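/- A multiplier Hopf $^*$-algebra is a complex $^*$-algebra $A$ with non-degenerate product and a non-degenerate coassociative $^*$-homomorphism $\Delta:A\to M(A\otimes A)$ such that $a\otimes a'\mapsto\Delta(a)(1\otimes a')$ and $a\otimes a'\mapsto(a\otimes1)\Delta(a')$ are injective with range $A\otimes A$; its counit and antipode are denoted by $\varepsilon$ and $S$, and we write $\Delta(a)=a_{(1)}\otimes a_{(2)}$. A positive left integral is a non-zero linear functional $\varphi$ on $A$ with $\varphi(a^*a)\ge 0$ and $(\iota\otimes\varphi)\Delta(a)=\varphi(a)1$ for all $a$. Its GNS space $\mathcal H$, with canonical map $\eta:A\to\mathcal H$, is the completion of $A$ for $\langle\eta(x'),\eta(x)\rangle=\varphi(x^*x')$. The map $V(x\otimes x')=\Delta(x')(x\otimes 1)$ is a bijection of $A\otimes A$; put $W=V^{-1}$. **Proposition.** Let $(A,\Delta)$ be a multiplier Hopf $^*$-algebra with a positive left integral $\varphi$. 1. There is a unique bounded operator $W$ on $\mathcal H\otimes\mathcal H$ (Hilbert space tensor product) with $W(\eta\otimes\eta)(t)=(\eta\otimes\eta)(Wt)$ for $t\in A\otimes A$, and it is unitary.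 For all $x,x'\in A$, $$W(\eta(x)\otimes\eta(x'))=\eta(S^{-1}(x'_{(1)})x)\otimes\eta(x'_{(2)}),\qquad W^*(\eta(x)\otimes\eta(x'))=\eta(x'_{(1)}x)\otimes\eta(x'_{(2)}).$$ It is called the left regular representation of $(A,\Delta)$. 2. Let $B=\{\varphi(\,\cdot\,a):a\in A\}$, and write $\langle a,b\rangle=b(a)$. Then $B$ is a multiplier Hopf $^*$-algebra with the product, involution and coproduct determined by $$\langle a,bb'\rangle=\langle\Delta(a),b\otimes b'\rangle,\qquad \langle a,b^*\rangle=\overline{\langle S(a)^*,b\rangle},\qquad \langle a\otimes a',\Delta(b)\rangle=\langle a'a,b\rangle$$ (so $B$ is the dual of $A$ with the opposite comultiplication), and $\varphi(\,\cdot\,a)\mapsto\varepsilon(a)$ is a positive left integral on $B$. Let $\hat{\mathcal H},\hat\eta$ be its GNS space and canonical map, and let $\hat W$ on $\hat{\mathcal H}\otimes\hat{\mathcal H}$ be the left regular representation of $(B,\Delta)$ obtained by applying part 1 to $B$. 3. There is a unitary $F:\mathcal H\to\hat{\mathcal H}$ with $F\eta(a)=\hat\eta(\varphi(\,\cdot\,a))$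 for all $a\in A$. The unitary $U=(F\otimes1)W(F\otimes1)^*$ on $\hat{\mathcal H}\otimes\mathcal H$ satisfies, for $y\in B$ and $x\in A$, $$U(\hat\eta(y)\otimes\eta(x))=\langle S^{-1}(x_{(1)}),y_{(1)}\rangle\,\hat\eta(y_{(2)})\otimes\eta(x_{(2)}).$$ Moreover, with $\Sigma$ the flip on $\hat{\mathcal H}\otimes\hat{\mathcal H}$, $$(F\otimes F)\,W\,(F\otimes F)^*=\Sigma\,\hat W^*\,\Sigma.$$ -/

import Mathlib

open scoped TensorProduct

universe u v

noncomputable section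

namespace AlgQG

/-! ### The `*`-algebra structure on an algebraic tensor product -/

section StarTensor

variable {A B : Type*}
  [NonUnitalRing A] [StarRing A] [Module ℂ A] [IsScalarTower ℂ A A] [SMulCommClass ℂ A A]
  [StarModule ℂ A]
  [NonUnitalRing B] [StarRing B] [Module ℂ B] [IsScalarTower ℂ B B] [SMulCommClass ℂ B B]
  [StarModule ℂ B]

/-- `A ⊗ B` is a `*`-algebra for `(a ⊗ b)^* = a^* ⊗ b^*`. -/
instance tensorStarRing : StarRing (A ⊗[ℂ] B) where
  star_add := star_add
  star_mul x y := by
    induction x using TensorProduct.induction_on with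
    | zero => simp
    | add x₁ x₂ h₁ h₂ => rw [add_mul, star_add, h₁, h₂, star_add, mul_add]
    | tmul a b =>
      induction y using TensorProduct.induction_on with
      | zero => simp
      | add y₁ y₂ h₁ h₂ => rw [mul_add, star_add, h₁, h₂, star_add, add_mul]
      | tmul c d => simp [Algebra.TensorProduct.tmul_mul_tmul]

end StarTensor

/-! ### The multiplier algebra -/

section Multiplier

variable (X : Type*) [NonUnitalRing X] [Module ℂ X] [IsScalarTower ℂ X X] [SMulCommClass ℂ X X]

/-- The (algebraic) multiplier algebra `M(X)`: pairs `(L, R)` of linear maps `X → X`, thought of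
as `L x = m x` and `R x = x m`, such that `x (L y) = (R x) y`, `L (x y) = (L x) y` and
`R (x y) = x (R y)`. Left multiplications compose in the usual order and right multiplications in
the opposite order, so this is a unital algebra under the componentwise operations. -/
def multiplierSubalgebra : Subalgebra ℂ (Module.End ℂ X × (Module.End ℂ X)ᵐᵒᵖ) where
  carrier := {m | (∀ x y, x * m.1 y = m.2.unop x * y) ∧ (∀ x y, m.1 (x * y) = m.1 x * y) ∧
    ∀ x y, m.2.unop (x * y) = x * m.2.unop y}
  mul_mem' := by
    rintro m n ⟨h1, h2, h3⟩ ⟨k1, k2, k3⟩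
    exact ⟨fun x y => by simp [h1, k1], fun x y => by simp [h2, k2], fun x y => by simp [h3, k3]⟩
  add_mem' := by
    rintro m n ⟨h1, h2, h3⟩ ⟨k1, k2, k3⟩
    exact ⟨fun x y => by simp [h1, k1, mul_add, add_mul],
      fun x y => by simp [h2, k2, add_mul], fun x y => by simp [h3, k3, mul_add]⟩
  algebraMap_mem' r := by
    refine ⟨fun x y => ?_, fun x y => ?_, fun x y => ?_⟩ <;>
    simp [Algebra.algebraMap_eq_smul_one, smul_mul_assoc, mul_smul_comm]

/-- The multiplier algebra `M(X)` as a type. -/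
def Multiplier : Type _ := multiplierSubalgebra X

instance : Ring (Multiplier X) := inferInstanceAs (Ring (multiplierSubalgebra X))

instance : Algebra ℂ (Multiplier X) := inferInstanceAs (Algebra ℂ (multiplierSubalgebra X))

variable {X}

namespace Multiplier

/-- Left multiplication `x ↦ m x`. -/
def left (m : Multiplier X) : X →ₗ[ℂ] X := m.1.1

/-- Right multiplication `x ↦ x m`. -/
def right (m : Multiplier X) : X →ₗ[ℂ] X := m.1.2.unop

theorem mul_left_eq (m : Multiplier X) (x y : X) : x * m.left y = m.right x * y := m.2.1 x y

theorem left_mul (m : Multiplier X) (x y : X) : m.left (x * y) = m.left x * y := m.2.2.1 x y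

theorem right_mul (m : Multiplier X) (x y : X) : m.right (x * y) = x * m.right y := m.2.2.2 x y

theorem ext' {m n : Multiplier X} (h : ∀ x, m.left x = n.left x)
    (k : ∀ x, m.right x = n.right x) : m = n :=
  Subtype.ext (Prod.ext (LinearMap.ext h) (MulOpposite.unop_injective (LinearMap.ext k)))

@[simp] theorem mul_left (m n : Multiplier X) (x : X) : (m * n).left x = m.left (n.left x) := rfl

@[simp] theorem mul_right (m n : Multiplier X) (x : X) :
    (m * n).right x = n.right (m.right x) := rfl

/-- The canonical map `X → M(X)`. -/
def incl (x : X) : Multiplier X :=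
  ⟨(LinearMap.mulLeft ℂ x, MulOpposite.op (LinearMap.mulRight ℂ x)),
    fun y z => by simp [mul_assoc], fun y z => by simp [mul_assoc], fun y z => by simp [mul_assoc]⟩

@[simp] theorem incl_left (x y : X) : (incl x).left y = x * y := rfl

@[simp] theorem incl_right (x y : X) : (incl x).right y = y * x := rfl

theorem mul_incl (m : Multiplier X) (x : X) : m * incl x = incl (m.left x) :=
  ext' (fun y => by simp [left_mul]) (fun y => by simp [mul_left_eq])

theorem incl_mul (m : Multiplier X) (x : X) : incl x * m = incl (m.right x) :=
  ext' (fun y => by simp [mul_left_eq]) (fun y => by simp [right_mul])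

variable [StarRing X] [StarModule ℂ X]

/-- The involution of `M(X)`: `m^* x = (x^* m)^*` and `x m^* = (m x^*)^*`. -/
instance : Star (Multiplier X) where
  star m :=
    ⟨({ toFun := fun x => star (m.right (star x))
        map_add' := fun x y => by simp
        map_smul' := fun c x => by simp },
      MulOpposite.op
      { toFun := fun x => star (m.left (star x))
        map_add' := fun x y => by simp
        map_smul' := fun c x => by simp }),
      fun x y => star_injective (by simp [mul_left_eq]),
      fun x y => by simp [right_mul], fun x y => by simp [left_mul]⟩

@[simp] theorem star_left (m : Multiplier X) (x : X) :
    (star m).left x = star (m.right (star x)) := rfl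

@[simp] theorem star_right (m : Multiplier X) (x : X) :
    (star m).right x = star (m.left (star x)) := rfl

theorem star_mul' (m n : Multiplier X) : star (m * n) = star n * star m :=
  ext' (fun x => by simp) (fun x => by simp)

theorem star_incl (x : X) : star (incl x) = incl (star x) :=
  ext' (fun y => by simp) (fun y => by simp)

end Multiplier

end Multiplier

section TensorMultiplier

variable {A : Type*} [NonUnitalRing A] [Module ℂ A] [IsScalarTower ℂ A A] [SMulCommClass ℂ A A]

/-- The multiplier `1 ⊗ a` of `A ⊗ A`. -/
def oneTmul (a : A) : Multiplier (A ⊗[ℂ] A) :=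
  ⟨(TensorProduct.map LinearMap.id (LinearMap.mulLeft ℂ a),
    MulOpposite.op (TensorProduct.map LinearMap.id (LinearMap.mulRight ℂ a))), by
    refine ⟨fun x y => ?_, fun x y => ?_, fun x y => ?_⟩ <;>
    · induction x using TensorProduct.induction_on with
      | zero => simp
      | add x₁ x₂ h₁ h₂ => simp only [add_mul, map_add, h₁, h₂]
      | tmul b c =>
        induction y using TensorProduct.induction_on with
        | zero => simp
        | add y₁ y₂ h₁ h₂ => simp only [mul_add, map_add, h₁, h₂]
        | tmul d e => simp [Algebra.TensorProduct.tmul_mul_tmul, mul_assoc]⟩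

/-- The multiplier `a ⊗ 1` of `A ⊗ A`. -/
def tmulOne (a : A) : Multiplier (A ⊗[ℂ] A) :=
  ⟨(TensorProduct.map (LinearMap.mulLeft ℂ a) LinearMap.id,
    MulOpposite.op (TensorProduct.map (LinearMap.mulRight ℂ a) LinearMap.id)), by
    refine ⟨fun x y => ?_, fun x y => ?_, fun x y => ?_⟩ <;>
    · induction x using TensorProduct.induction_on with
      | zero => simp
      | add x₁ x₂ h₁ h₂ => simp only [add_mul, map_add, h₁, h₂]
      | tmul b c =>
        induction y using TensorProduct.induction_on with
        | zero => simp
        | add y₁ y₂ h₁ h₂ => simp only [mul_add, map_add, h₁, h₂]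
        | tmul d e => simp [Algebra.TensorProduct.tmul_mul_tmul, mul_assoc]⟩

@[simp] theorem oneTmul_left (a b c : A) :
    (oneTmul a).left (b ⊗ₜ[ℂ] c) = b ⊗ₜ[ℂ] (a * c) := rfl

@[simp] theorem oneTmul_right (a b c : A) :
    (oneTmul a).right (b ⊗ₜ[ℂ] c) = b ⊗ₜ[ℂ] (c * a) := rfl

@[simp] theorem tmulOne_left (a b c : A) :
    (tmulOne a).left (b ⊗ₜ[ℂ] c) = (a * b) ⊗ₜ[ℂ] c := rfl

@[simp] theorem tmulOne_right (a b c : A) :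
    (tmulOne a).right (b ⊗ₜ[ℂ] c) = (b * a) ⊗ₜ[ℂ] c := rfl

@[simp] theorem tensor_incl_left (s t : A ⊗[ℂ] A) : (Multiplier.incl s).left t = s * t := rfl

theorem mult_ext {m n : Multiplier (A ⊗[ℂ] A)}
    (h : ∀ a b : A, m.left (a ⊗ₜ[ℂ] b) = n.left (a ⊗ₜ[ℂ] b))
    (k : ∀ a b : A, m.right (a ⊗ₜ[ℂ] b) = n.right (a ⊗ₜ[ℂ] b)) : m = n :=
  Multiplier.ext' (fun x => LinearMap.congr_fun (TensorProduct.ext' h) x)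
    (fun x => LinearMap.congr_fun (TensorProduct.ext' k) x)

theorem tmulOne_mul_oneTmul (a b : A) :
    tmulOne a * oneTmul b = Multiplier.incl (a ⊗ₜ[ℂ] b) :=
  mult_ext (fun c d => by simp [Algebra.TensorProduct.tmul_mul_tmul])
    (fun c d => by simp [Algebra.TensorProduct.tmul_mul_tmul])

theorem oneTmul_mul (a b : A) : oneTmul (a * b) = oneTmul a * oneTmul b :=
  mult_ext (fun c d => by simp [mul_assoc]) (fun c d => by simp [mul_assoc])

theorem star_tmulOne [StarRing A] [StarModule ℂ A] (a : A) :
    star (tmulOne a) = tmulOne (star a) :=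
  mult_ext (fun c d => by simp) (fun c d => by simp)

/-- If the product of `A` is non-degenerate, so is that of `A ⊗ A`. -/
theorem incl_tensor_injective (h : ∀ a : A, (∀ b, a * b = 0) → a = 0) :
    Function.Injective (Multiplier.incl : A ⊗[ℂ] A → Multiplier (A ⊗[ℂ] A)) := by
  classical
  intro s t hst
  rw [← sub_eq_zero]
  have h0 : ∀ a b : A, (s - t) * (a ⊗ₜ[ℂ] b) = 0 := fun a b => by
    have := congrArg (fun m => Multiplier.left m (a ⊗ₜ[ℂ] b)) hst
    simpa [sub_mul, sub_eq_zero] using this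
  generalize s - t = w at h0
  have hmul : ∀ a b : A, ∀ z : A ⊗[ℂ] A, z * (a ⊗ₜ[ℂ] b) =
      TensorProduct.map (LinearMap.mulRight ℂ a) (LinearMap.mulRight ℂ b) z := fun a b z => by
    induction z using TensorProduct.induction_on with
    | zero => simp
    | add x y hx hy => rw [add_mul, hx, hy, map_add]
    | tmul c d => simp [Algebra.TensorProduct.tmul_mul_tmul]
  have key : ∀ z : A ⊗[ℂ] A, (∀ f : Module.Dual ℂ A,
      TensorProduct.lid ℂ A (TensorProduct.map f LinearMap.id z) = 0) → z = 0 := fun z hz => by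
    let B := Module.Basis.ofVectorSpace ℂ A
    apply (TensorProduct.equivFinsuppOfBasisLeft B).injective
    rw [map_zero]
    ext i
    rw [Finsupp.zero_apply, ← hz (B.coord i)]
    generalize z = z'
    induction z' using TensorProduct.induction_on with
    | zero => simp
    | add x y hx hy => simp only [map_add, Finsupp.add_apply, hx, hy]
    | tmul c d => simp
  have key' : ∀ z : A ⊗[ℂ] A, (∀ f : Module.Dual ℂ A,
      TensorProduct.rid ℂ A (TensorProduct.map LinearMap.id f z) = 0) → z = 0 := fun z hz => by
    let B := Module.Basis.ofVectorSpace ℂ A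
    apply (TensorProduct.equivFinsuppOfBasisRight B).injective
    rw [map_zero]
    ext i
    rw [Finsupp.zero_apply, ← hz (B.coord i)]
    generalize z = z'
    induction z' using TensorProduct.induction_on with
    | zero => simp
    | add x y hx hy => simp only [map_add, Finsupp.add_apply, hx, hy]
    | tmul c d => simp
  have step : ∀ b : A, TensorProduct.map LinearMap.id (LinearMap.mulRight ℂ b) w = 0 :=
    fun b => by
    refine key' _ fun f => h _ fun a => ?_
    have h1 := congrArg
      (fun z => TensorProduct.rid ℂ A (TensorProduct.map LinearMap.id f z)) (h0 a b)
    rw [hmul] at h1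
    rw [← LinearMap.mulRight_apply (R := ℂ)]
    simp only [map_zero] at h1
    rw [← h1]
    generalize w = w'
    induction w' using TensorProduct.induction_on with
    | zero => simp
    | add x y hx hy => simp only [map_add, hx, hy]
    | tmul c d => simp
  refine key _ fun f => h _ fun b => ?_
  have h1 := congrArg
      (fun z => TensorProduct.lid ℂ A (TensorProduct.map f LinearMap.id z)) (step b)
  rw [← LinearMap.mulRight_apply (R := ℂ)]
  simp only [map_zero] at h1
  rw [← h1]
  generalize w = w'
  induction w' using TensorProduct.induction_on with
  | zero => simp
  | add x y hx hy => simp only [map_add, hx, hy]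
  | tmul c d => simp

end TensorMultiplier

/-! ### Multiplier Hopf `*`-algebras -/

/-- A multiplier Hopf `*`-algebra: a `*`-algebra `A` with non-degenerate product, together with a
non-degenerate coassociative `*`-homomorphism `Δ : A → M(A ⊗ A)` for which
`a ⊗ a' ↦ Δ(a)(1 ⊗ a')` and `a ⊗ a' ↦ (a ⊗ 1)Δ(a')` are injective with range `A ⊗ A`. These two
maps, seen as linear bijections of `A ⊗ A`, are the fields `T₁` and `T₂` (they are determined by
`Δ`). Coassociativity is the usual covered form of `(Δ ⊗ ι)Δ = (ι ⊗ Δ)Δ`, namely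
`(a ⊗ 1 ⊗ 1)(Δ ⊗ ι)(Δ(b)(1 ⊗ c)) = (ι ⊗ Δ)((a ⊗ 1)Δ(b))(1 ⊗ 1 ⊗ c)`, in which the left side is
`(T₂ ⊗ ι)(a ⊗ T₁(b ⊗ c))` and the right side is `(ι ⊗ T₁)(T₂(a ⊗ b) ⊗ c)`. -/
structure MultiplierHopfStarAlgebra (A : Type*) [NonUnitalRing A] [StarRing A] [Module ℂ A]
    [IsScalarTower ℂ A A] [SMulCommClass ℂ A A] [StarModule ℂ A] where
  eq_zero_of_mul_right : ∀ a : A, (∀ b, a * b = 0) → a = 0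
  eq_zero_of_mul_left : ∀ a : A, (∀ b, b * a = 0) → a = 0
  /-- The comultiplication. -/
  Δ : A →⋆ₙₐ[ℂ] Multiplier (A ⊗[ℂ] A)
  Δ_nondegenerate : Submodule.span ℂ {z : A ⊗[ℂ] A | ∃ a w, z = (Δ a).left w} = ⊤
  /-- The map `a ⊗ a' ↦ Δ(a)(1 ⊗ a')`. -/
  T₁ : (A ⊗[ℂ] A) ≃ₗ[ℂ] (A ⊗[ℂ] A)
  T₁_spec : ∀ a a' : A, Multiplier.incl (T₁ (a ⊗ₜ[ℂ] a')) = Δ a * oneTmul a'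
  /-- The map `a ⊗ a' ↦ (a ⊗ 1)Δ(a')`. -/
  T₂ : (A ⊗[ℂ] A) ≃ₗ[ℂ] (A ⊗[ℂ] A)
  T₂_spec : ∀ a a' : A, Multiplier.incl (T₂ (a ⊗ₜ[ℂ] a')) = tmulOne a * Δ a'
  coassoc : ∀ a b c : A,
    TensorProduct.assoc ℂ A A A (TensorProduct.map T₂.toLinearMap LinearMap.id
      ((TensorProduct.assoc ℂ A A A).symm (a ⊗ₜ[ℂ] T₁ (b ⊗ₜ[ℂ] c)))) =
    TensorProduct.map LinearMap.id T₁.toLinearMap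
      (TensorProduct.assoc ℂ A A A (T₂ (a ⊗ₜ[ℂ] b) ⊗ₜ[ℂ] c))

namespace MultiplierHopfStarAlgebra

variable {A : Type*} [NonUnitalRing A] [StarRing A] [Module ℂ A]
    [IsScalarTower ℂ A A] [SMulCommClass ℂ A A] [StarModule ℂ A]
    (𝒜 : MultiplierHopfStarAlgebra A)

/-- The map `V : x ⊗ x' ↦ Δ(x')(x ⊗ 1)` of `A ⊗ A`, as `Δ(x')(x ⊗ 1) = ((x^* ⊗ 1)Δ(x'^*))^*`;
see `V_spec`. -/
def V : (A ⊗[ℂ] A) ≃ₗ[ℂ] (A ⊗[ℂ] A) :=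
  (starLinearEquiv ℂ (A := A ⊗[ℂ] A)).trans
    (𝒜.T₂.trans (starLinearEquiv ℂ (A := A ⊗[ℂ] A)))

theorem V_apply (t : A ⊗[ℂ] A) : 𝒜.V t = star (𝒜.T₂ (star t)) := rfl

theorem V_spec (x x' : A) :
    Multiplier.incl (𝒜.V (x ⊗ₜ[ℂ] x')) = 𝒜.Δ x' * tmulOne x := by
  rw [V_apply, ← Multiplier.star_incl, TensorProduct.star_tmul, T₂_spec, Multiplier.star_mul',
    star_tmulOne, star_star, ← map_star, star_star]

/-- The map `W = V⁻¹`, formally `x ⊗ x' ↦ S⁻¹(x'₍₁₎)x ⊗ x'₍₂₎`. -/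
def W : (A ⊗[ℂ] A) ≃ₗ[ℂ] (A ⊗[ℂ] A) := 𝒜.V.symm

/-! #### Construction of the counit and the antipode -/

theorem incl_inj (𝒜 : MultiplierHopfStarAlgebra A) {s t : A ⊗[ℂ] A} (h : Multiplier.incl s = Multiplier.incl t) : s = t :=
  incl_tensor_injective 𝒜.eq_zero_of_mul_right h

theorem Δ_left_T₁ (a : A) (t : A ⊗[ℂ] A) : (𝒜.Δ a).left (𝒜.T₁ t) = 𝒜.T₁ ((tmulOne a).left t) := by
  have : (𝒜.Δ a).left ∘ₗ 𝒜.T₁.toLinearMap = 𝒜.T₁.toLinearMap ∘ₗ (tmulOne a).left := by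
    refine TensorProduct.ext' fun b c => 𝒜.incl_inj ?_
    simp only [LinearMap.comp_apply, LinearEquiv.coe_coe, tmulOne_left]
    rw [← Multiplier.mul_incl, T₁_spec, T₁_spec, map_mul, mul_assoc]
  exact LinearMap.congr_fun this t

theorem T₁_right (t : A ⊗[ℂ] A) (c : A) :
    𝒜.T₁ ((oneTmul c).right t) = (oneTmul c).right (𝒜.T₁ t) := by
  have : 𝒜.T₁.toLinearMap ∘ₗ (oneTmul c).right = (oneTmul c).right ∘ₗ 𝒜.T₁.toLinearMap := by
    refine TensorProduct.ext' fun b d => 𝒜.incl_inj ?_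
    simp only [LinearMap.comp_apply, LinearEquiv.coe_coe, oneTmul_right]
    rw [← Multiplier.incl_mul, T₁_spec, T₁_spec, oneTmul_mul, mul_assoc]
  exact LinearMap.congr_fun this t

theorem T₁_symm_right (t : A ⊗[ℂ] A) (c : A) :
    𝒜.T₁.symm ((oneTmul c).right t) = (oneTmul c).right (𝒜.T₁.symm t) := by
  rw [LinearEquiv.symm_apply_eq, T₁_right, LinearEquiv.apply_symm_apply]

theorem T₁_symm_Δ_left (a : A) (t : A ⊗[ℂ] A) :
    𝒜.T₁.symm ((𝒜.Δ a).left t) = (tmulOne a).left (𝒜.T₁.symm t) := by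
  rw [LinearEquiv.symm_apply_eq, ← Δ_left_T₁, LinearEquiv.apply_symm_apply]

theorem T₁_mul (a c b d : A) :
    𝒜.T₁ (a ⊗ₜ[ℂ] c) * (b ⊗ₜ[ℂ] d) = (𝒜.Δ a).left (b ⊗ₜ[ℂ] (c * d)) := by
  have := congrArg (fun m => Multiplier.left m (b ⊗ₜ[ℂ] d)) (𝒜.T₁_spec a c)
  simpa using this

theorem V_mul (x a b d : A) :
    𝒜.V (x ⊗ₜ[ℂ] a) * (b ⊗ₜ[ℂ] d) = (𝒜.Δ a).left ((x * b) ⊗ₜ[ℂ] d) := by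
  have := congrArg (fun m => Multiplier.left m (b ⊗ₜ[ℂ] d)) (𝒜.V_spec x a)
  simpa using this

theorem T₂_mul (x a b d : A) :
    𝒜.T₂ (x ⊗ₜ[ℂ] a) * (b ⊗ₜ[ℂ] d) = (tmulOne x).left ((𝒜.Δ a).left (b ⊗ₜ[ℂ] d)) := by
  have := congrArg (fun m => Multiplier.left m (b ⊗ₜ[ℂ] d)) (𝒜.T₂_spec x a)
  simpa using this

theorem V_right (x a b : A) :
    (oneTmul b).right (𝒜.V (x ⊗ₜ[ℂ] a)) = (𝒜.Δ a).left (x ⊗ₜ[ℂ] b) := by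
  apply 𝒜.incl_inj
  rw [← Multiplier.incl_mul, V_spec, mul_assoc, tmulOne_mul_oneTmul, Multiplier.mul_incl]

theorem T₂_right_eq (a b c : A) :
    (oneTmul c).right (𝒜.T₂ (a ⊗ₜ[ℂ] b)) = (tmulOne a).left (𝒜.T₁ (b ⊗ₜ[ℂ] c)) := by
  apply 𝒜.incl_inj
  rw [← Multiplier.incl_mul, T₂_spec, ← Multiplier.mul_incl, T₁_spec, mul_assoc]

theorem ext_T₁ {M : Type*} [AddCommGroup M] [Module ℂ M] {f g : A ⊗[ℂ] A →ₗ[ℂ] M}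
    (h : ∀ a b, f (𝒜.T₁ (a ⊗ₜ[ℂ] b)) = g (𝒜.T₁ (a ⊗ₜ[ℂ] b))) : f = g := by
  have : f ∘ₗ 𝒜.T₁.toLinearMap = g ∘ₗ 𝒜.T₁.toLinearMap := TensorProduct.ext' h
  ext1
  ext a b
  have := LinearMap.congr_fun this (𝒜.T₁.symm (a ⊗ₜ[ℂ] b))
  simpa using this

theorem ext_T₂ {M : Type*} [AddCommGroup M] [Module ℂ M] {f g : A ⊗[ℂ] A →ₗ[ℂ] M}
    (h : ∀ a b, f (𝒜.T₂ (a ⊗ₜ[ℂ] b)) = g (𝒜.T₂ (a ⊗ₜ[ℂ] b))) : f = g := by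
  have : f ∘ₗ 𝒜.T₂.toLinearMap = g ∘ₗ 𝒜.T₂.toLinearMap := TensorProduct.ext' h
  ext1
  ext a b
  have := LinearMap.congr_fun this (𝒜.T₂.symm (a ⊗ₜ[ℂ] b))
  simpa using this

theorem ext_V {M : Type*} [AddCommGroup M] [Module ℂ M] {f g : A ⊗[ℂ] A →ₗ[ℂ] M}
    (h : ∀ a b, f (𝒜.V (a ⊗ₜ[ℂ] b)) = g (𝒜.V (a ⊗ₜ[ℂ] b))) : f = g := by
  have : f ∘ₗ 𝒜.V.toLinearMap = g ∘ₗ 𝒜.V.toLinearMap := TensorProduct.ext' h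
  ext1
  ext a b
  have := LinearMap.congr_fun this (𝒜.V.symm (a ⊗ₜ[ℂ] b))
  simpa using this

theorem coassoc_symm (a b c : A) :
    TensorProduct.map LinearMap.id 𝒜.T₁.symm.toLinearMap
      (TensorProduct.assoc ℂ A A A (𝒜.T₂ (a ⊗ₜ[ℂ] b) ⊗ₜ[ℂ] c)) =
    TensorProduct.assoc ℂ A A A (TensorProduct.map 𝒜.T₂.toLinearMap LinearMap.id
      ((TensorProduct.assoc ℂ A A A).symm (a ⊗ₜ[ℂ] 𝒜.T₁.symm (b ⊗ₜ[ℂ] c)))) := by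
  have h1 : ∀ t : A ⊗[ℂ] A,
      TensorProduct.assoc ℂ A A A (TensorProduct.map 𝒜.T₂.toLinearMap LinearMap.id
        ((TensorProduct.assoc ℂ A A A).symm (a ⊗ₜ[ℂ] 𝒜.T₁ t))) =
      TensorProduct.map LinearMap.id 𝒜.T₁.toLinearMap
        (TensorProduct.assoc ℂ A A A (TensorProduct.map 𝒜.T₂.toLinearMap LinearMap.id
          ((TensorProduct.assoc ℂ A A A).symm (a ⊗ₜ[ℂ] t)))) := fun t => by
    induction t using TensorProduct.induction_on with
    | zero => simp
    | add x y hx hy => simp only [map_add, TensorProduct.tmul_add, hx, hy]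
    | tmul b c => rw [𝒜.coassoc]; simp
  have h2 := h1 (𝒜.T₁.symm (b ⊗ₜ[ℂ] c))
  rw [LinearEquiv.apply_symm_apply] at h2
  have h3 := congrArg (TensorProduct.map (LinearMap.id : A →ₗ[ℂ] A) 𝒜.T₁.symm.toLinearMap) h2
  rw [← LinearMap.comp_apply (TensorProduct.map _ 𝒜.T₁.symm.toLinearMap) (TensorProduct.map _ _),
    ← TensorProduct.map_comp] at h3
  simpa using h3

theorem counit_aux (t : A ⊗[ℂ] A) (b : A) :
    TensorProduct.map LinearMap.id (LinearMap.mul' ℂ A ∘ₗ 𝒜.T₁.symm.toLinearMap)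
      (TensorProduct.assoc ℂ A A A (t ⊗ₜ[ℂ] b)) =
    (LinearMap.mul' ℂ A (𝒜.T₂.symm t)) ⊗ₜ[ℂ] b := by
  obtain ⟨s, rfl⟩ := 𝒜.T₂.surjective t
  rw [LinearEquiv.symm_apply_apply]
  induction s using TensorProduct.induction_on with
  | zero => simp
  | add x y hx hy => simp only [map_add, TensorProduct.add_tmul, hx, hy]
  | tmul c a =>
    have h1 : ∀ s : A ⊗[ℂ] A, TensorProduct.map LinearMap.id (LinearMap.mul' ℂ A)
        (TensorProduct.assoc ℂ A A A (TensorProduct.map 𝒜.T₂.toLinearMap LinearMap.id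
          ((TensorProduct.assoc ℂ A A A).symm (c ⊗ₜ[ℂ] s)))) = (tmulOne c).left (𝒜.T₁ s) := by
      intro s
      induction s using TensorProduct.induction_on with
      | zero => simp
      | add x y hx hy => simp only [map_add, TensorProduct.tmul_add, hx, hy]
      | tmul a b =>
        rw [← T₂_right_eq]
        simp only [TensorProduct.assoc_symm_tmul, TensorProduct.map_tmul, LinearMap.id_apply,
          LinearEquiv.coe_coe]
        generalize 𝒜.T₂ (c ⊗ₜ[ℂ] a) = w
        induction w using TensorProduct.induction_on with
        | zero => simp
        | add x y hx hy => simp only [map_add, TensorProduct.add_tmul, hx, hy]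
        | tmul p q => simp
    have h2 := h1 (𝒜.T₁.symm (a ⊗ₜ[ℂ] b))
    rw [← coassoc_symm, ← LinearMap.comp_apply (TensorProduct.map _ _) (TensorProduct.map _ _),
      ← TensorProduct.map_comp, LinearMap.id_comp] at h2
    rw [h2]
    simp

theorem exists_counit : ∃ ε : Module.Dual ℂ A,
    (∀ a b : A, TensorProduct.lid ℂ A (TensorProduct.map ε LinearMap.id (𝒜.T₁ (a ⊗ₜ[ℂ] b))) =
      a * b) ∧
    (∀ a b : A, TensorProduct.rid ℂ A (TensorProduct.map LinearMap.id ε (𝒜.T₂ (a ⊗ₜ[ℂ] b))) =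
      a * b) := by
  rcases subsingleton_or_nontrivial A with hA | hA
  · exact ⟨0, fun a b => Subsingleton.elim _ _, fun a b => Subsingleton.elim _ _⟩
  obtain ⟨p₀, hp₀⟩ := exists_ne (0 : A)
  obtain ⟨ω, hω⟩ := Module.Projective.exists_dual_eq_one ℂ hp₀
  have aux : ∀ p q b : A, p ⊗ₜ[ℂ] (LinearMap.mul' ℂ A (𝒜.T₁.symm (q ⊗ₜ[ℂ] b))) =
      (LinearMap.mul' ℂ A (𝒜.T₂.symm (p ⊗ₜ[ℂ] q))) ⊗ₜ[ℂ] b := fun p q b => by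
    simpa using 𝒜.counit_aux (p ⊗ₜ[ℂ] q) b
  let ε : Module.Dual ℂ A :=
    ω ∘ₗ LinearMap.mul' ℂ A ∘ₗ 𝒜.T₂.symm.toLinearMap ∘ₗ TensorProduct.mk ℂ A A p₀
  have h1 : ∀ q b : A, LinearMap.mul' ℂ A (𝒜.T₁.symm (q ⊗ₜ[ℂ] b)) = ε q • b := fun q b => by
    have := congrArg (fun z => TensorProduct.lid ℂ A (TensorProduct.map ω LinearMap.id z))
      (aux p₀ q b)
    simpa [hω, ε] using this
  have h2 : ∀ p q : A, LinearMap.mul' ℂ A (𝒜.T₂.symm (p ⊗ₜ[ℂ] q)) = ε q • p := fun p q => by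
    have h := aux p q p₀
    rw [h1, TensorProduct.tmul_smul] at h
    have := congrArg (fun z => TensorProduct.rid ℂ A (TensorProduct.map LinearMap.id ω z)) h
    simpa [hω] using this.symm
  refine ⟨ε, fun a b => ?_, fun a b => ?_⟩
  · have : (TensorProduct.lid ℂ A).toLinearMap ∘ₗ TensorProduct.map ε LinearMap.id =
        LinearMap.mul' ℂ A ∘ₗ 𝒜.T₁.symm.toLinearMap :=
      TensorProduct.ext' fun q b => by simp [h1]
    simpa using LinearMap.congr_fun this (𝒜.T₁ (a ⊗ₜ[ℂ] b))
  · have : (TensorProduct.rid ℂ A).toLinearMap ∘ₗ TensorProduct.map LinearMap.id ε =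
        LinearMap.mul' ℂ A ∘ₗ 𝒜.T₂.symm.toLinearMap :=
      TensorProduct.ext' fun q b => by simp [h2]
    simpa using LinearMap.congr_fun this (𝒜.T₂ (a ⊗ₜ[ℂ] b))

/-- The counit `ε`, characterized by `(ε ⊗ ι)Δ(a) = a` and `(ι ⊗ ε)Δ(a) = a`. -/
def counit : Module.Dual ℂ A := 𝒜.exists_counit.choose

theorem counit_T₁ (t : A ⊗[ℂ] A) :
    TensorProduct.lid ℂ A (TensorProduct.map 𝒜.counit LinearMap.id (𝒜.T₁ t)) =
      LinearMap.mul' ℂ A t := by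
  have : (TensorProduct.lid ℂ A).toLinearMap ∘ₗ TensorProduct.map 𝒜.counit LinearMap.id ∘ₗ
      𝒜.T₁.toLinearMap = LinearMap.mul' ℂ A :=
    TensorProduct.ext' fun a b => 𝒜.exists_counit.choose_spec.1 a b
  exact LinearMap.congr_fun this t

theorem counit_T₂ (t : A ⊗[ℂ] A) :
    TensorProduct.rid ℂ A (TensorProduct.map LinearMap.id 𝒜.counit (𝒜.T₂ t)) =
      LinearMap.mul' ℂ A t := by
  have : (TensorProduct.rid ℂ A).toLinearMap ∘ₗ TensorProduct.map LinearMap.id 𝒜.counit ∘ₗ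
      𝒜.T₂.toLinearMap = LinearMap.mul' ℂ A :=
    TensorProduct.ext' fun a b => 𝒜.exists_counit.choose_spec.2 a b
  exact LinearMap.congr_fun this t

theorem mul_T₁_symm (a b : A) :
    LinearMap.mul' ℂ A (𝒜.T₁.symm (a ⊗ₜ[ℂ] b)) = 𝒜.counit a • b := by
  rw [← counit_T₁, LinearEquiv.apply_symm_apply]; simp

theorem mul_T₂_symm (a b : A) :
    LinearMap.mul' ℂ A (𝒜.T₂.symm (a ⊗ₜ[ℂ] b)) = 𝒜.counit b • a := by
  rw [← counit_T₂, LinearEquiv.apply_symm_apply]; simp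

theorem exists_mul_ne_zero [Nontrivial A] (𝒜 : MultiplierHopfStarAlgebra A) :
    ∃ a b : A, a * b ≠ 0 := by
  obtain ⟨p₀, hp₀⟩ := exists_ne (0 : A)
  by_contra! h
  exact hp₀ (𝒜.eq_zero_of_mul_right p₀ (h p₀))

theorem counit_ne_zero [Nontrivial A] : ∃ e : A, 𝒜.counit e = 1 := by
  obtain ⟨a, b, hab⟩ := 𝒜.exists_mul_ne_zero
  by_contra! h
  have h0 : 𝒜.counit = 0 := by
    ext e
    by_contra he
    exact h ((𝒜.counit e)⁻¹ • e) (by simpa using inv_mul_cancel₀ he)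
  have := 𝒜.counit_T₁ (a ⊗ₜ[ℂ] b)
  rw [h0] at this
  simp at this
  exact hab this.symm

theorem counit_Δ_left (a : A) (t : A ⊗[ℂ] A) :
    TensorProduct.lid ℂ A (TensorProduct.map 𝒜.counit LinearMap.id ((𝒜.Δ a).left t)) =
      a * TensorProduct.lid ℂ A (TensorProduct.map 𝒜.counit LinearMap.id t) := by
  obtain ⟨t, rfl⟩ := 𝒜.T₁.surjective t
  rw [Δ_left_T₁, counit_T₁, counit_T₁]
  induction t using TensorProduct.induction_on with
  | zero => simp
  | add x y hx hy => simp only [map_add, hx, hy, mul_add]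
  | tmul b c => simp [mul_assoc]

theorem counit_mul (a b : A) : 𝒜.counit (a * b) = 𝒜.counit a * 𝒜.counit b := by
  rcases subsingleton_or_nontrivial A with hA | hA
  · simp [Subsingleton.elim a 0]
  have h : ∀ b d : A, (TensorProduct.lid ℂ A).toLinearMap ∘ₗ
      TensorProduct.map 𝒜.counit LinearMap.id ∘ₗ LinearMap.mulRight ℂ (b ⊗ₜ[ℂ] d) =
      𝒜.counit b • (LinearMap.mulRight ℂ d ∘ₗ (TensorProduct.lid ℂ A).toLinearMap ∘ₗ
        TensorProduct.map 𝒜.counit LinearMap.id) := fun b d => by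
    refine 𝒜.ext_T₁ fun a c => ?_
    simp only [LinearMap.comp_apply, LinearMap.smul_apply, LinearEquiv.coe_coe,
      LinearMap.mulRight_apply]
    rw [T₁_mul, counit_Δ_left, counit_T₁]
    simp [mul_assoc, mul_smul_comm]
  obtain ⟨q, d, hqd⟩ := 𝒜.exists_mul_ne_zero
  have := LinearMap.congr_fun (h b d) (a ⊗ₜ[ℂ] q)
  simp only [LinearMap.comp_apply, LinearMap.smul_apply, LinearEquiv.coe_coe,
      LinearMap.mulRight_apply, Algebra.TensorProduct.tmul_mul_tmul, TensorProduct.map_tmul,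
      TensorProduct.lid_tmul, LinearMap.id_apply, smul_mul_assoc, smul_smul] at this
  rw [mul_comm (𝒜.counit a)]
  exact smul_left_injective ℂ hqd this

/-- `K (p ⊗ q) = S(p)q`. -/
theorem K_right (c : A) (t : A ⊗[ℂ] A) :
    TensorProduct.lid ℂ A (TensorProduct.map 𝒜.counit LinearMap.id
      (𝒜.T₁.symm ((oneTmul c).right t))) =
    TensorProduct.lid ℂ A (TensorProduct.map 𝒜.counit LinearMap.id (𝒜.T₁.symm t)) * c := by
  rw [T₁_symm_right]
  generalize 𝒜.T₁.symm t = s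
  induction s using TensorProduct.induction_on with
  | zero => simp
  | add x y hx hy => simp only [map_add, hx, hy, add_mul]
  | tmul a b => simp [smul_mul_assoc]

theorem K_Δ_left (a : A) (t : A ⊗[ℂ] A) :
    TensorProduct.lid ℂ A (TensorProduct.map 𝒜.counit LinearMap.id
      (𝒜.T₁.symm ((𝒜.Δ a).left t))) =
    𝒜.counit a • TensorProduct.lid ℂ A
      (TensorProduct.map 𝒜.counit LinearMap.id (𝒜.T₁.symm t)) := by
  rw [T₁_symm_Δ_left]
  generalize 𝒜.T₁.symm t = s
  induction s using TensorProduct.induction_on with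
  | zero => simp
  | add x y hx hy => simp only [map_add, hx, hy, smul_add]
  | tmul b c => simp [counit_mul, smul_smul]

theorem exists_antipode_aux : ∃ S : A →ₗ[ℂ] A,
    (∀ a b : A, S a * b =
      TensorProduct.lid ℂ A (TensorProduct.map 𝒜.counit LinearMap.id
        (𝒜.T₁.symm (a ⊗ₜ[ℂ] b)))) := by
  rcases subsingleton_or_nontrivial A with hA | hA
  · exact ⟨0, fun a b => Subsingleton.elim _ _⟩
  obtain ⟨e, he⟩ := 𝒜.counit_ne_zero
  refine ⟨(TensorProduct.lid ℂ A).toLinearMap ∘ₗ TensorProduct.map 𝒜.counit LinearMap.id ∘ₗ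
    𝒜.T₁.symm.toLinearMap ∘ₗ 𝒜.V.toLinearMap ∘ₗ (TensorProduct.mk ℂ A A).flip e, fun a b => ?_⟩
  simp only [LinearMap.comp_apply, LinearEquiv.coe_coe, LinearMap.flip_apply,
    TensorProduct.mk_apply]
  rw [← K_right, V_right, K_Δ_left, he, one_smul]

theorem exists_antipode_aux' : ∃ S : A →ₗ[ℂ] A,
    (∀ a b : A, LinearMap.mul' ℂ A (TensorProduct.map S LinearMap.id (𝒜.T₁ (a ⊗ₜ[ℂ] b))) =
      𝒜.counit a • b) ∧
    (∀ a b : A, LinearMap.mul' ℂ A (TensorProduct.map LinearMap.id S (𝒜.T₂ (a ⊗ₜ[ℂ] b))) =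
      𝒜.counit b • a) := by
  obtain ⟨S, hS⟩ := 𝒜.exists_antipode_aux
  have hK : LinearMap.mul' ℂ A ∘ₗ TensorProduct.map S LinearMap.id =
      (TensorProduct.lid ℂ A).toLinearMap ∘ₗ TensorProduct.map 𝒜.counit LinearMap.id ∘ₗ
        𝒜.T₁.symm.toLinearMap := TensorProduct.ext' fun a b => by simp [hS]
  -- `T₂⁻¹(b ⊗ a)` and `T₁⁻¹(a ⊗ c)` combine to an element of the triple tensor product
  have key : ∀ a b c : A,
      TensorProduct.rid ℂ A (TensorProduct.map LinearMap.id 𝒜.counit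
        (𝒜.T₂.symm (b ⊗ₜ[ℂ] a))) * c = b * (S a * c) := by
    intro a b c
    have h1 : ∀ t : A ⊗[ℂ] A, ∀ c : A, LinearMap.mul' ℂ A (TensorProduct.map LinearMap.id
        (LinearMap.mul' ℂ A ∘ₗ 𝒜.T₁.symm.toLinearMap)
          (TensorProduct.assoc ℂ A A A (t ⊗ₜ[ℂ] c))) =
        TensorProduct.rid ℂ A (TensorProduct.map LinearMap.id 𝒜.counit t) * c := fun t c => by
      induction t using TensorProduct.induction_on with
      | zero => simp
      | add x y hx hy => simp only [map_add, TensorProduct.add_tmul, hx, hy, add_mul]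
      | tmul p q => simp [mul_T₁_symm, smul_mul_assoc]
    have h2 : ∀ t : A ⊗[ℂ] A, LinearMap.mul' ℂ A (TensorProduct.map
        (LinearMap.mul' ℂ A ∘ₗ 𝒜.T₂.symm.toLinearMap) LinearMap.id
          ((TensorProduct.assoc ℂ A A A).symm (b ⊗ₜ[ℂ] t))) =
        b * TensorProduct.lid ℂ A (TensorProduct.map 𝒜.counit LinearMap.id t) := fun t => by
      induction t using TensorProduct.induction_on with
      | zero => simp
      | add x y hx hy => simp only [map_add, TensorProduct.tmul_add, hx, hy, mul_add]
      | tmul p q => simp [mul_T₂_symm, mul_smul_comm, smul_mul_assoc]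
    have h3 : ∀ s : A ⊗[ℂ] A, TensorProduct.map LinearMap.id 𝒜.T₁.symm.toLinearMap
        (TensorProduct.assoc ℂ A A A (𝒜.T₂ s ⊗ₜ[ℂ] c)) =
      TensorProduct.assoc ℂ A A A (TensorProduct.map 𝒜.T₂.toLinearMap LinearMap.id
        ((TensorProduct.assoc ℂ A A A).symm (TensorProduct.map LinearMap.id 𝒜.T₁.symm.toLinearMap
          (TensorProduct.assoc ℂ A A A (s ⊗ₜ[ℂ] c))))) := fun s => by
      induction s using TensorProduct.induction_on with
      | zero => simp
      | add x y hx hy => simp only [map_add, TensorProduct.add_tmul, hx, hy]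
      | tmul p q => rw [coassoc_symm]; simp
    have h4 := h3 (𝒜.T₂.symm (b ⊗ₜ[ℂ] a))
    rw [LinearEquiv.apply_symm_apply] at h4
    have h5 : ∀ u : A ⊗[ℂ] (A ⊗[ℂ] A),
        LinearMap.mul' ℂ A (TensorProduct.map
        (LinearMap.mul' ℂ A ∘ₗ 𝒜.T₂.symm.toLinearMap) LinearMap.id
          ((TensorProduct.assoc ℂ A A A).symm (TensorProduct.assoc ℂ A A A
            (TensorProduct.map 𝒜.T₂.toLinearMap LinearMap.id
            ((TensorProduct.assoc ℂ A A A).symm u))))) =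
        LinearMap.mul' ℂ A (TensorProduct.map LinearMap.id (LinearMap.mul' ℂ A) u) := fun u => by
      induction u using TensorProduct.induction_on with
      | zero => simp
      | add x y hx hy => simp only [map_add, hx, hy]
      | tmul p v =>
        induction v using TensorProduct.induction_on with
        | zero => simp
        | add x y hx hy => simp only [map_add, TensorProduct.tmul_add, hx, hy]
        | tmul q r => simp [mul_assoc]
    rw [TensorProduct.assoc_tmul, TensorProduct.map_tmul, LinearMap.id_apply,
      LinearEquiv.coe_coe] at h4
    rw [hS, ← h2, ← (TensorProduct.assoc ℂ A A A).apply_symm_apply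
      (b ⊗ₜ[ℂ] 𝒜.T₁.symm (a ⊗ₜ[ℂ] c)), h4, LinearEquiv.apply_symm_apply, h5,
      ← LinearMap.comp_apply (TensorProduct.map _ _) (TensorProduct.map _ _),
      ← TensorProduct.map_comp, LinearMap.id_comp, h1]
  have hK' : LinearMap.mul' ℂ A ∘ₗ TensorProduct.map LinearMap.id S =
      (TensorProduct.rid ℂ A).toLinearMap ∘ₗ TensorProduct.map LinearMap.id 𝒜.counit ∘ₗ
        𝒜.T₂.symm.toLinearMap := TensorProduct.ext' fun b a => by
    refine sub_eq_zero.mp (𝒜.eq_zero_of_mul_right _ fun c => ?_)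
    rw [sub_mul, sub_eq_zero]
    simpa [mul_assoc] using (key a b c).symm
  refine ⟨S, fun a b => ?_, fun a b => ?_⟩
  · simpa using LinearMap.congr_fun hK (𝒜.T₁ (a ⊗ₜ[ℂ] b))
  · simpa using LinearMap.congr_fun hK' (𝒜.T₂ (a ⊗ₜ[ℂ] b))

theorem antipode_anti {S : A →ₗ[ℂ] A}
    (h1 : ∀ a b : A, LinearMap.mul' ℂ A (TensorProduct.map S LinearMap.id (𝒜.T₁ (a ⊗ₜ[ℂ] b))) =
      𝒜.counit a • b) (u p : A) : S (u * p) = S p * S u := by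
  have hK : LinearMap.mul' ℂ A ∘ₗ TensorProduct.map S LinearMap.id =
      (TensorProduct.lid ℂ A).toLinearMap ∘ₗ TensorProduct.map 𝒜.counit LinearMap.id ∘ₗ
        𝒜.T₁.symm.toLinearMap := 𝒜.ext_T₁ fun a b => by
    rw [LinearMap.comp_apply, h1]; simp
  have h : ∀ q : A, LinearMap.mul' ℂ A ∘ₗ TensorProduct.map S LinearMap.id ∘ₗ
      LinearMap.mulRight ℂ (p ⊗ₜ[ℂ] q) = LinearMap.mulRight ℂ q ∘ₗ LinearMap.mulLeft ℂ (S p) ∘ₗ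
        LinearMap.mul' ℂ A ∘ₗ TensorProduct.map S LinearMap.id := fun q => 𝒜.ext_T₁ fun a b => by
    simp only [LinearMap.comp_apply, LinearMap.mulRight_apply, LinearMap.mulLeft_apply]
    rw [h1, T₁_mul, ← LinearMap.comp_apply (LinearMap.mul' ℂ A), hK]
    simp only [LinearMap.comp_apply, LinearEquiv.coe_coe]
    rw [K_Δ_left, mul_smul_comm, smul_mul_assoc]
    congr 1
    have := LinearMap.congr_fun hK (p ⊗ₜ[ℂ] (b * q))
    simp only [LinearMap.comp_apply, LinearEquiv.coe_coe] at this
    rw [← this]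
    simp [mul_assoc]
  refine sub_eq_zero.mp (𝒜.eq_zero_of_mul_right _ fun v => 𝒜.eq_zero_of_mul_right _ fun q => ?_)
  have := LinearMap.congr_fun (h q) (u ⊗ₜ[ℂ] v)
  simp [Algebra.TensorProduct.tmul_mul_tmul] at this
  rw [sub_mul, sub_mul, sub_eq_zero]
  simpa [mul_assoc] using this

theorem star_mul'_map (S : A →ₗ[ℂ] A) (S' : A →ₗ[ℂ] A) (hS' : ∀ a, S' a = star (S (star a)))
    (t : A ⊗[ℂ] A) : star (LinearMap.mul' ℂ A (TensorProduct.map S LinearMap.id t)) =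
      LinearMap.mul' ℂ A (TensorProduct.map LinearMap.id S' (TensorProduct.comm ℂ A A (star t))) := by
  induction t using TensorProduct.induction_on with
  | zero => simp
  | add x y hx hy => simp only [map_add, star_add, hx, hy]
  | tmul a b => simp [hS']

theorem star_mul'_map' (S : A →ₗ[ℂ] A) (S' : A →ₗ[ℂ] A) (hS' : ∀ a, S' a = star (S (star a)))
    (t : A ⊗[ℂ] A) : star (LinearMap.mul' ℂ A (TensorProduct.map LinearMap.id S t)) =
      LinearMap.mul' ℂ A (TensorProduct.map S' LinearMap.id (TensorProduct.comm ℂ A A (star t))) := by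
  induction t using TensorProduct.induction_on with
  | zero => simp
  | add x y hx hy => simp only [map_add, star_add, hx, hy]
  | tmul a b => simp [hS']

theorem counit_V (x a : A) :
    TensorProduct.rid ℂ A (TensorProduct.map LinearMap.id 𝒜.counit (𝒜.V (x ⊗ₜ[ℂ] a))) =
      a * x := by
  rcases subsingleton_or_nontrivial A with hA | hA
  · exact Subsingleton.elim _ _
  obtain ⟨e, he⟩ := 𝒜.counit_ne_zero
  have hm : ∀ (t : A ⊗[ℂ] A) (y c : A), TensorProduct.rid ℂ A (TensorProduct.map LinearMap.id
      𝒜.counit (t * (y ⊗ₜ[ℂ] c))) = 𝒜.counit c •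
        (TensorProduct.rid ℂ A (TensorProduct.map LinearMap.id 𝒜.counit t) * y) := fun t y c => by
    induction t using TensorProduct.induction_on with
    | zero => simp
    | add u v hu hv => simp only [map_add, add_mul, hu, hv, smul_add]
    | tmul p q =>
      simp [Algebra.TensorProduct.tmul_mul_tmul, counit_mul, mul_comm, smul_smul, smul_mul_assoc]
  have hl : ∀ (t : A ⊗[ℂ] A) (d : A), TensorProduct.rid ℂ A (TensorProduct.map LinearMap.id
      𝒜.counit ((tmulOne d).left t)) =
        d * TensorProduct.rid ℂ A (TensorProduct.map LinearMap.id 𝒜.counit t) := fun t d => by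
    induction t using TensorProduct.induction_on with
    | zero => simp
    | add u v hu hv => simp only [map_add, mul_add, hu, hv]
    | tmul p q => simp [mul_smul_comm]
  refine sub_eq_zero.mp (𝒜.eq_zero_of_mul_left _ fun d => 𝒜.eq_zero_of_mul_right _ fun y => ?_)
  have h1 := hm (𝒜.V (x ⊗ₜ[ℂ] a)) y e
  rw [V_mul, he, one_smul] at h1
  have h2 := hm (𝒜.T₂ (d ⊗ₜ[ℂ] a)) (x * y) e
  rw [T₂_mul, hl, h1, counit_T₂, he, one_smul] at h2
  rw [mul_sub, sub_mul, sub_eq_zero]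
  simpa [mul_assoc] using h2

theorem counit_star (a : A) : 𝒜.counit (star a) = star (𝒜.counit a) := by
  rcases subsingleton_or_nontrivial A with hA | hA
  · simp [Subsingleton.elim a 0]
  let ε' : Module.Dual ℂ A :=
    { toFun := fun a => star (𝒜.counit (star a))
      map_add' := fun x y => by simp
      map_smul' := fun c x => by simp }
  have hs : ∀ t : A ⊗[ℂ] A, TensorProduct.rid ℂ A (TensorProduct.map LinearMap.id ε' (star t)) =
      star (TensorProduct.rid ℂ A (TensorProduct.map LinearMap.id 𝒜.counit t)) := fun t => by
    induction t using TensorProduct.induction_on with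
    | zero => simp
    | add u v hu hv => simp only [map_add, star_add, hu, hv]
    | tmul p q => simp [ε']
  have h : (TensorProduct.rid ℂ A).toLinearMap ∘ₗ TensorProduct.map LinearMap.id ε' =
      (TensorProduct.rid ℂ A).toLinearMap ∘ₗ TensorProduct.map LinearMap.id 𝒜.counit :=
    𝒜.ext_V fun x a => by
      simp only [LinearMap.comp_apply, LinearEquiv.coe_coe]
      rw [counit_V, V_apply, hs, TensorProduct.star_tmul, counit_T₂]
      simp
  obtain ⟨p, hp⟩ := exists_ne (0 : A)
  have := LinearMap.congr_fun h (p ⊗ₜ[ℂ] a)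
  simp [ε'] at this
  have h2 := smul_left_injective ℂ hp this
  simpa using congrArg star h2

theorem exists_antipode : ∃ S : A ≃ₗ[ℂ] A,
    (∀ a b : A, LinearMap.mul' ℂ A
      (TensorProduct.map S.toLinearMap LinearMap.id (𝒜.T₁ (a ⊗ₜ[ℂ] b))) = 𝒜.counit a • b) ∧
    (∀ a b : A, LinearMap.mul' ℂ A
      (TensorProduct.map LinearMap.id S.toLinearMap (𝒜.T₂ (a ⊗ₜ[ℂ] b))) = 𝒜.counit b • a) := by
  rcases subsingleton_or_nontrivial A with hA | hA
  · exact ⟨LinearEquiv.refl ℂ A, fun a b => Subsingleton.elim _ _, fun a b => Subsingleton.elim _ _⟩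
  obtain ⟨S, h1, h2⟩ := 𝒜.exists_antipode_aux'
  have hanti := 𝒜.antipode_anti h1
  let S' : A →ₗ[ℂ] A :=
    { toFun := fun a => star (S (star a))
      map_add' := fun x y => by simp
      map_smul' := fun c x => by simp }
  have hS' : ∀ a, S' a = star (S (star a)) := fun a => rfl
  have hanti' : ∀ a b, S' (a * b) = S' b * S' a := fun a b => by simp [hS', hanti]
  obtain ⟨e, he⟩ := 𝒜.counit_ne_zero
  -- cancellation
  have hcancel : ∀ z : A, (∀ y, S' y * z = 0) → z = 0 := fun z hz => by
    refine 𝒜.eq_zero_of_mul_left _ fun b => ?_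
    have h := congrArg star (h1 e (star b))
    rw [star_mul'_map S S' hS', he, one_smul, star_star] at h
    rw [← h]
    generalize star (𝒜.T₁ (e ⊗ₜ[ℂ] star b)) = w
    induction w using TensorProduct.induction_on with
    | zero => simp
    | add x y hx hy => simp only [map_add, add_mul, hx, hy, add_zero]
    | tmul p q => simp [mul_assoc, hz]
  let R₂ : A ⊗[ℂ] A →ₗ[ℂ] A := LinearMap.mul' ℂ A ∘ₗ TensorProduct.map S' LinearMap.id ∘ₗ
    (TensorProduct.comm ℂ A A).toLinearMap
  have hR₂V : ∀ x a : A, R₂ (𝒜.V (x ⊗ₜ[ℂ] a)) = 𝒜.counit a • x := fun x a => by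
    have h := congrArg star (h2 (star x) (star a))
    rw [star_mul'_map' S S' hS', ← TensorProduct.star_tmul, ← V_apply] at h
    simpa [counit_star, R₂] using h
  have hR₂ : ∀ (t : A ⊗[ℂ] A) (x y : A), R₂ (t * (x ⊗ₜ[ℂ] y)) = S' y * R₂ t * x := fun t x y => by
    induction t using TensorProduct.induction_on with
    | zero => simp
    | add u v hu hv => simp only [map_add, mul_add, add_mul, hu, hv]
    | tmul p q => simp [R₂, Algebra.TensorProduct.tmul_mul_tmul, hanti', mul_assoc]
  have hR₂' : ∀ (t : A ⊗[ℂ] A) (y : A), R₂ ((oneTmul y).right t) = S' y * R₂ t := fun t y => by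
    induction t using TensorProduct.induction_on with
    | zero => simp
    | add u v hu hv => simp only [map_add, mul_add, hu, hv]
    | tmul p q => simp [R₂, hanti', mul_assoc]
  have hR₂T : ∀ a b : A, R₂ (𝒜.T₁ (a ⊗ₜ[ℂ] b)) = 𝒜.counit a • S' b := fun a b => by
    refine sub_eq_zero.mp (hcancel _ fun y => 𝒜.eq_zero_of_mul_right _ fun x => ?_)
    rw [mul_sub, sub_mul, sub_eq_zero, ← hR₂, T₁_mul, ← V_right, hR₂', hR₂V, hanti']
    simp [smul_mul_assoc, mul_smul_comm]
  have hR : LinearMap.mul' ℂ A ∘ₗ TensorProduct.map S' (S' ∘ₗ S) ∘ₗ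
      (TensorProduct.comm ℂ A A).toLinearMap = R₂ := 𝒜.ext_T₁ fun a b => by
    rw [hR₂T, ← map_smul, ← h1]
    generalize 𝒜.T₁ (a ⊗ₜ[ℂ] b) = w
    induction w using TensorProduct.induction_on with
    | zero => simp
    | add u v hu hv => simp only [map_add, hu, hv]
    | tmul p q => simp [hanti']
  have hinv : ∀ p, S' (S p) = p := fun p => by
    refine sub_eq_zero.mp (hcancel _ fun q => ?_)
    have := LinearMap.congr_fun hR (p ⊗ₜ[ℂ] q)
    simp [R₂] at this
    rw [mul_sub, this, sub_self]
  have hinv' : ∀ p, S (S' p) = p := fun p => by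
    have := congrArg star (hinv (star p))
    simpa [hS'] using this
  exact ⟨LinearEquiv.ofLinearMap S S' (LinearMap.ext hinv') (LinearMap.ext hinv), h1, h2⟩

/-- The antipode `S`, a linear bijection characterized by `m(S ⊗ ι)Δ(a) = ε(a)1` and
`m(ι ⊗ S)Δ(a) = ε(a)1`. -/
def antipode : A ≃ₗ[ℂ] A := 𝒜.exists_antipode.choose

theorem mul_antipode_T₁ (a b : A) : LinearMap.mul' ℂ A
    (TensorProduct.map 𝒜.antipode.toLinearMap LinearMap.id (𝒜.T₁ (a ⊗ₜ[ℂ] b))) =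
      𝒜.counit a • b := 𝒜.exists_antipode.choose_spec.1 a b

theorem mul_antipode_T₂ (a b : A) : LinearMap.mul' ℂ A
    (TensorProduct.map LinearMap.id 𝒜.antipode.toLinearMap (𝒜.T₂ (a ⊗ₜ[ℂ] b))) =
      𝒜.counit b • a := 𝒜.exists_antipode.choose_spec.2 a b

/-! ### Positive integrals and the Fourier transform -/

/-- A positive left integral: a non-zero linear functional `φ` with
`(ι ⊗ φ)((a' ⊗ 1)Δ(a)) = φ(a)a'` and `φ(a^* a) ≥ 0`. -/
structure PositiveLeftIntegral where
  /-- The underlying functional. -/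
  φ : Module.Dual ℂ A
  ne_zero : φ ≠ 0
  left_invariant : ∀ a a' : A,
    TensorProduct.rid ℂ A (TensorProduct.map LinearMap.id φ (𝒜.T₂ (a' ⊗ₜ[ℂ] a))) = φ a • a'
  nonneg_re : ∀ a : A, 0 ≤ (φ (star a * a)).re
  im_eq_zero : ∀ a : A, (φ (star a * a)).im = 0

end MultiplierHopfStarAlgebra

open MultiplierHopfStarAlgebra

namespace MultiplierHopfStarAlgebra.PositiveLeftIntegral

variable {A : Type*} [NonUnitalRing A] [StarRing A] [Module ℂ A]
    [IsScalarTower ℂ A A] [SMulCommClass ℂ A A] [StarModule ℂ A]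
    {𝒜 : MultiplierHopfStarAlgebra A} (Φ : 𝒜.PositiveLeftIntegral)

/-- The map `a ↦ φ( · a)` from `A` to its dual space. -/
def fourier : A →ₗ[ℂ] Module.Dual ℂ A where
  toFun a := Φ.φ ∘ₗ LinearMap.mulRight ℂ a
  map_add' a b := by ext; simp [mul_add]
  map_smul' c a := by ext; simp [mul_smul_comm]

theorem conj_symm (x y : A) : (starRingEnd ℂ) (Φ.φ (star y * x)) = Φ.φ (star x * y) := by
  have h1 := Φ.im_eq_zero (x + y)
  have h2 := Φ.im_eq_zero (x + Complex.I • y)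
  have hx := Φ.im_eq_zero x
  have hy := Φ.im_eq_zero y
  simp [add_mul, mul_add, smul_mul_assoc, mul_smul_comm, hx, hy, star_smul] at h1 h2
  apply Complex.ext <;> simp <;> linarith

/-- `A` equipped with the semi-inner product defined by the integral. -/
def PreGNS (_ : 𝒜.PositiveLeftIntegral) : Type _ := A

instance : AddCommGroup Φ.PreGNS := inferInstanceAs (AddCommGroup A)

instance : Module ℂ Φ.PreGNS := inferInstanceAs (Module ℂ A)

/-- The identity map from `A` to `PreGNS`. -/
def toPreGNS : A ≃ₗ[ℂ] Φ.PreGNS := LinearEquiv.refl ℂ A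

/-- The scalar product `⟨x', x⟩ = φ(x^* x')`, linear in `x'`; in Mathlib's `inner` the conjugate
linear variable comes first. -/
abbrev preGNSCore : PreInnerProductSpace.Core ℂ Φ.PreGNS where
  inner x x' := Φ.φ (star (Φ.toPreGNS.symm x) * Φ.toPreGNS.symm x')
  conj_inner_symm x y := Φ.conj_symm _ _
  re_inner_nonneg x := Φ.nonneg_re _
  add_left x y z := by simp [add_mul]
  smul_left x y c := by simp [smul_mul_assoc]

instance : SeminormedAddCommGroup Φ.PreGNS :=
  InnerProductSpace.Core.toSeminormedAddCommGroup (c := Φ.preGNSCore)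

instance : InnerProductSpace ℂ Φ.PreGNS := InnerProductSpace.ofCore Φ.preGNSCore

/-- The Hilbert space `ℋ` obtained by completing `A` for the scalar product
`(x', x) ↦ φ(x^* x')`. -/
abbrev GNS : Type _ := UniformSpace.Completion Φ.PreGNS

/-- The canonical map `η : A → ℋ`. -/
def η : A →ₗ[ℂ] Φ.GNS :=
  (UniformSpace.Completion.toComplL (𝕜 := ℂ) (E := Φ.PreGNS)).toLinearMap ∘ₗ Φ.toPreGNS.toLinearMap

theorem inner_η (x x' : A) : inner ℂ (Φ.η x) (Φ.η x') = Φ.φ (star x * x') :=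
  UniformSpace.Completion.inner_coe _ _

end MultiplierHopfStarAlgebra.PositiveLeftIntegral

/-! ### Hilbert space tensor products -/

section HilbertTensor

/-- The extension of a unitary to the completions. -/
def completionCongr {E F : Type*} [NormedAddCommGroup E] [InnerProductSpace ℂ E]
    [NormedAddCommGroup F] [InnerProductSpace ℂ F] (e : E ≃ₗᵢ[ℂ] F) :
    UniformSpace.Completion E ≃ₗᵢ[ℂ] UniformSpace.Completion F where
  toFun := (e.toContinuousLinearEquiv : E →L[ℂ] F).completion
  invFun := (e.symm.toContinuousLinearEquiv : F →L[ℂ] E).completion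
  map_add' := map_add _
  map_smul' := map_smul _
  left_inv x := by
    induction x using UniformSpace.Completion.induction_on with
    | hp => exact isClosed_eq (by fun_prop) (by fun_prop)
    | ih x => simp
  right_inv x := by
    induction x using UniformSpace.Completion.induction_on with
    | hp => exact isClosed_eq (by fun_prop) (by fun_prop)
    | ih x => simp
  norm_map' x := by
    induction x using UniformSpace.Completion.induction_on with
    | hp => exact isClosed_eq (by simp; fun_prop) (by fun_prop)
    | ih x => simp

variable (H K : Type*) [NormedAddCommGroup H] [InnerProductSpace ℂ H]
  [NormedAddCommGroup K] [InnerProductSpace ℂ K]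

/-- The Hilbert space tensor product: the completion of the algebraic tensor product for the scalar
product with `⟨ξ ⊗ ζ, ξ' ⊗ ζ'⟩ = ⟨ξ, ξ'⟩⟨ζ, ζ'⟩`. -/
abbrev HilbertTensor : Type _ := UniformSpace.Completion (H ⊗[ℂ] K)

/-- The flip `Σ : ξ ⊗ ζ ↦ ζ ⊗ ξ`. -/
def HilbertTensor.flip : HilbertTensor H K ≃ₗᵢ[ℂ] HilbertTensor K H :=
  completionCongr (TensorProduct.commIsometry ℂ H K)

variable {H K} {H' K' : Type*} [NormedAddCommGroup H'] [InnerProductSpace ℂ H']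
  [NormedAddCommGroup K'] [InnerProductSpace ℂ K']

/-- The tensor product `f ⊗ g : ξ ⊗ ζ ↦ f(ξ) ⊗ g(ζ)` of two unitaries. -/
def HilbertTensor.congr (f : H ≃ₗᵢ[ℂ] H') (g : K ≃ₗᵢ[ℂ] K') :
    HilbertTensor H K ≃ₗᵢ[ℂ] HilbertTensor H' K' :=
  completionCongr (TensorProduct.congrIsometry f g)

end HilbertTensor

section Main

variable {A : Type*} [NonUnitalRing A] [StarRing A] [Module ℂ A]
    [IsScalarTower ℂ A A] [SMulCommClass ℂ A A] [StarModule ℂ A]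
    {𝒜 : MultiplierHopfStarAlgebra A}
  {B : Type*} [NonUnitalRing B] [StarRing B] [Module ℂ B]
    [IsScalarTower ℂ B B] [SMulCommClass ℂ B B] [StarModule ℂ B]
    {ℬ : MultiplierHopfStarAlgebra B}

/-- The canonical map `x ⊗ x' ↦ η(x) ⊗ η'(x')` from `A ⊗ B` to `ℋ ⊗ ℋ'`. -/
def tensorη (Φ : 𝒜.PositiveLeftIntegral) (Ψ : ℬ.PositiveLeftIntegral) :
    A ⊗[ℂ] B →ₗ[ℂ] HilbertTensor Φ.GNS Ψ.GNS :=
  (UniformSpace.Completion.toComplL (𝕜 := ℂ) (E := Φ.GNS ⊗[ℂ] Ψ.GNS)).toLinearMap ∘ₗ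
    TensorProduct.map Φ.η Ψ.η

/-- A unitary on `ℋ ⊗ ℋ` extends the algebraic map `W` of `A ⊗ A`. -/
def ExtendsW (Φ : 𝒜.PositiveLeftIntegral)
    (W : HilbertTensor Φ.GNS Φ.GNS ≃ₗᵢ[ℂ] HilbertTensor Φ.GNS Φ.GNS) : Prop :=
  ∀ t : A ⊗[ℂ] A, W (tensorη Φ Φ t) = tensorη Φ Φ (𝒜.W t)

/-- The multiplier Hopf `*`-algebra `B`, with integral `Ψ`, is the dual of `A` endowed with the
opposite comultiplication, relative to the left integral `Φ` of `A`. Here `p b a = ⟨a, b⟩`, so that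
`p` identifies `B` with the space of functionals `φ( · a)` on `A`.
* The product is dual to the coproduct: `⟨a, bb'⟩ = ⟨Δ(a), b ⊗ b'⟩`, which for `b = φ( · c)` and
  `b' = φ( · d)` means `(φ ⊗ φ)(Δ(a)(c ⊗ d))`.
* The involution is `⟨a, b^*⟩ = ⟨S(a)^*, b⟩` up to complex conjugation.
* The coproduct is opposite to the dual of the product, `⟨a ⊗ a', Δ(b)⟩ = ⟨a'a, b⟩`; covered by
  `b'` this means that `⟨a ⊗ a', Δ(b)(1 ⊗ b')⟩ = ⟨a'₍₁₎a, b⟩⟨a'₍₂₎, b'⟩`.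
* The integral on `B` is normalized by `φ(b) = ε(a)` when `b = φ( · a)`. -/
structure IsOpDual (Φ : 𝒜.PositiveLeftIntegral) (Ψ : ℬ.PositiveLeftIntegral)
    (p : B →ₗ[ℂ] Module.Dual ℂ A) : Prop where
  injective : Function.Injective p
  range_eq : LinearMap.range p = LinearMap.range Φ.fourier
  mul : ∀ (b b' : B) (c d a : A), p b = Φ.fourier c → p b' = Φ.fourier d →
    p (b * b') a = TensorProduct.dualDistrib ℂ A A (Φ.φ ⊗ₜ[ℂ] Φ.φ) ((𝒜.Δ a).left (c ⊗ₜ[ℂ] d))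
  star : ∀ (b : B) (a : A), p (star b) a = (starRingEnd ℂ) (p b (star (𝒜.antipode a)))
  comul : ∀ (b b' : B) (a a' : A),
    TensorProduct.dualDistrib ℂ A A (TensorProduct.map p p (ℬ.T₁ (b ⊗ₜ[ℂ] b'))) (a ⊗ₜ[ℂ] a') =
      TensorProduct.dualDistrib ℂ A A (p b ⊗ₜ[ℂ] p b') (𝒜.V (a ⊗ₜ[ℂ] a'))
  integral : ∀ (b : B) (a : A), p b = Φ.fourier a → Ψ.φ b = 𝒜.counit a

/-- The element `z` of `B ⊗ A` is `⟨S⁻¹(x₍₁₎), y₍₁₎⟩ y₍₂₎ ⊗ x₍₂₎`. Elements of `B ⊗ A` are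
determined by pairing the first leg with all `a` in `A`, and because the coproduct of `B` is
opposite to the dual of the product of `A`, the condition becomes
`(⟨a, · ⟩ ⊗ ι)z = ⟨aS⁻¹(x₍₁₎), y⟩ x₍₂₎`, where
`aS⁻¹(x₍₁₎) ⊗ x₍₂₎ = (S⁻¹ ⊗ ι)(Δ(x)(S(a) ⊗ 1))` lies in `A ⊗ A`. -/
def IsTwist (𝒜 : MultiplierHopfStarAlgebra A) (p : B →ₗ[ℂ] Module.Dual ℂ A)
    (y : B) (x : A) (z : B ⊗[ℂ] A) : Prop :=
  ∀ a : A, TensorProduct.lid ℂ A (TensorProduct.map (p.flip a) LinearMap.id z) =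
    TensorProduct.lid ℂ A (TensorProduct.map (p y ∘ₗ 𝒜.antipode.symm.toLinearMap) LinearMap.id
      (𝒜.V (𝒜.antipode a ⊗ₜ[ℂ] x)))

end Main

end AlgQG

end

open AlgQG AlgQG.MultiplierHopfStarAlgebra

/-! Sweedler notation has a meaning here only when it is covered, so the algebra is carried by four
bijections of `A ⊗ A`: `T₁`, `T₂`, `V`, and `Y(x ⊗ a) = (1 ⊗ x)Δ(a)`. The antipode makes the
inverses of `T₁`, `T₂` and `V` explicit (`T₁_symm_antipode`, `T₂_symm_antipode`); with `S(S(p^*)^*)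
= p` this yields the formula `W_tmul` for `W = V⁻¹`. Unitarity is left invariance: `V(x ⊗ x')^* V(y
⊗ y') = (x^* ⊗ 1)Δ(x'^*y')(y ⊗ 1)`, and applying `ι ⊗ φ` gives `φ(x'^*y')x^*y`. So the bijection `V`
preserves the inner product, and density of `A ⊗ A` extends it and its inverse to the Hilbert tensor
product.

For the dual, faithfulness of `φ` identifies `c` with `φ( · c)`. Convolution of functionals becomes
`c ⋆ d = (φ ⊗ ι)W(c ⊗ d)`, and multiplication by `φ( · d)` is the transpose of one of the two
commuting operators `R d = (ι ⊗ φ( · d))Δ` and `L d = (φ( · d) ⊗ ι)Δ` on `A`. The canonical maps of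
the dual must be the transposes of `V` and `Y`. That these act bijectively on the functionals
represented in `A ⊗ A` follows from strong left invariance and from the equality of the three spaces
of functionals `φ( · e)`, `φ(e · )` and `φ(S( · f))`. The axioms are then identities between
elements of `B ⊗ B`, checked by pairing with `A ⊗ A`.

Two identities give the last part for every realization of the dual. The Plancherel identity `ε(c^♯
⋆ d) = φ(c^*d)`, with `c^♯` representing the adjoint of `φ( · c)`, makes the dual integral positive
and the Fourier transform unitary (`counit_conv`, `plancherel`). And `V_tmul` says that `V` of the
dual is `W` of `A` conjugated by the flip; since `V` implements the adjoint of the regular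
representation, this is the final formula. -/

noncomputable section

namespace AlgQG

/-! ### Slice maps on algebraic tensor products -/

section Slices

variable {X Y : Type*} [AddCommGroup X] [Module ℂ X] [AddCommGroup Y] [Module ℂ Y]

/-- The slice map `f ⊗ ι`. -/
def lslice (f : Module.Dual ℂ X) : X ⊗[ℂ] Y →ₗ[ℂ] Y :=
  (TensorProduct.lid ℂ Y).toLinearMap ∘ₗ TensorProduct.map f LinearMap.id

/-- The slice map `ι ⊗ f`. -/
def rslice (f : Module.Dual ℂ Y) : X ⊗[ℂ] Y →ₗ[ℂ] X :=
  (TensorProduct.rid ℂ X).toLinearMap ∘ₗ TensorProduct.map LinearMap.id f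

@[simp] theorem lslice_tmul (f : Module.Dual ℂ X) (x : X) (y : Y) :
    lslice f (x ⊗ₜ[ℂ] y) = f x • y := by simp [lslice]

@[simp] theorem rslice_tmul (f : Module.Dual ℂ Y) (x : X) (y : Y) :
    rslice f (x ⊗ₜ[ℂ] y) = f y • x := by simp [rslice]

theorem eq_zero_of_lslice {t : X ⊗[ℂ] Y} (h : ∀ f, lslice f t = 0) : t = 0 := by
  classical
  let b := Module.Basis.ofVectorSpace ℂ X
  apply (TensorProduct.equivFinsuppOfBasisLeft b).injective
  rw [map_zero]
  ext i
  rw [Finsupp.zero_apply, ← h (b.coord i)]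
  clear h
  induction t using TensorProduct.induction_on with
  | zero => simp
  | add x y hx hy => simp only [map_add, Finsupp.add_apply, hx, hy]
  | tmul c d => simp

theorem eq_zero_of_rslice {t : X ⊗[ℂ] Y} (h : ∀ f, rslice f t = 0) : t = 0 := by
  classical
  let b := Module.Basis.ofVectorSpace ℂ Y
  apply (TensorProduct.equivFinsuppOfBasisRight b).injective
  rw [map_zero]
  ext i
  rw [Finsupp.zero_apply, ← h (b.coord i)]
  clear h
  induction t using TensorProduct.induction_on with
  | zero => simp
  | add x y hx hy => simp only [map_add, Finsupp.add_apply, hx, hy]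
  | tmul c d => simp

theorem lslice_ext {s t : X ⊗[ℂ] Y} (h : ∀ f, lslice f s = lslice f t) : s = t :=
  sub_eq_zero.mp (eq_zero_of_lslice fun f => by rw [map_sub, h, sub_self])

theorem rslice_ext {s t : X ⊗[ℂ] Y} (h : ∀ f, rslice f s = rslice f t) : s = t :=
  sub_eq_zero.mp (eq_zero_of_rslice fun f => by rw [map_sub, h, sub_self])

theorem apply_lslice (f : Module.Dual ℂ X) (g : Module.Dual ℂ Y) (t : X ⊗[ℂ] Y) :
    g (lslice f t) = f (rslice g t) := by
  induction t using TensorProduct.induction_on with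
  | zero => simp
  | add x y hx hy => simp only [map_add, hx, hy]
  | tmul c d => simp [mul_comm]

theorem dualDistrib_eq (f : Module.Dual ℂ X) (g : Module.Dual ℂ Y) (t : X ⊗[ℂ] Y) :
    TensorProduct.dualDistrib ℂ X Y (f ⊗ₜ[ℂ] g) t = f (rslice g t) := by
  induction t using TensorProduct.induction_on with
  | zero => simp
  | add x y hx hy => simp only [map_add, hx, hy]
  | tmul c d => simp [mul_comm]

theorem lslice_surjective {f : Module.Dual ℂ X} (hf : f ≠ 0) :
    Function.Surjective (lslice (Y := Y) f) := fun y => by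
  obtain ⟨x, hx⟩ : ∃ x, f x ≠ 0 := by
    by_contra! h
    exact hf (LinearMap.ext h)
  exact ⟨((f x)⁻¹ • x) ⊗ₜ y, by simp [hx]⟩

theorem rslice_surjective {f : Module.Dual ℂ Y} (hf : f ≠ 0) :
    Function.Surjective (rslice (X := X) f) := fun y => by
  obtain ⟨x, hx⟩ : ∃ x, f x ≠ 0 := by
    by_contra! h
    exact hf (LinearMap.ext h)
  exact ⟨y ⊗ₜ ((f x)⁻¹ • x), by simp [hx]⟩

theorem exists_sum_tmul (t : X ⊗[ℂ] Y) :
    ∃ (n : ℕ) (p : Fin n → X) (q : Fin n → Y), t = ∑ i, p i ⊗ₜ[ℂ] q i := by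
  induction t using TensorProduct.induction_on with
  | zero => exact ⟨0, Fin.elim0, Fin.elim0, by simp⟩
  | tmul x y => exact ⟨1, fun _ => x, fun _ => y, by simp⟩
  | add s t hs ht =>
    obtain ⟨n, p, q, rfl⟩ := hs
    obtain ⟨m, p', q', rfl⟩ := ht
    exact ⟨n + m, Fin.append p p', Fin.append q q', by simp [Fin.sum_univ_add]⟩

end Slices

/-! ### Multiplication in one leg -/

section Legs

variable {A : Type*} [NonUnitalRing A] [Module ℂ A] [IsScalarTower ℂ A A] [SMulCommClass ℂ A A]

theorem lslice_oneTmul_left (f : Module.Dual ℂ A) (a : A) (t : A ⊗[ℂ] A) :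
    lslice f ((oneTmul a).left t) = a * lslice f t := by
  induction t using TensorProduct.induction_on with
  | zero => simp
  | add x y hx hy => simp only [map_add, mul_add, hx, hy]
  | tmul c d => simp [mul_smul_comm]

theorem lslice_oneTmul_right (f : Module.Dual ℂ A) (a : A) (t : A ⊗[ℂ] A) :
    lslice f ((oneTmul a).right t) = lslice f t * a := by
  induction t using TensorProduct.induction_on with
  | zero => simp
  | add x y hx hy => simp only [map_add, add_mul, hx, hy]
  | tmul c d => simp [smul_mul_assoc]

theorem rslice_tmulOne_left (f : Module.Dual ℂ A) (a : A) (t : A ⊗[ℂ] A) :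
    rslice f ((tmulOne a).left t) = a * rslice f t := by
  induction t using TensorProduct.induction_on with
  | zero => simp
  | add x y hx hy => simp only [map_add, mul_add, hx, hy]
  | tmul c d => simp [mul_smul_comm]

theorem rslice_tmulOne_right (f : Module.Dual ℂ A) (a : A) (t : A ⊗[ℂ] A) :
    rslice f ((tmulOne a).right t) = rslice f t * a := by
  induction t using TensorProduct.induction_on with
  | zero => simp
  | add x y hx hy => simp only [map_add, add_mul, hx, hy]
  | tmul c d => simp [smul_mul_assoc]

theorem lslice_tmulOne_right (f : Module.Dual ℂ A) (a : A) (t : A ⊗[ℂ] A) :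
    lslice f ((tmulOne a).right t) = lslice (f ∘ₗ LinearMap.mulRight ℂ a) t := by
  induction t using TensorProduct.induction_on with
  | zero => simp
  | add x y hx hy => simp only [map_add, hx, hy]
  | tmul c d => simp

theorem rslice_oneTmul_right (f : Module.Dual ℂ A) (a : A) (t : A ⊗[ℂ] A) :
    rslice f ((oneTmul a).right t) = rslice (f ∘ₗ LinearMap.mulRight ℂ a) t := by
  induction t using TensorProduct.induction_on with
  | zero => simp
  | add x y hx hy => simp only [map_add, hx, hy]
  | tmul c d => simp

theorem tmulOne_oneTmul_comm (a b : A) : tmulOne a * oneTmul b = oneTmul b * tmulOne a :=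
  mult_ext (fun c d => by simp) (fun c d => by simp)

theorem star_oneTmul [StarRing A] [StarModule ℂ A] (a : A) :
    star (oneTmul a) = oneTmul (star a) :=
  mult_ext (fun c d => by simp) (fun c d => by simp)

theorem mul_tmul_eq (t : A ⊗[ℂ] A) (a b : A) :
    t * (a ⊗ₜ[ℂ] b) = (tmulOne a).right ((oneTmul b).right t) := by
  induction t using TensorProduct.induction_on with
  | zero => simp
  | add x y hx hy => simp only [map_add, add_mul, hx, hy]
  | tmul c d => simp [Algebra.TensorProduct.tmul_mul_tmul]

theorem tmul_mul_eq (t : A ⊗[ℂ] A) (a b : A) :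
    (a ⊗ₜ[ℂ] b) * t = (tmulOne a).left ((oneTmul b).left t) := by
  induction t using TensorProduct.induction_on with
  | zero => simp
  | add x y hx hy => simp only [map_add, mul_add, hx, hy]
  | tmul c d => simp [Algebra.TensorProduct.tmul_mul_tmul]

theorem Multiplier.add_left {X : Type*} [NonUnitalRing X] [Module ℂ X] [IsScalarTower ℂ X X]
    [SMulCommClass ℂ X X] (m n : Multiplier X) (x : X) :
    (m + n).left x = m.left x + n.left x := rfl

theorem Multiplier.smul_left {X : Type*} [NonUnitalRing X] [Module ℂ X] [IsScalarTower ℂ X X]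
    [SMulCommClass ℂ X X] (c : ℂ) (m : Multiplier X) (x : X) :
    (c • m).left x = c • m.left x := rfl

end Legs

namespace MultiplierHopfStarAlgebra

variable {A : Type*} [NonUnitalRing A] [StarRing A] [Module ℂ A]
    [IsScalarTower ℂ A A] [SMulCommClass ℂ A A] [StarModule ℂ A]
    (𝒜 : MultiplierHopfStarAlgebra A)

/-! ### Cancellation -/

theorem mul_right_cancel' (𝒜 : MultiplierHopfStarAlgebra A) {a b : A}
    (h : ∀ c, a * c = b * c) : a = b :=
  sub_eq_zero.mp (𝒜.eq_zero_of_mul_right _ fun c => by rw [sub_mul, h, sub_self])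

theorem mul_left_cancel' (𝒜 : MultiplierHopfStarAlgebra A) {a b : A}
    (h : ∀ c, c * a = c * b) : a = b :=
  sub_eq_zero.mp (𝒜.eq_zero_of_mul_left _ fun c => by rw [mul_sub, h, sub_self])

/-- Slicing the other leg reduces this to non-degeneracy of the product of `A`. It is what allows a
cover to be removed from an identity. -/
theorem tmulOne_left_cancel (𝒜 : MultiplierHopfStarAlgebra A) {s t : A ⊗[ℂ] A}
    (h : ∀ c, (tmulOne c).left s = (tmulOne c).left t) : s = t :=
  rslice_ext fun f => 𝒜.mul_left_cancel' fun c => by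
    rw [← rslice_tmulOne_left, h, rslice_tmulOne_left]

theorem tmulOne_right_cancel (𝒜 : MultiplierHopfStarAlgebra A) {s t : A ⊗[ℂ] A}
    (h : ∀ c, (tmulOne c).right s = (tmulOne c).right t) : s = t :=
  rslice_ext fun f => 𝒜.mul_right_cancel' fun c => by
    rw [← rslice_tmulOne_right, h, rslice_tmulOne_right]

theorem oneTmul_right_cancel (𝒜 : MultiplierHopfStarAlgebra A) {s t : A ⊗[ℂ] A}
    (h : ∀ c, (oneTmul c).right s = (oneTmul c).right t) : s = t :=
  lslice_ext fun f => 𝒜.mul_right_cancel' fun c => by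
    rw [← lslice_oneTmul_right, h, lslice_oneTmul_right]

theorem mul_tmul_cancel (𝒜 : MultiplierHopfStarAlgebra A) {s t : A ⊗[ℂ] A}
    (h : ∀ c d : A, s * (c ⊗ₜ[ℂ] d) = t * (c ⊗ₜ[ℂ] d)) : s = t :=
  𝒜.oneTmul_right_cancel fun d => 𝒜.tmulOne_right_cancel fun c => by
    simpa only [mul_tmul_eq] using h c d

/-- This is associativity `m(tn) = (mt)n` in the multiplier algebra, pulled back along the injective
inclusion of `A ⊗ A`. -/
theorem left_right_comm (𝒜 : MultiplierHopfStarAlgebra A) (m n : Multiplier (A ⊗[ℂ] A))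
    (t : A ⊗[ℂ] A) : m.left (n.right t) = n.right (m.left t) := by
  apply 𝒜.incl_inj
  rw [← Multiplier.mul_incl, ← Multiplier.incl_mul, ← Multiplier.incl_mul, ← Multiplier.mul_incl,
    mul_assoc]

/-! ### The four canonical maps -/

/-- The map `Y : x ⊗ a ↦ (1 ⊗ x)Δ(a)` of `A ⊗ A`; see `Y_spec`. -/
def Y : (A ⊗[ℂ] A) ≃ₗ[ℂ] (A ⊗[ℂ] A) :=
  (starLinearEquiv ℂ (A := A ⊗[ℂ] A)).trans
    (((TensorProduct.comm ℂ A A).trans 𝒜.T₁).trans (starLinearEquiv ℂ (A := A ⊗[ℂ] A)))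

theorem Y_tmul (x a : A) : 𝒜.Y (x ⊗ₜ[ℂ] a) = star (𝒜.T₁ (star a ⊗ₜ[ℂ] star x)) := by
  simp [Y]

theorem Y_spec (x a : A) : Multiplier.incl (𝒜.Y (x ⊗ₜ[ℂ] a)) = oneTmul x * 𝒜.Δ a := by
  rw [Y_tmul, ← Multiplier.star_incl, T₁_spec, Multiplier.star_mul', star_oneTmul, star_star,
    ← map_star, star_star]

theorem T₁_tmulOne_right (x a b : A) :
    (tmulOne x).right (𝒜.T₁ (a ⊗ₜ[ℂ] b)) = (𝒜.Δ a).left (x ⊗ₜ[ℂ] b) := by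
  apply 𝒜.incl_inj
  rw [← Multiplier.incl_mul, T₁_spec, ← Multiplier.mul_incl, ← tmulOne_mul_oneTmul,
    tmulOne_oneTmul_comm, mul_assoc]

theorem T₂_tmulOne_right (a b c : A) :
    (tmulOne c).right (𝒜.T₂ (a ⊗ₜ[ℂ] b)) = (tmulOne a).left (𝒜.V (c ⊗ₜ[ℂ] b)) := by
  apply 𝒜.incl_inj
  rw [← Multiplier.incl_mul, T₂_spec, ← Multiplier.mul_incl, V_spec, mul_assoc]

theorem Y_tmulOne_right (x a c : A) :
    (tmulOne c).right (𝒜.Y (x ⊗ₜ[ℂ] a)) = (oneTmul x).left (𝒜.V (c ⊗ₜ[ℂ] a)) := by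
  apply 𝒜.incl_inj
  rw [← Multiplier.incl_mul, Y_spec, ← Multiplier.mul_incl, V_spec, mul_assoc]

theorem T₂_oneTmul_left (x a c : A) :
    (oneTmul x).left (𝒜.T₂ (c ⊗ₜ[ℂ] a)) = (𝒜.Δ a).right (c ⊗ₜ[ℂ] x) := by
  apply 𝒜.incl_inj
  rw [← Multiplier.mul_incl, T₂_spec, ← Multiplier.incl_mul, ← tmulOne_mul_oneTmul,
    tmulOne_oneTmul_comm, mul_assoc]

theorem Y_tmulOne_left (x a c : A) :
    (tmulOne c).left (𝒜.Y (x ⊗ₜ[ℂ] a)) = (𝒜.Δ a).right (c ⊗ₜ[ℂ] x) := by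
  apply 𝒜.incl_inj
  rw [← Multiplier.mul_incl, Y_spec, ← Multiplier.incl_mul, ← tmulOne_mul_oneTmul, mul_assoc]

theorem Δ_left_V (a x y : A) : (𝒜.Δ a).left (𝒜.V (x ⊗ₜ[ℂ] y)) = 𝒜.V (x ⊗ₜ[ℂ] (a * y)) := by
  apply 𝒜.incl_inj
  rw [← Multiplier.mul_incl, V_spec, V_spec, map_mul, mul_assoc]

theorem Δ_right_T₂ (a : A) (t : A ⊗[ℂ] A) :
    (𝒜.Δ a).right (𝒜.T₂ t) = 𝒜.T₂ ((oneTmul a).right t) := by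
  induction t using TensorProduct.induction_on with
  | zero => simp
  | add x y hx hy => simp only [map_add, hx, hy]
  | tmul x y =>
    apply 𝒜.incl_inj
    rw [oneTmul_right, ← Multiplier.incl_mul, T₂_spec, T₂_spec, map_mul, mul_assoc]

/-! ### Inverses of the canonical maps in terms of the antipode -/

theorem antipode_mul (a b : A) : 𝒜.antipode (a * b) = 𝒜.antipode b * 𝒜.antipode a :=
  𝒜.antipode_anti (S := 𝒜.antipode.toLinearMap) 𝒜.mul_antipode_T₁ a b

theorem antipode_symm_mul (a b : A) :
    𝒜.antipode.symm (a * b) = 𝒜.antipode.symm b * 𝒜.antipode.symm a :=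
  𝒜.antipode.injective (by simp [antipode_mul])

theorem lslice_counit_T₁ (a b : A) : lslice 𝒜.counit (𝒜.T₁ (a ⊗ₜ[ℂ] b)) = a * b :=
  𝒜.counit_T₁ _

theorem rslice_counit_T₂ (a b : A) : rslice 𝒜.counit (𝒜.T₂ (a ⊗ₜ[ℂ] b)) = a * b :=
  𝒜.counit_T₂ _

/-- The counit axioms treat the first leg of `T₁` and the second leg of `T₂`. For the second leg of
`T₁`, a cover by `x` on the left turns `T₁` into `T₂`, and multiplicativity of `ε` extracts `ε(b)`.
-/
theorem rslice_counit_T₁ (a b : A) :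
    rslice 𝒜.counit (𝒜.T₁ (a ⊗ₜ[ℂ] b)) = 𝒜.counit b • a := by
  refine 𝒜.mul_left_cancel' fun x => ?_
  rw [← rslice_tmulOne_left, ← T₂_right_eq, rslice_oneTmul_right]
  have : 𝒜.counit ∘ₗ LinearMap.mulRight ℂ b = 𝒜.counit b • 𝒜.counit := by
    ext c; simp [counit_mul, mul_comm]
  have h2 : ∀ t : A ⊗[ℂ] A, rslice (𝒜.counit b • 𝒜.counit) t =
      𝒜.counit b • rslice 𝒜.counit t := fun t => by
    induction t using TensorProduct.induction_on with
    | zero => simp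
    | add x y hx hy => simp only [map_add, smul_add, hx, hy]
    | tmul c d => simp [smul_smul]
  rw [this, h2, rslice_counit_T₂, mul_smul_comm]

theorem rslice_counit_T₁_symm (a b : A) :
    rslice 𝒜.counit (𝒜.T₁.symm (a ⊗ₜ[ℂ] b)) = 𝒜.counit b • a := by
  have : rslice 𝒜.counit ∘ₗ 𝒜.T₁.toLinearMap = rslice 𝒜.counit :=
    TensorProduct.ext' fun a b => by simp [rslice_counit_T₁]
  simpa using (LinearMap.congr_fun this (𝒜.T₁.symm (a ⊗ₜ[ℂ] b))).symm

theorem lslice_counit_T₁_symm (a b : A) :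
    lslice 𝒜.counit (𝒜.T₁.symm (a ⊗ₜ[ℂ] b)) = 𝒜.antipode a * b := by
  have : LinearMap.mul' ℂ A ∘ₗ TensorProduct.map 𝒜.antipode.toLinearMap LinearMap.id ∘ₗ
      𝒜.T₁.toLinearMap = lslice 𝒜.counit :=
    TensorProduct.ext' fun a b => by simpa using 𝒜.mul_antipode_T₁ a b
  simpa using (LinearMap.congr_fun this (𝒜.T₁.symm (a ⊗ₜ[ℂ] b))).symm

theorem rslice_counit_T₂_symm (a b : A) :
    rslice 𝒜.counit (𝒜.T₂.symm (a ⊗ₜ[ℂ] b)) = a * 𝒜.antipode b := by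
  have : LinearMap.mul' ℂ A ∘ₗ TensorProduct.map LinearMap.id 𝒜.antipode.toLinearMap ∘ₗ
      𝒜.T₂.toLinearMap = rslice 𝒜.counit :=
    TensorProduct.ext' fun a b => by simpa using 𝒜.mul_antipode_T₂ a b
  simpa using (LinearMap.congr_fun this (𝒜.T₂.symm (a ⊗ₜ[ℂ] b))).symm

/-- The covered form of `T₁⁻¹(a ⊗ b) = a₍₁₎ ⊗ S(a₍₂₎)b`, obtained by applying `ε` to the middle leg
of coassociativity. -/
theorem T₁_symm_tmulOne_left (a b c : A) :
    (tmulOne c).left (𝒜.T₁.symm (a ⊗ₜ[ℂ] b)) =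
      (oneTmul b).right (TensorProduct.map LinearMap.id 𝒜.antipode.toLinearMap
        (𝒜.T₂ (c ⊗ₜ[ℂ] a))) := by
  have h := congrArg (TensorProduct.map (LinearMap.id : A →ₗ[ℂ] A) (lslice 𝒜.counit))
    (𝒜.coassoc_symm c a b)
  obtain ⟨n, p, q, hpq⟩ := exists_sum_tmul (𝒜.T₂ (c ⊗ₜ[ℂ] a))
  obtain ⟨m, r, s, hrs⟩ := exists_sum_tmul (𝒜.T₁.symm (a ⊗ₜ[ℂ] b))
  have hl : ∀ x y z : A, TensorProduct.map (LinearMap.id : A →ₗ[ℂ] A) (lslice 𝒜.counit)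
      (TensorProduct.assoc ℂ A A A (𝒜.T₂ (x ⊗ₜ[ℂ] y) ⊗ₜ[ℂ] z)) = (x * y) ⊗ₜ[ℂ] z := fun x y z => by
    rw [← rslice_counit_T₂]
    generalize 𝒜.T₂ (x ⊗ₜ[ℂ] y) = t
    induction t using TensorProduct.induction_on with
    | zero => simp
    | add x y hx hy => simp only [map_add, TensorProduct.add_tmul, hx, hy]
    | tmul c d => simp [TensorProduct.smul_tmul]
  rw [hpq, hrs] at h
  simp only [TensorProduct.sum_tmul, TensorProduct.tmul_sum, map_sum, TensorProduct.assoc_tmul,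
    TensorProduct.assoc_symm_tmul, TensorProduct.map_tmul, LinearMap.id_apply,
    LinearEquiv.coe_coe, lslice_counit_T₁_symm, hl] at h
  rw [hpq, hrs]
  simpa using h.symm

/-- The covered form of `T₂⁻¹(a ⊗ b) = aS(b₍₁₎) ⊗ b₍₂₎`: coassociativity is applied to the legs of
`T₂⁻¹(a ⊗ b)`, then `T₂⁻¹` to the first two legs and `ε` to the middle one. -/
theorem T₂_symm_oneTmul_right (a b c : A) :
    (oneTmul c).right (𝒜.T₂.symm (a ⊗ₜ[ℂ] b)) =
      (tmulOne a).left (TensorProduct.map 𝒜.antipode.toLinearMap LinearMap.id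
        (𝒜.T₁ (b ⊗ₜ[ℂ] c))) := by
  obtain ⟨n, p, q, hpq⟩ := exists_sum_tmul (𝒜.T₁ (b ⊗ₜ[ℂ] c))
  obtain ⟨m, r, s, hrs⟩ := exists_sum_tmul (𝒜.T₂.symm (a ⊗ₜ[ℂ] b))
  have h : ∑ i, TensorProduct.assoc ℂ A A A (TensorProduct.map 𝒜.T₂.toLinearMap LinearMap.id
      ((TensorProduct.assoc ℂ A A A).symm (r i ⊗ₜ[ℂ] 𝒜.T₁ (s i ⊗ₜ[ℂ] c)))) =
      a ⊗ₜ[ℂ] 𝒜.T₁ (b ⊗ₜ[ℂ] c) := by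
    simp only [𝒜.coassoc, ← map_sum, ← TensorProduct.sum_tmul, ← hrs,
      LinearEquiv.apply_symm_apply]
    simp
  have h' := congrArg (fun w => TensorProduct.map (rslice 𝒜.counit ∘ₗ 𝒜.T₂.symm.toLinearMap)
    LinearMap.id ((TensorProduct.assoc ℂ A A A).symm w)) h
  have hl : ∀ x w, TensorProduct.map (rslice 𝒜.counit ∘ₗ 𝒜.T₂.symm.toLinearMap)
      LinearMap.id (TensorProduct.map 𝒜.T₂.toLinearMap LinearMap.id
      ((TensorProduct.assoc ℂ A A A).symm (x ⊗ₜ[ℂ] w))) = x ⊗ₜ[ℂ] lslice 𝒜.counit w := fun x w => by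
    induction w using TensorProduct.induction_on with
    | zero => simp
    | add x y hx hy => simp only [map_add, TensorProduct.tmul_add, hx, hy]
    | tmul c d => simp [TensorProduct.smul_tmul]
  simp only [map_sum, LinearEquiv.symm_apply_apply, hl, lslice_counit_T₁, hpq,
    TensorProduct.tmul_sum, TensorProduct.assoc_symm_tmul, TensorProduct.map_tmul,
    LinearMap.comp_apply, LinearEquiv.coe_coe, rslice_counit_T₂_symm, LinearMap.id_apply] at h'
  rw [hpq, hrs]
  simpa using h'

/-! ### The antipode and the involution -/

/-- With first factor `S(a)` the inverse needs no cover: `S(a)S(b₍₁₎) = S(b₍₁₎a)`, and `b₍₁₎a ⊗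
b₍₂₎` is `V(a ⊗ b)`. -/
theorem T₂_symm_antipode (a b : A) : 𝒜.T₂.symm (𝒜.antipode a ⊗ₜ[ℂ] b) =
    TensorProduct.map 𝒜.antipode.toLinearMap LinearMap.id (𝒜.V (a ⊗ₜ[ℂ] b)) := by
  refine 𝒜.oneTmul_right_cancel fun c => ?_
  rw [T₂_symm_oneTmul_right]
  have h1 : ∀ t, (tmulOne (𝒜.antipode a)).left
      (TensorProduct.map 𝒜.antipode.toLinearMap LinearMap.id t) =
      TensorProduct.map 𝒜.antipode.toLinearMap LinearMap.id ((tmulOne a).right t) := fun t => by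
    induction t using TensorProduct.induction_on with
    | zero => simp
    | add x y hx hy => simp only [map_add, hx, hy]
    | tmul c d => simp [antipode_mul]
  have h2 : ∀ t, (oneTmul c).right
      (TensorProduct.map 𝒜.antipode.toLinearMap LinearMap.id t) =
      TensorProduct.map 𝒜.antipode.toLinearMap LinearMap.id ((oneTmul c).right t) := fun t => by
    induction t using TensorProduct.induction_on with
    | zero => simp
    | add x y hx hy => simp only [map_add, hx, hy]
    | tmul c d => simp
  rw [h1, h2, T₁_tmulOne_right, V_right]

theorem T₁_symm_antipode (a c : A) : 𝒜.T₁.symm (a ⊗ₜ[ℂ] 𝒜.antipode c) =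
    TensorProduct.map LinearMap.id 𝒜.antipode.toLinearMap (𝒜.Y (c ⊗ₜ[ℂ] a)) := by
  refine 𝒜.tmulOne_left_cancel fun x => ?_
  rw [T₁_symm_tmulOne_left]
  have h1 : ∀ t, (oneTmul (𝒜.antipode c)).right
      (TensorProduct.map LinearMap.id 𝒜.antipode.toLinearMap t) =
      TensorProduct.map LinearMap.id 𝒜.antipode.toLinearMap ((oneTmul c).left t) := fun t => by
    induction t using TensorProduct.induction_on with
    | zero => simp
    | add x y hx hy => simp only [map_add, hx, hy]
    | tmul c d => simp [antipode_mul]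
  have h2 : ∀ t, (tmulOne x).left
      (TensorProduct.map LinearMap.id 𝒜.antipode.toLinearMap t) =
      TensorProduct.map LinearMap.id 𝒜.antipode.toLinearMap ((tmulOne x).left t) := fun t => by
    induction t using TensorProduct.induction_on with
    | zero => simp
    | add x y hx hy => simp only [map_add, hx, hy]
    | tmul c d => simp
  rw [h1, h2, T₂_oneTmul_left, Y_tmulOne_left]

/-- Put `S'(a) = S(a^*)^*`. The adjoint of the antipode axiom says that `S'(b₂)b₁ = ε(a)x` when `V(x
⊗ a)` is written as `b₁ ⊗ b₂`. Applying `S` gives `S(b₁)SS'(b₂) = ε(a)S(x)`, while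
`T₂_symm_antipode` gives `S(b₁)b₂ = ε(a)S(x)`. As `V` is onto, `S(c)SS'(p) = S(c)p` for all `c` and
`p`. -/
theorem antipode_star_antipode_star (p : A) :
    𝒜.antipode (star (𝒜.antipode (star p))) = p := by
  let S' : A →ₗ[ℂ] A :=
    { toFun := fun a => star (𝒜.antipode (star a))
      map_add' := fun x y => by simp
      map_smul' := fun c x => by simp }
  have key : LinearMap.mul' ℂ A ∘ₗ TensorProduct.map 𝒜.antipode.toLinearMap
      (𝒜.antipode.toLinearMap ∘ₗ S') =
      LinearMap.mul' ℂ A ∘ₗ TensorProduct.map 𝒜.antipode.toLinearMap LinearMap.id := by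
    refine 𝒜.ext_V fun x a => ?_
    have h1 : LinearMap.mul' ℂ A (TensorProduct.map S' LinearMap.id
        (TensorProduct.comm ℂ A A (𝒜.V (x ⊗ₜ[ℂ] a)))) = 𝒜.counit a • x := by
      have h := congrArg star (𝒜.mul_antipode_T₂ (star x) (star a))
      rw [star_mul'_map' 𝒜.antipode.toLinearMap S' fun _ => rfl, ← TensorProduct.star_tmul,
        ← V_apply] at h
      simpa [counit_star] using h
    have h2 : ∀ t : A ⊗[ℂ] A, LinearMap.mul' ℂ A (TensorProduct.map 𝒜.antipode.toLinearMap
        (𝒜.antipode.toLinearMap ∘ₗ S') t) = 𝒜.antipode (LinearMap.mul' ℂ A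
          (TensorProduct.map S' LinearMap.id (TensorProduct.comm ℂ A A t))) := fun t => by
      induction t using TensorProduct.induction_on with
      | zero => simp
      | add x y hx hy => simp only [map_add, hx, hy]
      | tmul c d => simp [antipode_mul]
    rw [LinearMap.comp_apply, LinearMap.comp_apply, h2, h1, ← T₂_symm_antipode, mul_T₂_symm,
      map_smul]
  refine 𝒜.mul_left_cancel' fun c => ?_
  have := LinearMap.congr_fun key (𝒜.antipode.symm c ⊗ₜ[ℂ] p)
  simpa [S'] using this

theorem star_antipode_star_antipode (p : A) :
    star (𝒜.antipode (star (𝒜.antipode p))) = p :=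
  𝒜.antipode.injective (𝒜.antipode_star_antipode_star _)

/-- `W(x ⊗ x') = S⁻¹(x'₍₁₎)x ⊗ x'₍₂₎`. -/
theorem W_tmul (x x' : A) : 𝒜.W (x ⊗ₜ[ℂ] x') =
    TensorProduct.map 𝒜.antipode.symm.toLinearMap LinearMap.id
      (𝒜.T₂ (𝒜.antipode x ⊗ₜ[ℂ] x')) := by
  have hs : ∀ a, star (𝒜.antipode.symm a) = 𝒜.antipode (star a) := fun a => by
    rw [← 𝒜.antipode_star_antipode_star (star (𝒜.antipode.symm a)), star_star,
      LinearEquiv.apply_symm_apply]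
  have h1 : ∀ t : A ⊗[ℂ] A, star (TensorProduct.map 𝒜.antipode.symm.toLinearMap LinearMap.id t) =
      TensorProduct.map 𝒜.antipode.toLinearMap LinearMap.id (star t) := fun t => by
    induction t using TensorProduct.induction_on with
    | zero => simp
    | add x y hx hy => simp only [map_add, star_add, hx, hy]
    | tmul c d => simp [hs]
  -- Under the involution `S⁻¹` becomes `S` and `T₂` becomes `V`, so the claim turns into
  -- `T₂_symm_antipode` for the adjoints.
  rw [W, LinearEquiv.symm_apply_eq, V_apply, h1]
  have h2 : star (𝒜.T₂ (𝒜.antipode x ⊗ₜ[ℂ] x')) =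
      𝒜.V (star (𝒜.antipode x) ⊗ₜ[ℂ] star x') := by
    rw [V_apply, TensorProduct.star_tmul, star_star, star_star]
  have h3 : 𝒜.antipode (star (𝒜.antipode x)) = star x := by
    simpa using 𝒜.antipode_star_antipode_star (star x)
  rw [h2, ← T₂_symm_antipode, LinearEquiv.apply_symm_apply, TensorProduct.star_tmul, h3,
    star_star, star_star]

/-! ### The antipode is anti-comultiplicative -/

/-- `T₂` carries right multiplication by `1 ⊗ d` to right multiplication by `Δ(d)`, so the cover in
`T₂_symm_oneTmul_right` becomes a coproduct. Both strong left invariance and the behaviour of `Δ`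
under `S` rest on this. -/
theorem T₂_antipode_T₁ (c a d : A) : 𝒜.T₂ ((tmulOne c).left
    (TensorProduct.map 𝒜.antipode.toLinearMap LinearMap.id (𝒜.T₁ (a ⊗ₜ[ℂ] d)))) =
    (𝒜.Δ d).right (c ⊗ₜ[ℂ] a) := by
  rw [← T₂_symm_oneTmul_right, ← Δ_right_T₂, LinearEquiv.apply_symm_apply]

/-- The flip composed with `S ⊗ S`. -/
def antipodeFlip : (A ⊗[ℂ] A) →ₗ[ℂ] (A ⊗[ℂ] A) :=
  TensorProduct.map 𝒜.antipode.toLinearMap 𝒜.antipode.toLinearMap ∘ₗ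
    (TensorProduct.comm ℂ A A).toLinearMap

@[simp] theorem antipodeFlip_tmul (a b : A) :
    𝒜.antipodeFlip (a ⊗ₜ[ℂ] b) = 𝒜.antipode b ⊗ₜ[ℂ] 𝒜.antipode a := by simp [antipodeFlip]

theorem antipodeFlip_mul (s t : A ⊗[ℂ] A) :
    𝒜.antipodeFlip (s * t) = 𝒜.antipodeFlip t * 𝒜.antipodeFlip s := by
  induction s using TensorProduct.induction_on with
  | zero => simp
  | add x y hx hy => simp only [map_add, add_mul, mul_add, hx, hy]
  | tmul a b =>
    induction t using TensorProduct.induction_on with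
    | zero => simp
    | add x y hx hy => simp only [map_add, add_mul, mul_add, hx, hy]
    | tmul c d => simp [antipode_mul, Algebra.TensorProduct.tmul_mul_tmul]

/-- In Sweedler notation, `Δ(S(p₍₁₎))(p₍₂₎q ⊗ S(c)) = q ⊗ S(cp)`. The core is `h1`, that is
`(S(p₍₁₎) ⊗ c)Δ(p₍₂₎q) = (1 ⊗ cp)Δ(q)`, which `T₁_symm_antipode` translates into a statement about
`T₁`. -/
theorem Δ_antipode_aux {n : ℕ} (r s : Fin n → A) (p q c : A)
    (h : 𝒜.T₁ (p ⊗ₜ[ℂ] q) = ∑ i, r i ⊗ₜ[ℂ] s i) :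
    ∑ i, (𝒜.Δ (𝒜.antipode (r i))).left (s i ⊗ₜ[ℂ] 𝒜.antipode c) =
      q ⊗ₜ[ℂ] 𝒜.antipode (c * p) := by
  have h1 : ∑ i, (tmulOne (𝒜.antipode (r i))).left (𝒜.Y (c ⊗ₜ[ℂ] s i)) =
      𝒜.Y ((c * p) ⊗ₜ[ℂ] q) := by
    refine 𝒜.tmulOne_left_cancel fun x => ?_
    have h2 := congrArg (oneTmul c).left (𝒜.T₂_antipode_T₁ x p q)
    rw [h] at h2
    simp only [map_sum, TensorProduct.map_tmul, LinearMap.id_apply, LinearEquiv.coe_coe,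
      tmulOne_left, T₂_oneTmul_left] at h2
    rw [left_right_comm 𝒜, oneTmul_left] at h2
    simpa only [map_sum, Y_tmulOne_left, left_right_comm 𝒜, tmulOne_left] using h2
  have h3 : ∀ t, ∀ a, (tmulOne a).left (TensorProduct.map LinearMap.id
      𝒜.antipode.toLinearMap t) =
      TensorProduct.map LinearMap.id 𝒜.antipode.toLinearMap ((tmulOne a).left t) := fun t a => by
    induction t using TensorProduct.induction_on with
    | zero => simp
    | add x y hx hy => simp only [map_add, hx, hy]
    | tmul c d => simp
  calc _ = ∑ i, 𝒜.T₁ (TensorProduct.map LinearMap.id 𝒜.antipode.toLinearMap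
        ((tmulOne (𝒜.antipode (r i))).left (𝒜.Y (c ⊗ₜ[ℂ] s i)))) := by
        refine Finset.sum_congr rfl fun i _ => ?_
        rw [← h3, ← Δ_left_T₁, ← T₁_symm_antipode, LinearEquiv.apply_symm_apply]
    _ = _ := by
      rw [← map_sum, ← map_sum, h1, ← T₁_symm_antipode, LinearEquiv.apply_symm_apply]

/-- `Δ(S(a))(S(b) ⊗ S(c))` is the image of `(c ⊗ b)Δ(a)` under `S ⊗ S` and the flip. -/
theorem Δ_antipode (a b c : A) :
    (𝒜.Δ (𝒜.antipode a)).left (𝒜.antipode b ⊗ₜ[ℂ] 𝒜.antipode c) =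
      𝒜.antipodeFlip ((𝒜.Δ a).right (c ⊗ₜ[ℂ] b)) := by
  let G : A ⊗[ℂ] A →ₗ[ℂ] A ⊗[ℂ] A := TensorProduct.lift (LinearMap.mk₂ ℂ
    (fun r s => (𝒜.Δ (𝒜.antipode r)).left (s ⊗ₜ[ℂ] 𝒜.antipode c))
    (fun x y z => by simp [Multiplier.add_left]) (fun k x y => by simp [Multiplier.smul_left])
    (fun x y z => by simp [TensorProduct.add_tmul])
    (fun k x y => by simp [← TensorProduct.smul_tmul']))
  have hG : G ∘ₗ 𝒜.T₁.toLinearMap = (TensorProduct.comm ℂ A A).toLinearMap ∘ₗ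
      TensorProduct.map (𝒜.antipode.toLinearMap ∘ₗ LinearMap.mulLeft ℂ c) LinearMap.id :=
    TensorProduct.ext' fun p q => by
      obtain ⟨n, r, s, h⟩ := exists_sum_tmul (𝒜.T₁ (p ⊗ₜ[ℂ] q))
      simpa [h, G] using 𝒜.Δ_antipode_aux r s p q c h
  -- This argument isolates the pure tensor `a ⊗ S(b)` on the left, and its preimage under `T₁` is
  -- explicit: `(ι ⊗ S)((1 ⊗ b)Δ(a))`.
  have h1 := LinearMap.congr_fun hG (𝒜.T₁.symm (a ⊗ₜ[ℂ] 𝒜.antipode b))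
  rw [T₁_symm_antipode, LinearMap.comp_apply, ← T₁_symm_antipode, LinearEquiv.coe_coe,
    LinearEquiv.apply_symm_apply, T₁_symm_antipode] at h1
  have h2 : ∀ t : A ⊗[ℂ] A, TensorProduct.comm ℂ A A (TensorProduct.map
      (𝒜.antipode.toLinearMap ∘ₗ LinearMap.mulLeft ℂ c) LinearMap.id
        (TensorProduct.map LinearMap.id 𝒜.antipode.toLinearMap t)) =
      𝒜.antipodeFlip ((tmulOne c).left t) := fun t => by
    induction t using TensorProduct.induction_on with
    | zero => simp
    | add x y hx hy => simp only [map_add, hx, hy]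
    | tmul c d => simp
  rw [← Y_tmulOne_left, ← h2]
  simpa [G] using h1

theorem tmul_mul_T₁ (a c d b : A) : (d ⊗ₜ[ℂ] b) * 𝒜.T₁ (a ⊗ₜ[ℂ] c) =
    (oneTmul c).right ((𝒜.Δ a).right (d ⊗ₜ[ℂ] b)) := by
  apply 𝒜.incl_inj
  rw [← Multiplier.incl_mul, ← Multiplier.incl_mul, mul_assoc, ← T₁_spec, Multiplier.incl_mul]
  simp

/-- Together with `T₂_antipode`, this is anti-comultiplicativity of `S` on elements of `A ⊗ A`: `S ⊗
S` and the flip exchange the two canonical maps, and hence left and right invariance. -/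
theorem T₁_antipode (a c : A) : 𝒜.T₁ (𝒜.antipode a ⊗ₜ[ℂ] 𝒜.antipode c) =
    𝒜.antipodeFlip (𝒜.T₂ (c ⊗ₜ[ℂ] a)) := by
  refine 𝒜.mul_tmul_cancel fun b d => ?_
  obtain ⟨b, rfl⟩ := 𝒜.antipode.surjective b
  obtain ⟨d, rfl⟩ := 𝒜.antipode.surjective d
  rw [T₁_mul, ← antipode_mul, Δ_antipode, ← antipodeFlip_tmul 𝒜 d b, ← antipodeFlip_mul,
    tmul_mul_eq, T₂_oneTmul_left, left_right_comm 𝒜, tmulOne_left]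

theorem T₂_antipode (a c : A) : 𝒜.T₂ (𝒜.antipode c ⊗ₜ[ℂ] 𝒜.antipode a) =
    𝒜.antipodeFlip (𝒜.T₁ (a ⊗ₜ[ℂ] c)) := by
  refine 𝒜.mul_tmul_cancel fun b d => ?_
  obtain ⟨b, rfl⟩ := 𝒜.antipode.surjective b
  obtain ⟨d, rfl⟩ := 𝒜.antipode.surjective d
  rw [T₂_mul, Δ_antipode, ← antipodeFlip_tmul 𝒜 d b, ← antipodeFlip_mul, tmul_mul_T₁]
  generalize (𝒜.Δ a).right (d ⊗ₜ[ℂ] b) = t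
  induction t using TensorProduct.induction_on with
  | zero => simp
  | add x y hx hy => simp only [map_add, hx, hy]
  | tmul p q => simp [antipode_mul]

end MultiplierHopfStarAlgebra

/-! ### Right-invariant functionals -/

namespace MultiplierHopfStarAlgebra

variable {A : Type*} [NonUnitalRing A] [StarRing A] [Module ℂ A]
    [IsScalarTower ℂ A A] [SMulCommClass ℂ A A] [StarModule ℂ A]
    (𝒜 : MultiplierHopfStarAlgebra A)

/-- Right invariance of a functional: `(ψ ⊗ ι)(Δ(a)(1 ⊗ b)) = ψ(a)b`. -/
def IsRightInvariant (ψ : Module.Dual ℂ A) : Prop :=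
  ∀ a b : A, lslice ψ (𝒜.T₁ (a ⊗ₜ[ℂ] b)) = ψ a • b

variable {𝒜}

theorem IsRightInvariant.lslice_T₁ {ψ : Module.Dual ℂ A} (hψ : 𝒜.IsRightInvariant ψ)
    (t : A ⊗[ℂ] A) : lslice ψ (𝒜.T₁ t) = lslice ψ t := by
  have : lslice ψ ∘ₗ 𝒜.T₁.toLinearMap = lslice ψ :=
    TensorProduct.ext' fun a b => by simpa using hψ a b
  exact LinearMap.congr_fun this t

/-- `T₁` intertwines `a ⊗ 1` with `Δ(a)`, and right invariance makes `T₁` invisible to `ψ ⊗ ι`. -/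
theorem IsRightInvariant.lslice_T₁_symm {ψ : Module.Dual ℂ A} (hψ : 𝒜.IsRightInvariant ψ)
    (a : A) (t : A ⊗[ℂ] A) :
    lslice ψ ((tmulOne a).left (𝒜.T₁.symm t)) = lslice ψ ((𝒜.Δ a).left t) := by
  rw [← hψ.lslice_T₁, ← Δ_left_T₁, LinearEquiv.apply_symm_apply]

theorem IsRightInvariant.lslice_V_mul {ψ : Module.Dual ℂ A} (hψ : 𝒜.IsRightInvariant ψ)
    (a c d : A) : lslice ψ (𝒜.V (c ⊗ₜ[ℂ] a)) * d =
      lslice ψ ((tmulOne a).left (𝒜.T₁.symm (c ⊗ₜ[ℂ] d))) := by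
  rw [hψ.lslice_T₁_symm, ← V_right, lslice_oneTmul_right]

/-- `(ψ ⊗ ι)(Δ(a)(c ⊗ 1)) = (ψ ⊗ S)((a ⊗ 1)Δ(c))` for right invariant `ψ`. -/
theorem IsRightInvariant.lslice_V {ψ : Module.Dual ℂ A} (hψ : 𝒜.IsRightInvariant ψ)
    (a c : A) : lslice ψ (𝒜.V (c ⊗ₜ[ℂ] a)) = 𝒜.antipode (lslice ψ (𝒜.T₂ (a ⊗ₜ[ℂ] c))) := by
  refine 𝒜.mul_right_cancel' fun d => ?_
  rw [hψ.lslice_V_mul, T₁_symm_tmulOne_left, lslice_oneTmul_right]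
  congr 1
  generalize 𝒜.T₂ (a ⊗ₜ[ℂ] c) = t
  induction t using TensorProduct.induction_on with
  | zero => simp
  | add x y hx hy => simp only [map_add, hx, hy]
  | tmul x y => simp

/-! ### Left invariance and strong left invariance -/

namespace PositiveLeftIntegral

variable (Φ : 𝒜.PositiveLeftIntegral)

theorem fourier_apply (c a : A) : Φ.fourier c a = Φ.φ (a * c) := rfl

theorem rslice_T₂ (t : A ⊗[ℂ] A) : rslice Φ.φ (𝒜.T₂ t) = rslice Φ.φ t := by
  have : rslice Φ.φ ∘ₗ 𝒜.T₂.toLinearMap = rslice Φ.φ :=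
    TensorProduct.ext' fun a b => by 
      rw [LinearMap.comp_apply, LinearEquiv.coe_coe, rslice_tmul]; exact Φ.left_invariant b a
  exact LinearMap.congr_fun this t

/-- Left invariance is stated with a cover on the left of `Δ`. After covering with a further `a`,
the two sides of `(a ⊗ 1)Δ(b)(c ⊗ 1)` may be exchanged. -/
theorem rslice_V (t : A ⊗[ℂ] A) : rslice Φ.φ (𝒜.V t) = rslice Φ.φ t := by
  have : rslice Φ.φ ∘ₗ 𝒜.V.toLinearMap = rslice Φ.φ := TensorProduct.ext' fun c b => by
    refine 𝒜.mul_left_cancel' fun a => ?_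
    rw [LinearMap.comp_apply, LinearEquiv.coe_coe, ← rslice_tmulOne_left, ← T₂_tmulOne_right,
      rslice_tmulOne_right, rslice_T₂]
    simp [smul_mul_assoc, mul_smul_comm]
  exact LinearMap.congr_fun this t

/-- `V` intertwines `1 ⊗ a` with `Δ(a)` and is invisible to `ι ⊗ φ`. -/
theorem rslice_W (a : A) (t : A ⊗[ℂ] A) :
    rslice Φ.φ ((oneTmul a).left (𝒜.W t)) = rslice Φ.φ ((𝒜.Δ a).left t) := by
  obtain ⟨t, rfl⟩ := 𝒜.V.surjective t
  rw [W, LinearEquiv.symm_apply_apply, ← rslice_V]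
  congr 1
  induction t using TensorProduct.induction_on with
  | zero => simp
  | add x y hx hy => simp only [map_add, hx, hy]
  | tmul x y => rw [Δ_left_V, oneTmul_left]

theorem rslice_W_tmul (a c d : A) : rslice Φ.φ ((oneTmul a).left (𝒜.W (c ⊗ₜ[ℂ] d))) =
    rslice Φ.φ (𝒜.T₁ (a ⊗ₜ[ℂ] d)) * c := by
  rw [rslice_W, ← T₁_tmulOne_right, rslice_tmulOne_right]

/-- Strong left invariance: `S((ι ⊗ φ)(Δ(a)(1 ⊗ d))) = (ι ⊗ φ)((1 ⊗ a)Δ(d))`. -/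
theorem antipode_rslice_T₁ (a d : A) :
    𝒜.antipode (rslice Φ.φ (𝒜.T₁ (a ⊗ₜ[ℂ] d))) = rslice Φ.φ (𝒜.Y (a ⊗ₜ[ℂ] d)) := by
  refine 𝒜.mul_left_cancel' fun c => ?_
  rw [← rslice_tmulOne_left, Y_tmulOne_left, ← T₂_antipode_T₁, rslice_T₂, rslice_tmulOne_left]
  congr 1
  generalize 𝒜.T₁ (a ⊗ₜ[ℂ] d) = t
  induction t using TensorProduct.induction_on with
  | zero => simp
  | add x y hx hy => simp only [map_add, hx, hy]
  | tmul x y => simp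

/-! #### Faithfulness -/

/-- Write `t = ∑ bᵢ ⊗ mᵢ` with a basis `b`. The hypothesis says `φ(bmᵢ) = 0` for every `i` and every
`b`; taking `b = bᵢ` kills each term of `φ(∑ bᵢmᵢ)`. -/
theorem apply_mul'_eq_zero (t : A ⊗[ℂ] A)
    (h : ∀ b, rslice Φ.φ ((oneTmul b).left t) = 0) : Φ.φ (LinearMap.mul' ℂ A t) = 0 := by
  classical
  let b := Module.Basis.ofVectorSpace ℂ A
  obtain ⟨m, rfl⟩ := (TensorProduct.equivFinsuppOfBasisLeft (N := A) b).symm.surjective t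
  rw [TensorProduct.equivFinsuppOfBasisLeft_symm_apply] at h ⊢
  rw [Finsupp.sum, map_sum, map_sum]
  refine Finset.sum_eq_zero fun i _ => ?_
  have h1 := congrArg (b.coord i) (h (b i))
  by_cases hm : m i = 0
  · simp [hm]
  · simpa [Finsupp.sum, Finsupp.single_apply, hm] using h1

/-- By strong left invariance this slice is `S` of `(ι ⊗ φ)(Δ(b)(1 ⊗ n))`, in which `φ` only meets
elements multiplied on the right by `n`. -/
theorem rslice_Y_eq_zero {n : A} (h : ∀ b, Φ.φ (b * n) = 0) (b : A) :
    rslice Φ.φ (𝒜.Y (b ⊗ₜ[ℂ] n)) = 0 := by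
  have hn : Φ.φ ∘ₗ LinearMap.mulRight ℂ n = 0 := LinearMap.ext h
  rw [← antipode_rslice_T₁]
  suffices rslice Φ.φ (𝒜.T₁ (b ⊗ₜ[ℂ] n)) = 0 by rw [this, map_zero]
  refine 𝒜.mul_left_cancel' fun x => ?_
  rw [← rslice_tmulOne_left, ← T₂_right_eq, rslice_oneTmul_right, hn]
  simp [rslice]

/-- The element `T₂⁻¹(S(y) ⊗ n)` has product `ε(n)S(y)` and satisfies the hypothesis of
`apply_mul'_eq_zero`, so `ε(n)φ(S(y)) = 0`. It remains to choose `y` with `φ(S(y)) ≠ 0`. -/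
theorem counit_eq_zero_of_apply_mul_eq_zero {n : A} (h : ∀ b, Φ.φ (b * n) = 0) :
    𝒜.counit n = 0 := by
  obtain ⟨y, hy⟩ : ∃ y, Φ.φ y ≠ 0 := by
    by_contra! h
    exact Φ.ne_zero (LinearMap.ext h)
  obtain ⟨y, rfl⟩ := 𝒜.antipode.surjective y
  have h1 := Φ.apply_mul'_eq_zero (𝒜.T₂.symm (𝒜.antipode y ⊗ₜ[ℂ] n)) fun b => by
    rw [T₂_symm_antipode]
    have h2 : ∀ t : A ⊗[ℂ] A, rslice Φ.φ ((oneTmul b).left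
        (TensorProduct.map 𝒜.antipode.toLinearMap LinearMap.id t)) =
        𝒜.antipode (rslice Φ.φ ((oneTmul b).left t)) := fun t => by
      induction t using TensorProduct.induction_on with
      | zero => simp
      | add x y hx hy => simp only [map_add, hx, hy]
      | tmul x y => simp
    rw [h2, ← Y_tmulOne_right, rslice_tmulOne_right, Φ.rslice_Y_eq_zero h, zero_mul, map_zero]
  rw [mul_T₂_symm, map_smul, smul_eq_mul] at h1
  exact (mul_eq_zero.mp h1).resolve_right hy

/-- A positive left integral is faithful. -/
theorem eq_zero_of_apply_mul_eq_zero {n : A} (h : ∀ b, Φ.φ (b * n) = 0) : n = 0 := by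
  refine 𝒜.eq_zero_of_mul_left _ fun x => ?_
  rw [← Module.forall_dual_apply_eq_zero_iff ℂ]
  intro f
  rw [← rslice_counit_T₂, ← apply_lslice]
  -- The elements `n` annihilated by all `φ(b · )` are stable under the slices `(f ⊗ ι)((x ⊗
  -- 1)Δ(n))`, and `ε` of such a slice is `f(xn)`.
  refine Φ.counit_eq_zero_of_apply_mul_eq_zero fun b => ?_
  rw [← lslice_oneTmul_left, apply_lslice, T₂_oneTmul_left, ← Y_tmulOne_left, rslice_tmulOne_left,
    Φ.rslice_Y_eq_zero h, mul_zero, map_zero]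

theorem fourier_injective : Function.Injective Φ.fourier := by
  rw [← LinearMap.ker_eq_bot, LinearMap.ker_eq_bot']
  exact fun c hc => Φ.eq_zero_of_apply_mul_eq_zero fun b => LinearMap.congr_fun hc b

/-- Hermitian symmetry of `φ` moves faithfulness to the other variable: the functionals `φ( · c)`
separate the points of `A`. -/
theorem eq_zero_of_forall_fourier {a : A} (h : ∀ c, Φ.fourier c a = 0) : a = 0 := by
  refine star_eq_zero.mp (Φ.eq_zero_of_apply_mul_eq_zero fun b => ?_)
  have h1 := Φ.conj_symm (star a) (star b)
  have h2 : Φ.φ (a * star b) = 0 := h _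
  rw [star_star, star_star, h2] at h1
  simpa using h1

/-! #### The right integral `φ ∘ S` and comparison of functionals -/

/-- The right integral `φ ∘ S`. -/
def ψ : Module.Dual ℂ A := Φ.φ ∘ₗ 𝒜.antipode.toLinearMap

theorem ψ_apply (a : A) : Φ.ψ a = Φ.φ (𝒜.antipode a) := rfl

theorem ψ_ne_zero : Φ.ψ ≠ 0 := fun h => Φ.ne_zero (LinearMap.ext fun a => by
  simpa [ψ] using LinearMap.congr_fun h (𝒜.antipode.symm a))

/-- Left invariance transported by `T₂_antipode`. -/
theorem isRightInvariant_ψ : 𝒜.IsRightInvariant Φ.ψ := fun a b => 𝒜.antipode.injective <| by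
  have h := Φ.rslice_T₂ (𝒜.antipode b ⊗ₜ[ℂ] 𝒜.antipode a)
  rw [T₂_antipode, rslice_tmul] at h
  rw [map_smul, ψ_apply, ← h]
  generalize 𝒜.T₁ (a ⊗ₜ[ℂ] b) = t
  induction t using TensorProduct.induction_on with
  | zero => simp
  | add x y hx hy => simp only [map_add, hx, hy]
  | tmul x y => simp [ψ]

/-- Both sides are `(ψ ⊗ φ)(Δ(a)t)`, evaluated with left invariance of `φ` and with right invariance
of `ψ`. As `W`, `T₁` and the slices are onto, the functionals `φ( · e)` and `ψ( · f)` form the same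
space. -/
theorem exists_fourier_eq (t : A ⊗[ℂ] A) (a : A) : Φ.φ (a * lslice Φ.ψ (𝒜.W t)) =
    Φ.ψ (a * rslice Φ.φ (𝒜.T₁.symm t)) := by
  rw [← lslice_oneTmul_left, apply_lslice, rslice_W, ← apply_lslice,
    ← Φ.isRightInvariant_ψ.lslice_T₁_symm, apply_lslice, rslice_tmulOne_left]

theorem exists_ψ_eq_φ (f : A) : ∃ e, ∀ a, Φ.ψ (a * f) = Φ.φ (a * e) := by
  obtain ⟨t, rfl⟩ := rslice_surjective (X := A) Φ.ne_zero f
  exact ⟨_, fun a => by rw [Φ.exists_fourier_eq (𝒜.T₁ t), LinearEquiv.symm_apply_apply]⟩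

theorem exists_φ_eq_ψ (e : A) : ∃ f, ∀ a, Φ.ψ (a * f) = Φ.φ (a * e) := by
  obtain ⟨t, rfl⟩ := lslice_surjective (Y := A) Φ.ψ_ne_zero e
  obtain ⟨t, rfl⟩ := 𝒜.W.surjective t
  exact ⟨_, fun a => (Φ.exists_fourier_eq t a).symm⟩

/-- Both sides are `(ψ ⊗ φ)((1 ⊗ a)Δ(x)(b ⊗ 1))`: the antipode formula for `ψ` isolates `x` on the
left, and strong left invariance of `φ` isolates it on the right. Hence the functionals `ψ( · f)`
and `φ(e · )` form the same space. -/
theorem ψ_mul_eq_φ_mul (a b x : A) :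
    Φ.ψ (x * rslice Φ.ψ (𝒜.T₁ (b ⊗ₜ[ℂ] 𝒜.antipode.symm a))) =
      Φ.φ (lslice (Φ.ψ ∘ₗ 𝒜.antipode.toLinearMap) (𝒜.T₂ (𝒜.antipode.symm b ⊗ₜ[ℂ] a)) * x) := by
  trans Φ.φ (a * lslice Φ.ψ (𝒜.V (b ⊗ₜ[ℂ] x)))
  · rw [Φ.isRightInvariant_ψ.lslice_V, ← rslice_tmulOne_left, ← T₂_right_eq, ← apply_lslice,
      lslice_oneTmul_right, ψ_apply, antipode_mul, LinearEquiv.apply_symm_apply]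
  · rw [← lslice_oneTmul_right, T₂_right_eq, ← lslice_oneTmul_left, apply_lslice, apply_lslice,
      rslice_tmulOne_left, ← Y_tmulOne_right, rslice_tmulOne_right, ← antipode_rslice_T₁]
    simp [antipode_mul]

theorem exists_ψ_eq_φ_left (f : A) : ∃ e, ∀ a, Φ.ψ (a * f) = Φ.φ (e * a) := by
  obtain ⟨t, rfl⟩ := rslice_surjective (X := A) Φ.ψ_ne_zero f
  obtain ⟨t, rfl⟩ := 𝒜.T₁.surjective t
  induction t using TensorProduct.induction_on with
  | zero => exact ⟨0, by simp⟩
  | add x y hx hy =>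
    obtain ⟨e, he⟩ := hx
    obtain ⟨e', he'⟩ := hy
    exact ⟨e + e', fun a => by simp only [map_add, mul_add, add_mul, he, he']⟩
  | tmul b a =>
    obtain ⟨a, rfl⟩ := 𝒜.antipode.symm.surjective a
    exact ⟨_, Φ.ψ_mul_eq_φ_mul a b⟩

theorem exists_φ_left_eq_ψ (e : A) : ∃ f, ∀ a, Φ.ψ (a * f) = Φ.φ (e * a) := by
  have hne : Φ.ψ ∘ₗ 𝒜.antipode.toLinearMap ≠ 0 := fun h => Φ.ψ_ne_zero (LinearMap.ext fun a => by
    simpa using LinearMap.congr_fun h (𝒜.antipode.symm a))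
  obtain ⟨t, rfl⟩ := lslice_surjective (Y := A) hne e
  obtain ⟨t, rfl⟩ := 𝒜.T₂.surjective t
  induction t using TensorProduct.induction_on with
  | zero => exact ⟨0, by simp⟩
  | add x y hx hy =>
    obtain ⟨e, he⟩ := hx
    obtain ⟨e', he'⟩ := hy
    exact ⟨e + e', fun a => by simp only [map_add, mul_add, add_mul, he, he']⟩
  | tmul b a =>
    obtain ⟨b, rfl⟩ := 𝒜.antipode.symm.surjective b
    exact ⟨_, Φ.ψ_mul_eq_φ_mul a b⟩

theorem exists_equiv_of_range_eq {X Y Z : Type*} [AddCommGroup X] [Module ℂ X] [AddCommGroup Y]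
    [Module ℂ Y] [AddCommGroup Z] [Module ℂ Z] {f : X →ₗ[ℂ] Z} {g : Y →ₗ[ℂ] Z}
    (hf : Function.Injective f) (hg : Function.Injective g)
    (h₁ : ∀ y, ∃ x, f x = g y) (h₂ : ∀ x, ∃ y, f x = g y) :
    ∃ θ : Y ≃ₗ[ℂ] X, ∀ y, f (θ y) = g y := by
  have h : LinearMap.range g = LinearMap.range f := le_antisymm
    (by rintro _ ⟨y, rfl⟩; exact h₁ y) (by rintro _ ⟨x, rfl⟩; exact (h₂ x).imp fun _ h => h.symm)
  refine ⟨(LinearEquiv.ofInjective g hg).trans ((LinearEquiv.ofEq _ _ h).trans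
    (LinearEquiv.ofInjective f hf).symm), fun y => ?_⟩
  rw [← LinearEquiv.ofInjective_apply (h := hf)]
  simp

/-- The linear bijection `θ` with `φ(aθ(z)) = φ(S(az))`. -/
theorem exists_ψ_equiv : ∃ θ : A ≃ₗ[ℂ] A, ∀ z a, Φ.φ (a * θ z) = Φ.ψ (a * z) := by
  obtain ⟨θ, h⟩ := exists_equiv_of_range_eq (f := Φ.fourier)
    (g := (LinearMap.mul ℂ A).flip.compr₂ Φ.ψ) Φ.fourier_injective
    (by
      rw [← LinearMap.ker_eq_bot, LinearMap.ker_eq_bot']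
      intro z hz
      rw [← 𝒜.antipode.map_eq_zero_iff]
      refine Φ.eq_zero_of_forall_fourier fun c => ?_
      obtain ⟨c, rfl⟩ := 𝒜.antipode.surjective c
      rw [fourier_apply, ← antipode_mul]
      exact LinearMap.congr_fun hz c)
    (fun z => (Φ.exists_ψ_eq_φ z).imp fun e h => LinearMap.ext fun a => (h a).symm)
    (fun z => (Φ.exists_φ_eq_ψ z).imp fun e h => LinearMap.ext fun a => (h a).symm)
  exact ⟨θ, fun z a => LinearMap.congr_fun (h z) a⟩

/-- The linear bijection `ρ` with `φ(yρ(x)) = φ(S⁻¹(x)y)`. -/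
theorem exists_antipode_symm_equiv :
    ∃ ρ : A ≃ₗ[ℂ] A, ∀ x y, Φ.φ (y * ρ x) = Φ.φ (𝒜.antipode.symm x * y) := by
  obtain ⟨σ, h⟩ := exists_equiv_of_range_eq (f := Φ.fourier)
    (g := (LinearMap.mul ℂ A).compr₂ Φ.φ) Φ.fourier_injective
    (by
      rw [← LinearMap.ker_eq_bot, LinearMap.ker_eq_bot']
      exact fun z hz => Φ.eq_zero_of_forall_fourier fun c => LinearMap.congr_fun hz c)
    -- The passage between `φ(z · )` and `φ( · e)` goes through `ψ( · f)`.
    (fun z => by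
      obtain ⟨f, hf⟩ := Φ.exists_φ_left_eq_ψ z
      obtain ⟨e, he⟩ := Φ.exists_ψ_eq_φ f
      exact ⟨e, LinearMap.ext fun a => (he a).symm.trans (hf a)⟩)
    (fun z => by
      obtain ⟨f, hf⟩ := Φ.exists_φ_eq_ψ z
      obtain ⟨e, he⟩ := Φ.exists_ψ_eq_φ_left f
      exact ⟨e, LinearMap.ext fun a => (hf a).symm.trans (he a)⟩)
  exact ⟨𝒜.antipode.symm.trans σ, fun x y => LinearMap.congr_fun (h _) y⟩

/-! #### The actions of functionals `φ( · d)` -/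

/-- The map `a ↦ (ι ⊗ φ( · d))Δ(a)`. -/
def R (d : A) : A →ₗ[ℂ] A :=
  rslice Φ.φ ∘ₗ 𝒜.T₁.toLinearMap ∘ₗ (TensorProduct.mk ℂ A A).flip d

/-- The map `a ↦ (φ( · d) ⊗ ι)Δ(a)`. -/
def L (d : A) : A →ₗ[ℂ] A :=
  lslice Φ.φ ∘ₗ 𝒜.V.toLinearMap ∘ₗ TensorProduct.mk ℂ A A d

theorem R_apply (d a : A) : Φ.R d a = rslice Φ.φ (𝒜.T₁ (a ⊗ₜ[ℂ] d)) := rfl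

theorem L_apply (d a : A) : Φ.L d a = lslice Φ.φ (𝒜.V (d ⊗ₜ[ℂ] a)) := rfl

theorem fourier_eq (d : A) : Φ.fourier d = Φ.φ ∘ₗ LinearMap.mulRight ℂ d := rfl

theorem rslice_fourier_V (d a x : A) :
    rslice (Φ.fourier d) (𝒜.V (x ⊗ₜ[ℂ] a)) = Φ.R d a * x := by
  rw [fourier_eq, ← rslice_oneTmul_right, V_right, ← T₁_tmulOne_right, rslice_tmulOne_right,
    R_apply]

theorem rslice_fourier_T₂ (d a x : A) :
    rslice (Φ.fourier d) (𝒜.T₂ (x ⊗ₜ[ℂ] a)) = x * Φ.R d a := by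
  rw [fourier_eq, ← rslice_oneTmul_right, T₂_right_eq, rslice_tmulOne_left, R_apply]

theorem lslice_fourier_T₁ (d a x : A) :
    lslice (Φ.fourier d) (𝒜.T₁ (a ⊗ₜ[ℂ] x)) = Φ.L d a * x := by
  rw [fourier_eq, ← lslice_tmulOne_right, T₁_tmulOne_right, ← V_right, lslice_oneTmul_right,
    L_apply]

theorem lslice_fourier_Y (d a x : A) :
    lslice (Φ.fourier d) (𝒜.Y (x ⊗ₜ[ℂ] a)) = x * Φ.L d a := by
  rw [fourier_eq, ← lslice_tmulOne_right, Y_tmulOne_right, lslice_oneTmul_left, L_apply]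

/-- Both sides are `φ( · d) ⊗ φ( · c)` applied to `Δ(a)`. -/
theorem fourier_L (c d a : A) : Φ.fourier c (Φ.L d a) = Φ.fourier d (Φ.R c a) := by
  rw [L_apply, apply_lslice, rslice_fourier_V, fourier_apply]

/-- The slice `ι ⊗ ι ⊗ φ` of coassociativity at `x`, `b`, `d`. -/
theorem T₂_R (d x b : A) :
    𝒜.T₂ (x ⊗ₜ[ℂ] Φ.R d b) = TensorProduct.map LinearMap.id (Φ.R d) (𝒜.T₂ (x ⊗ₜ[ℂ] b)) := by
  have h := congrArg (fun w => rslice Φ.φ ((TensorProduct.assoc ℂ A A A).symm w))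
    (𝒜.coassoc x b d)
  simp only [LinearEquiv.symm_apply_apply] at h
  have h1 : ∀ t : A ⊗[ℂ] A, rslice Φ.φ (TensorProduct.map 𝒜.T₂.toLinearMap LinearMap.id
      ((TensorProduct.assoc ℂ A A A).symm (x ⊗ₜ[ℂ] t))) = 𝒜.T₂ (x ⊗ₜ[ℂ] rslice Φ.φ t) := fun t => by
    induction t using TensorProduct.induction_on with
    | zero => simp
    | add x y hx hy => simp only [map_add, TensorProduct.tmul_add, hx, hy]
    | tmul y z => simp
  rw [R_apply, ← h1, h]
  generalize 𝒜.T₂ (x ⊗ₜ[ℂ] b) = t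
  have h2 : ∀ (y : A) (w : A ⊗[ℂ] A), rslice Φ.φ ((TensorProduct.assoc ℂ A A A).symm
      (y ⊗ₜ[ℂ] w)) = y ⊗ₜ[ℂ] rslice Φ.φ w := fun y w => by
    induction w using TensorProduct.induction_on with
    | zero => simp
    | add x y hx hy => simp only [map_add, TensorProduct.tmul_add, hx, hy]
    | tmul y z => simp
  induction t using TensorProduct.induction_on with
  | zero => simp
  | add x y hx hy => simp only [map_add, TensorProduct.add_tmul, hx, hy]
  | tmul y z => simp [h2, R_apply]

theorem V_R (d x b : A) :
    𝒜.V (x ⊗ₜ[ℂ] Φ.R d b) = TensorProduct.map LinearMap.id (Φ.R d) (𝒜.V (x ⊗ₜ[ℂ] b)) := by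
  refine 𝒜.tmulOne_left_cancel fun c => ?_
  have h1 : ∀ t : A ⊗[ℂ] A, (tmulOne c).left (TensorProduct.map LinearMap.id (Φ.R d) t) =
      TensorProduct.map LinearMap.id (Φ.R d) ((tmulOne c).left t) := fun t => by
    induction t using TensorProduct.induction_on with
    | zero => simp
    | add x y hx hy => simp only [map_add, hx, hy]
    | tmul y z => simp
  have h2 : ∀ t : A ⊗[ℂ] A, (tmulOne x).right (TensorProduct.map LinearMap.id (Φ.R d) t) =
      TensorProduct.map LinearMap.id (Φ.R d) ((tmulOne x).right t) := fun t => by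
    induction t using TensorProduct.induction_on with
    | zero => simp
    | add x y hx hy => simp only [map_add, hx, hy]
    | tmul y z => simp
  rw [← T₂_tmulOne_right, T₂_R, h1, ← T₂_tmulOne_right, h2]

/-- Coassociativity in terms of the two actions of functionals. Dually, left and right convolutions
commute. -/
theorem L_R_comm (c d a : A) : Φ.L c (Φ.R d a) = Φ.R d (Φ.L c a) := by
  rw [L_apply, V_R, L_apply]
  generalize 𝒜.V (c ⊗ₜ[ℂ] a) = t
  induction t using TensorProduct.induction_on with
  | zero => simp
  | add x y hx hy => simp only [map_add, hx, hy]
  | tmul y z => simp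

/-- Read off from `Δ(uv)(1 ⊗ d) = Δ(u)(Δ(v)(1 ⊗ d))`. It is the source of multiplicativity of the
dual coproduct. -/
theorem R_mul {n : ℕ} (r s : Fin n → A) (d u v : A)
    (h : 𝒜.T₁ (v ⊗ₜ[ℂ] d) = ∑ i, r i ⊗ₜ[ℂ] s i) : Φ.R d (u * v) = ∑ i, Φ.R (s i) u * r i := by
  have h1 := 𝒜.Δ_left_T₁ u (v ⊗ₜ[ℂ] d)
  rw [tmulOne_left, h, map_sum] at h1
  rw [R_apply, ← h1, map_sum]
  simp only [R_apply, ← rslice_tmulOne_right, T₁_tmulOne_right]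

/-! #### The convolution product -/

/-- The product of `A` for which `φ( · (c ⋆ d))` is the convolution of `φ( · c)` and `φ( · d)`. -/
def conv (c d : A) : A := lslice Φ.φ (𝒜.W (c ⊗ₜ[ℂ] d))

/-- By `rslice_W`, `(φ ⊗ φ)((1 ⊗ a)W(c ⊗ d)) = (φ ⊗ φ)(Δ(a)(c ⊗ d))`, the convolution of `φ( · c)`
and `φ( · d)` at `a`. -/
theorem fourier_conv (c d a : A) : Φ.fourier (Φ.conv c d) a = Φ.fourier c (Φ.R d a) := by
  rw [conv, fourier_apply, ← lslice_oneTmul_left, apply_lslice, rslice_W_tmul, fourier_apply,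
    R_apply]

theorem fourier_ext {a b : A} (h : ∀ c, Φ.fourier c a = Φ.fourier c b) : a = b :=
  sub_eq_zero.mp (Φ.eq_zero_of_forall_fourier fun c => by rw [map_sub, h, sub_self])

/-- Tested against a functional `φ( · y)`, the outer operator `R` becomes `L y`, which commutes with
`R d`. Associativity of convolution is a consequence. -/
theorem R_conv (c d a : A) : Φ.R (Φ.conv c d) a = Φ.R c (Φ.R d a) :=
  Φ.fourier_ext fun y => by
    rw [← fourier_L, fourier_conv, ← L_R_comm, fourier_L]

theorem L_conv (c d a : A) : Φ.L (Φ.conv c d) a = Φ.L d (Φ.L c a) :=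
  Φ.fourier_ext fun y => by
    rw [fourier_L, fourier_conv, ← fourier_L, L_R_comm, ← fourier_L]

/-- The formula for `W` gives `(ι ⊗ ε)W(c ⊗ d) = S⁻¹(d)c`. With the adjoint of `φ( · c)` in the
first place, this becomes the Plancherel identity. -/
theorem counit_conv (c d : A) : 𝒜.counit (Φ.conv c d) = Φ.fourier c (𝒜.antipode.symm d) := by
  rw [conv, apply_lslice, W_tmul]
  have h : ∀ t : A ⊗[ℂ] A, 𝒜.antipode (rslice 𝒜.counit
      (TensorProduct.map 𝒜.antipode.symm.toLinearMap LinearMap.id t)) =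
      rslice 𝒜.counit t := fun t => by
    induction t using TensorProduct.induction_on with
    | zero => simp
    | add x y hx hy => simp only [map_add, hx, hy]
    | tmul y z => simp
  rw [fourier_apply]
  congr 1
  apply 𝒜.antipode.injective
  rw [h, rslice_counit_T₂, antipode_mul, LinearEquiv.apply_symm_apply]

/-- The involution of `A` for which `φ( · c^♯)` is the adjoint of `φ( · c)`. -/
theorem exists_sharp (c : A) : ∃ d, ∀ a, Φ.fourier d a =
    (starRingEnd ℂ) (Φ.fourier c (star (𝒜.antipode a))) := by
  -- The conjugate of `φ(S(a)^*c)` is `φ(c^*S(a)) = ψ(aS⁻¹(c^*))`, and functionals `ψ( · f)` are of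
  -- the form `φ( · e)`.
  obtain ⟨e, he⟩ := Φ.exists_ψ_eq_φ (𝒜.antipode.symm (star c))
  refine ⟨e, fun a => ?_⟩
  have h := Φ.conj_symm c (𝒜.antipode a)
  rw [fourier_apply, fourier_apply, ← he, ψ_apply, antipode_mul, LinearEquiv.apply_symm_apply, h]

/-- The element `c^♯` for which `φ( · c^♯)` is the adjoint of `φ( · c)`. -/
def sharp (c : A) : A := (Φ.exists_sharp c).choose

theorem fourier_sharp (c a : A) : Φ.fourier (Φ.sharp c) a =
    (starRingEnd ℂ) (Φ.fourier c (star (𝒜.antipode a))) := (Φ.exists_sharp c).choose_spec a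

/-- The map `a ↦ S(a)^*` reverses the legs of the coproduct, by `T₁_antipode`, so it exchanges `R`
and `L`. Dually, the involution is anti-multiplicative. -/
theorem L_sharp (c a : A) :
    Φ.L (Φ.sharp c) (star (𝒜.antipode a)) = star (𝒜.antipode (Φ.R c a)) := by
  refine 𝒜.mul_left_cancel' fun b => ?_
  obtain ⟨b, rfl⟩ := (star_involutive (R := A)).surjective b
  obtain ⟨b, rfl⟩ := 𝒜.antipode.surjective b
  have h : ∀ t : A ⊗[ℂ] A, lslice (Φ.fourier (Φ.sharp c)) (star (𝒜.antipodeFlip t)) =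
      star (𝒜.antipode (rslice (Φ.fourier c) t)) := fun t => by
    induction t using TensorProduct.induction_on with
    | zero => simp
    | add x y hx hy => simp only [map_add, star_add, hx, hy]
    | tmul y z => simp [fourier_sharp, star_antipode_star_antipode]
  rw [← lslice_fourier_Y, Y_tmul, star_star, star_star, T₁_antipode, h, rslice_fourier_T₂,
    antipode_mul, star_mul]

theorem fourier_sharp_apply (c d : A) : Φ.fourier (Φ.sharp c) (𝒜.antipode.symm d) =
    Φ.φ (star c * d) := by
  rw [fourier_sharp, LinearEquiv.apply_symm_apply, fourier_apply, Φ.conj_symm]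

/-! #### The transposes of `V` and of `a ⊗ a' ↦ (1 ⊗ a')Δ(a)` -/

theorem exists_transpose_V : ∃ T : (A ⊗[ℂ] A) ≃ₗ[ℂ] (A ⊗[ℂ] A), ∀ s t,
    TensorProduct.dualDistrib ℂ A A (TensorProduct.map Φ.fourier Φ.fourier (T s)) t =
      TensorProduct.dualDistrib ℂ A A (TensorProduct.map Φ.fourier Φ.fourier s) (𝒜.V t) := by
  obtain ⟨ρ, hρ⟩ := Φ.exists_antipode_symm_equiv
  -- The transpose is `V` conjugated by `ρ ⊗ ι`: with first factor `ρ(z)`, strong left invariance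
  -- gives `φ(S⁻¹(S(R d a')z)a) = φ(S⁻¹(z)(R d a')a)`.
  refine ⟨(TensorProduct.congr ρ (LinearEquiv.refl ℂ A)).symm.trans
    (𝒜.V.trans (TensorProduct.congr ρ (LinearEquiv.refl ℂ A))), fun s t => ?_⟩
  obtain ⟨s, rfl⟩ := (TensorProduct.congr ρ (LinearEquiv.refl ℂ A)).surjective s
  rw [LinearEquiv.trans_apply, LinearEquiv.symm_apply_apply, LinearEquiv.trans_apply]
  induction s using TensorProduct.induction_on with
  | zero => simp
  | add x y hx hy => simp only [map_add, LinearMap.add_apply, hx, hy]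
  | tmul z d =>
    induction t using TensorProduct.induction_on with
    | zero => simp
    | add x y hx hy => simp only [map_add, hx, hy]
    | tmul a a' =>
      rw [TensorProduct.congr_tmul, TensorProduct.map_tmul, dualDistrib_eq, LinearEquiv.refl_apply,
        rslice_fourier_V, fourier_apply, hρ]
      have h : ∀ w : A ⊗[ℂ] A, TensorProduct.dualDistrib ℂ A A (TensorProduct.map Φ.fourier
          Φ.fourier (TensorProduct.congr ρ (LinearEquiv.refl ℂ A) w)) (a ⊗ₜ[ℂ] a') =
          Φ.φ (𝒜.antipode.symm (rslice Φ.φ ((oneTmul a').left w)) * a) := fun w => by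
        induction w using TensorProduct.induction_on with
        | zero => simp
        | add x y hx hy => simp only [map_add, LinearMap.add_apply, add_mul, hx, hy]
        | tmul u v => simp [fourier_apply, hρ, smul_mul_assoc, mul_comm]
      rw [h, ← Y_tmulOne_right, rslice_tmulOne_right, ← antipode_rslice_T₁, ← R_apply,
        antipode_symm_mul, LinearEquiv.symm_apply_apply, mul_assoc]

/-- In terms of the right integral, with `θ(z)` in the first factor, the transpose is `T₁⁻¹`: this
is `lslice_V_mul` for `ψ`. The counit clause will be left invariance of the dual integral, and holds
since `(ι ⊗ ε)T₁⁻¹(a ⊗ b) = ε(b)a`. -/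
theorem exists_transpose_Y : ∃ T : (A ⊗[ℂ] A) ≃ₗ[ℂ] (A ⊗[ℂ] A),
    (∀ c d, rslice 𝒜.counit (T (c ⊗ₜ[ℂ] d)) = 𝒜.counit d • c) ∧ ∀ s t, TensorProduct.dualDistrib ℂ A A (TensorProduct.map Φ.fourier Φ.fourier (T s)) t =
      TensorProduct.dualDistrib ℂ A A (TensorProduct.map Φ.fourier Φ.fourier s)
        (𝒜.Y (TensorProduct.comm ℂ A A t)) := by
  obtain ⟨θ, hθ⟩ := Φ.exists_ψ_equiv
  refine ⟨(TensorProduct.congr θ (LinearEquiv.refl ℂ A)).symm.trans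
    (𝒜.T₁.symm.trans (TensorProduct.congr θ (LinearEquiv.refl ℂ A))), fun c d => ?_,
    fun s t => ?_⟩
  · obtain ⟨c, rfl⟩ := θ.surjective c
    have h : ∀ w : A ⊗[ℂ] A, rslice 𝒜.counit (TensorProduct.congr θ (LinearEquiv.refl ℂ A) w) =
        θ (rslice 𝒜.counit w) := fun w => by
      induction w using TensorProduct.induction_on with
      | zero => simp
      | add x y hx hy => simp only [map_add, hx, hy]
      | tmul u v => simp
    rw [LinearEquiv.trans_apply, TensorProduct.congr_symm_tmul, LinearEquiv.symm_apply_apply,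
      LinearEquiv.trans_apply, h, LinearEquiv.refl_symm, LinearEquiv.refl_apply,
      rslice_counit_T₁_symm, map_smul]
  obtain ⟨s, rfl⟩ := (TensorProduct.congr θ (LinearEquiv.refl ℂ A)).surjective s
  rw [LinearEquiv.trans_apply, LinearEquiv.symm_apply_apply, LinearEquiv.trans_apply]
  induction s using TensorProduct.induction_on with
  | zero => simp
  | add x y hx hy => simp only [map_add, LinearMap.add_apply, hx, hy]
  | tmul z d =>
    induction t using TensorProduct.induction_on with
    | zero => simp
    | add x y hx hy => simp only [map_add, hx, hy]
    | tmul a a' =>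
      have hz : Φ.fourier (θ z) = Φ.ψ ∘ₗ LinearMap.mulRight ℂ z := LinearMap.ext fun a => hθ z a
      rw [TensorProduct.congr_tmul, TensorProduct.map_tmul, dualDistrib_eq, LinearEquiv.refl_apply,
        TensorProduct.comm_tmul, ← apply_lslice, hz, ← lslice_tmulOne_right, Y_tmulOne_right,
        lslice_oneTmul_left, fourier_apply, mul_assoc, Φ.isRightInvariant_ψ.lslice_V_mul]
      generalize 𝒜.T₁.symm (z ⊗ₜ[ℂ] d) = w
      induction w using TensorProduct.induction_on with
      | zero => simp
      | add x y hx hy => simp only [map_add, LinearMap.add_apply, mul_add, hx, hy]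
      | tmul u v => simp [fourier_apply, hθ, mul_smul_comm]

/-- The elements `R d a` span `A`, because `T₁` and the slice by `φ` are onto. The next two lemmas
use `V` and `W` in the same way. -/
theorem ext_R {M : Type*} [AddCommGroup M] [Module ℂ M] {f g : A →ₗ[ℂ] M}
    (h : ∀ d a, f (Φ.R d a) = g (Φ.R d a)) : f = g := by
  have : f ∘ₗ rslice Φ.φ ∘ₗ 𝒜.T₁.toLinearMap = g ∘ₗ rslice Φ.φ ∘ₗ 𝒜.T₁.toLinearMap :=
    TensorProduct.ext' fun a d => h d a
  ext a
  obtain ⟨t, rfl⟩ := rslice_surjective (X := A) Φ.ne_zero a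
  obtain ⟨t, rfl⟩ := 𝒜.T₁.surjective t
  exact LinearMap.congr_fun this t

theorem ext_L {M : Type*} [AddCommGroup M] [Module ℂ M] {f g : A →ₗ[ℂ] M}
    (h : ∀ d a, f (Φ.L d a) = g (Φ.L d a)) : f = g := by
  have : f ∘ₗ lslice Φ.φ ∘ₗ 𝒜.V.toLinearMap = g ∘ₗ lslice Φ.φ ∘ₗ 𝒜.V.toLinearMap :=
    TensorProduct.ext' fun d a => h d a
  ext a
  obtain ⟨t, rfl⟩ := lslice_surjective (Y := A) Φ.ne_zero a
  obtain ⟨t, rfl⟩ := 𝒜.V.surjective t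
  exact LinearMap.congr_fun this t

theorem ext_conv {M : Type*} [AddCommGroup M] [Module ℂ M] {f g : A →ₗ[ℂ] M}
    (h : ∀ c d, f (Φ.conv c d) = g (Φ.conv c d)) : f = g := by
  have : f ∘ₗ lslice Φ.φ ∘ₗ 𝒜.W.toLinearMap = g ∘ₗ lslice Φ.φ ∘ₗ 𝒜.W.toLinearMap :=
    TensorProduct.ext' fun c d => h c d
  ext a
  obtain ⟨t, rfl⟩ := lslice_surjective (Y := A) Φ.ne_zero a
  obtain ⟨t, rfl⟩ := 𝒜.W.surjective t
  exact LinearMap.congr_fun this t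

end PositiveLeftIntegral

end MultiplierHopfStarAlgebra

open MultiplierHopfStarAlgebra.PositiveLeftIntegral

/-! ### The regular representation on the Hilbert space tensor product -/

section Hilbert

variable {A : Type*} [NonUnitalRing A] [StarRing A] [Module ℂ A]
    [IsScalarTower ℂ A A] [SMulCommClass ℂ A A] [StarModule ℂ A]
    {𝒜 : MultiplierHopfStarAlgebra A}
  {B : Type*} [NonUnitalRing B] [StarRing B] [Module ℂ B]
    [IsScalarTower ℂ B B] [SMulCommClass ℂ B B] [StarModule ℂ B]
    {ℬ : MultiplierHopfStarAlgebra B}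
  (Φ : 𝒜.PositiveLeftIntegral) (Ψ : ℬ.PositiveLeftIntegral)

theorem denseRange_η : DenseRange Φ.η := by
  have : (Φ.η : A → Φ.GNS) = ((↑) : Φ.PreGNS → Φ.GNS) ∘ Φ.toPreGNS := rfl
  rw [this]
  exact UniformSpace.Completion.denseRange_coe.comp Φ.toPreGNS.surjective.denseRange
    (UniformSpace.Completion.continuous_coe _)

theorem tensorη_apply (t : A ⊗[ℂ] B) :
    tensorη Φ Ψ t = ((TensorProduct.map Φ.η Ψ.η t : Φ.GNS ⊗[ℂ] Ψ.GNS) :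
      HilbertTensor Φ.GNS Ψ.GNS) := rfl

theorem denseRange_tensorη : DenseRange (tensorη Φ Ψ) := by
  have h1 : DenseRange (TensorProduct.map Φ.η Ψ.η) := by
    -- The closure contains all elementary tensors, by approximating one leg at a time.
    let M := (LinearMap.range (TensorProduct.map Φ.η Ψ.η)).topologicalClosure
    have hl : ∀ (a : A) (ζ : Ψ.GNS), Φ.η a ⊗ₜ[ℂ] ζ ∈ M := fun a ζ => by
      refine (denseRange_η Ψ).induction_on ζ ?_ fun b => ?_
      · refine IsClosed.preimage (f := fun ζ : Ψ.GNS => Φ.η a ⊗ₜ[ℂ] ζ) ?_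
          (Submodule.isClosed_topologicalClosure _)
        exact (LinearMap.mkContinuous (TensorProduct.mk ℂ Φ.GNS Ψ.GNS (Φ.η a)) ‖Φ.η a‖
          fun ζ => by simp).continuous
      · exact Submodule.le_topologicalClosure _ ⟨a ⊗ₜ b, by simp⟩
    have hr : ∀ (ξ : Φ.GNS) (ζ : Ψ.GNS), ξ ⊗ₜ[ℂ] ζ ∈ M := fun ξ ζ => by
      refine (denseRange_η Φ).induction_on ξ ?_ fun b => hl b ζ
      refine IsClosed.preimage (f := fun ξ : Φ.GNS => ξ ⊗ₜ[ℂ] ζ) ?_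
          (Submodule.isClosed_topologicalClosure _)
      exact (LinearMap.mkContinuous ((TensorProduct.mk ℂ Φ.GNS Ψ.GNS).flip ζ) ‖ζ‖
          fun ζ => by simp [mul_comm]).continuous
    have hM : M = ⊤ := by
      rw [eq_top_iff, ← TensorProduct.span_tmul_eq_top, Submodule.span_le]
      rintro _ ⟨ξ, ζ, rfl⟩
      exact hr ξ ζ
    intro x
    have : x ∈ M := hM ▸ Submodule.mem_top
    exact this
  exact UniformSpace.Completion.denseRange_coe.comp h1
    (UniformSpace.Completion.continuous_coe _)

theorem inner_tensorη (s t : A ⊗[ℂ] A) :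
    inner ℂ (tensorη Φ Φ s) (tensorη Φ Φ t) = Φ.φ (rslice Φ.φ (star s * t)) := by
  rw [tensorη_apply, tensorη_apply, UniformSpace.Completion.inner_coe]
  induction s using TensorProduct.induction_on with
  | zero => simp
  | add x y hx hy => simp only [map_add, star_add, add_mul, inner_add_left, hx, hy]
  | tmul a b =>
    induction t using TensorProduct.induction_on with
    | zero => simp
    | add x y hx hy => simp only [map_add, mul_add, inner_add_right, hx, hy]
    | tmul c d => simp [inner_η, Algebra.TensorProduct.tmul_mul_tmul, mul_comm]

theorem star_V_mul_V (x x' y y' : A) : star (𝒜.V (x ⊗ₜ[ℂ] x')) * 𝒜.V (y ⊗ₜ[ℂ] y') =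
    (tmulOne y).right (𝒜.T₂ (star x ⊗ₜ[ℂ] (star x' * y'))) := by
  rw [V_apply, star_star, TensorProduct.star_tmul, ← Multiplier.incl_left]
  apply 𝒜.incl_inj
  rw [← Multiplier.mul_incl, ← Multiplier.incl_mul, V_spec, T₂_spec, T₂_spec, map_mul, mul_assoc,
    mul_assoc, mul_assoc]

/-- By `star_V_mul_V` the product under `φ ⊗ φ` is `(x^* ⊗ 1)Δ(x'^*y')(y ⊗ 1)`, to which left
invariance applies in the second leg. -/
theorem inner_tensorη_V (s t : A ⊗[ℂ] A) :
    inner ℂ (tensorη Φ Φ (𝒜.V s)) (tensorη Φ Φ (𝒜.V t)) =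
      inner ℂ (tensorη Φ Φ s) (tensorη Φ Φ t) := by
  rw [inner_tensorη, inner_tensorη]
  induction s using TensorProduct.induction_on with
  | zero => simp
  | add x y hx hy => simp only [map_add, star_add, add_mul, hx, hy]
  | tmul a b =>
    induction t using TensorProduct.induction_on with
    | zero => simp
    | add x y hx hy => simp only [map_add, mul_add, hx, hy]
    | tmul c d =>
      rw [star_V_mul_V, rslice_tmulOne_right, rslice_T₂]
      simp [Algebra.TensorProduct.tmul_mul_tmul, smul_mul_assoc]

theorem norm_tensorη_W (t : A ⊗[ℂ] A) : ‖tensorη Φ Φ (𝒜.W t)‖ = ‖tensorη Φ Φ t‖ := by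
  obtain ⟨t, rfl⟩ := 𝒜.V.surjective t
  rw [W, LinearEquiv.symm_apply_apply, @norm_eq_sqrt_re_inner ℂ, @norm_eq_sqrt_re_inner ℂ,
    inner_tensorη_V]

/-- The left regular representation, as a unitary on `ℋ ⊗ ℋ`. -/
def regularRep : HilbertTensor Φ.GNS Φ.GNS ≃ₗᵢ[ℂ] HilbertTensor Φ.GNS Φ.GNS :=
  𝒜.W.extendOfIsometry (tensorη Φ Φ) (tensorη Φ Φ) (denseRange_tensorη Φ Φ)
    (denseRange_tensorη Φ Φ) (norm_tensorη_W Φ)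

theorem extendsW_regularRep : ExtendsW Φ (regularRep Φ) := fun t =>
  LinearEquiv.extendOfIsometry_eq _ _ _ _ _ _ t

theorem regularRep_symm_tensorη (t : A ⊗[ℂ] A) :
    (regularRep Φ).symm (tensorη Φ Φ t) = tensorη Φ Φ (𝒜.V t) :=
  LinearEquiv.extendOfIsometry_symm_eq _ _ _ _ _ _ t

theorem adjoint_regularRep (ξ : HilbertTensor Φ.GNS Φ.GNS) : ContinuousLinearMap.adjoint
    (regularRep Φ : HilbertTensor Φ.GNS Φ.GNS →L[ℂ] HilbertTensor Φ.GNS Φ.GNS) ξ =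
      (regularRep Φ).symm ξ := by
  simp

theorem eq_of_tensorη {X : Type*} [TopologicalSpace X] [T2Space X]
    {f g : HilbertTensor Φ.GNS Ψ.GNS → X} (hf : Continuous f) (hg : Continuous g)
    (h : ∀ t, f (tensorη Φ Ψ t) = g (tensorη Φ Ψ t)) (ξ) : f ξ = g ξ :=
  congrFun ((denseRange_tensorη Φ Ψ).equalizer hf hg (funext h)) ξ

theorem completionCongr_coe {E F : Type*} [NormedAddCommGroup E] [InnerProductSpace ℂ E]
    [NormedAddCommGroup F] [InnerProductSpace ℂ F] (e : E ≃ₗᵢ[ℂ] F) (x : E) :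
    completionCongr e (x : UniformSpace.Completion E) = (e x : UniformSpace.Completion F) :=
  ContinuousLinearMap.completion_apply_coe _ _

theorem flip_tensorη (t : A ⊗[ℂ] B) : HilbertTensor.flip Φ.GNS Ψ.GNS (tensorη Φ Ψ t) =
    tensorη Ψ Φ (TensorProduct.comm ℂ A B t) := by
  rw [tensorη_apply, tensorη_apply, HilbertTensor.flip, completionCongr_coe]
  congr 1
  induction t using TensorProduct.induction_on with
  | zero => simp
  | add x y hx hy => simp only [map_add, hx, hy]
  | tmul c d => simp

variable {A' : Type*} [NonUnitalRing A'] [StarRing A'] [Module ℂ A']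
    [IsScalarTower ℂ A' A'] [SMulCommClass ℂ A' A'] [StarModule ℂ A']
    {𝒜' : MultiplierHopfStarAlgebra A'}
  {B' : Type*} [NonUnitalRing B'] [StarRing B'] [Module ℂ B']
    [IsScalarTower ℂ B' B'] [SMulCommClass ℂ B' B'] [StarModule ℂ B']
    {ℬ' : MultiplierHopfStarAlgebra B'}
  (Φ' : 𝒜'.PositiveLeftIntegral) (Ψ' : ℬ'.PositiveLeftIntegral)

theorem congr_tensorη {f : Φ.GNS ≃ₗᵢ[ℂ] Φ'.GNS} {g : Ψ.GNS ≃ₗᵢ[ℂ] Ψ'.GNS} {u : A →ₗ[ℂ] A'}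
    {v : B →ₗ[ℂ] B'} (hu : ∀ a, f (Φ.η a) = Φ'.η (u a)) (hv : ∀ a, g (Ψ.η a) = Ψ'.η (v a))
    (t : A ⊗[ℂ] B) : HilbertTensor.congr f g (tensorη Φ Ψ t) =
      tensorη Φ' Ψ' (TensorProduct.map u v t) := by
  rw [tensorη_apply, tensorη_apply, HilbertTensor.congr, completionCongr_coe]
  congr 1
  induction t using TensorProduct.induction_on with
  | zero => simp
  | add x y hx hy => simp only [map_add, hx, hy]
  | tmul c d => simp [hu, hv]

end Hilbert

/-- Identities in `B ⊗ B` are thereby reduced to values on pure tensors of `A ⊗ A`; a separating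
family on each factor suffices. -/
theorem tensor_ext_of_separating {X Y I J : Type*} [AddCommGroup X] [Module ℂ X] [AddCommGroup Y]
    [Module ℂ Y] {f : I → Module.Dual ℂ X} {g : J → Module.Dual ℂ Y}
    (hf : ∀ x, (∀ i, f i x = 0) → x = 0) (hg : ∀ y, (∀ j, g j y = 0) → y = 0) {s t : X ⊗[ℂ] Y}
    (h : ∀ i j, f i (rslice (g j) s) = f i (rslice (g j) t)) : s = t := by
  refine lslice_ext fun k => sub_eq_zero.mp (hg _ fun j => ?_)
  have h1 : rslice (g j) s = rslice (g j) t :=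
    sub_eq_zero.mp (hf _ fun i => by rw [map_sub, h, sub_self])
  rw [map_sub, apply_lslice, apply_lslice, h1, sub_self]

/-- Induction on `B ⊗ B` along `j`. -/
theorem tensor_induction {A B : Type*} [AddCommGroup A] [Module ℂ A] [AddCommGroup B] [Module ℂ B]
    (j : A ≃ₗ[ℂ] B) {motive : B ⊗[ℂ] B → Prop} (t : B ⊗[ℂ] B) (zero : motive 0)
    (add : ∀ x y, motive x → motive y → motive (x + y))
    (tmul : ∀ x y : A, motive (j x ⊗ₜ[ℂ] j y)) : motive t := by
  induction t using TensorProduct.induction_on with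
  | zero => exact zero
  | add x y hx hy => exact add x y hx hy
  | tmul x y =>
    obtain ⟨x, rfl⟩ := j.surjective x
    obtain ⟨y, rfl⟩ := j.surjective y
    exact tmul x y

/-! ### The pairing between `A ⊗ A` and `B ⊗ B` -/

section Pairing

variable {A : Type*} [NonUnitalRing A] [StarRing A] [Module ℂ A]
    [IsScalarTower ℂ A A] [SMulCommClass ℂ A A] [StarModule ℂ A]
    {𝒜 : MultiplierHopfStarAlgebra A} (Φ : 𝒜.PositiveLeftIntegral)
  {B : Type*} [AddCommGroup B] [Module ℂ B] (j : A ≃ₗ[ℂ] B)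

/-- The pairing of `A` with `B` when `c ↦ j(c)` represents the functional `φ( · c)`. -/
def pairing : B →ₗ[ℂ] Module.Dual ℂ A := Φ.fourier ∘ₗ j.symm.toLinearMap

@[simp] theorem pairing_apply (c : A) : pairing Φ j (j c) = Φ.fourier c := by
  simp [pairing]

/-- The pairing of `A ⊗ A` with `B ⊗ B`. -/
def pairing₂ : B ⊗[ℂ] B →ₗ[ℂ] Module.Dual ℂ (A ⊗[ℂ] A) :=
  TensorProduct.dualDistrib ℂ A A ∘ₗ TensorProduct.map (pairing Φ j) (pairing Φ j)

theorem pairing₂_tmul (b c : A) (t : A ⊗[ℂ] A) : pairing₂ Φ j (j b ⊗ₜ[ℂ] j c) t =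
    TensorProduct.dualDistrib ℂ A A (Φ.fourier b ⊗ₜ[ℂ] Φ.fourier c) t := by
  simp [pairing₂]

theorem pairing₂_tmul_tmul (b c a a' : A) :
    pairing₂ Φ j (j b ⊗ₜ[ℂ] j c) (a ⊗ₜ[ℂ] a') = Φ.fourier b a * Φ.fourier c a' := by
  simp [pairing₂]

theorem pairing₂_apply_tmul (s : B ⊗[ℂ] B) (a a' : A) : pairing₂ Φ j s (a ⊗ₜ[ℂ] a') =
    (pairing Φ j).flip a (rslice ((pairing Φ j).flip a') s) := by
  induction s using TensorProduct.induction_on with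
  | zero => simp
  | add x y hx hy => simp only [map_add, LinearMap.add_apply, hx, hy]
  | tmul b c => simp [pairing₂, mul_comm]

theorem pairing_separating (b : B) (h : ∀ a, (pairing Φ j).flip a b = 0) : b = 0 := by
  obtain ⟨b, rfl⟩ := j.surjective b
  have : Φ.fourier b = 0 := LinearMap.ext fun a => by simpa using h a
  rw [Φ.fourier_injective (this.trans (map_zero Φ.fourier).symm), map_zero]

theorem pairing₂_ext {s t : B ⊗[ℂ] B} (h : ∀ a a' : A,
    pairing₂ Φ j s (a ⊗ₜ[ℂ] a') = pairing₂ Φ j t (a ⊗ₜ[ℂ] a')) : s = t :=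
  tensor_ext_of_separating (pairing_separating Φ j) (pairing_separating Φ j) fun a a' => by
    rw [← pairing₂_apply_tmul, h, pairing₂_apply_tmul]

theorem pairing₂_V (b c a a' : A) : pairing₂ Φ j (j b ⊗ₜ[ℂ] j c) (𝒜.V (a ⊗ₜ[ℂ] a')) =
    Φ.fourier b (Φ.R c a' * a) := by
  rw [pairing₂_tmul, dualDistrib_eq, rslice_fourier_V]

theorem pairing₂_Y (b c a a' : A) : pairing₂ Φ j (j b ⊗ₜ[ℂ] j c) (𝒜.Y (a' ⊗ₜ[ℂ] a)) =
    Φ.fourier c (a' * Φ.L b a) := by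
  rw [pairing₂_tmul, dualDistrib_eq, ← apply_lslice, lslice_fourier_Y]

end Pairing

/-! ### Multiplication in the dual as the transpose of `R` and `L` -/

section Convolution

variable {A : Type*} [NonUnitalRing A] [StarRing A] [Module ℂ A]
    [IsScalarTower ℂ A A] [SMulCommClass ℂ A A] [StarModule ℂ A]
    {𝒜 : MultiplierHopfStarAlgebra A} (Φ : 𝒜.PositiveLeftIntegral)
  {B : Type*} [NonUnitalRing B] [Module ℂ B] [IsScalarTower ℂ B B] [SMulCommClass ℂ B B]
    (j : A ≃ₗ[ℂ] B)

theorem pairing₂_mul_tmul (hj : ∀ c d, j c * j d = j (Φ.conv c d)) (s : B ⊗[ℂ] B) (x y a a' : A) :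
    pairing₂ Φ j (s * (j x ⊗ₜ[ℂ] j y)) (a ⊗ₜ[ℂ] a') =
      pairing₂ Φ j s (Φ.R x a ⊗ₜ[ℂ] Φ.R y a') := by
  induction s using tensor_induction j with
  | zero => simp
  | add x y hx hy => simp only [map_add, add_mul, LinearMap.add_apply, hx, hy]
  | tmul b c =>
    rw [Algebra.TensorProduct.tmul_mul_tmul, hj, hj, pairing₂_tmul_tmul, pairing₂_tmul_tmul,
      fourier_conv, fourier_conv]

theorem pairing₂_tmul_mul (hj : ∀ c d, j c * j d = j (Φ.conv c d)) (s : B ⊗[ℂ] B) (x y a a' : A) :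
    pairing₂ Φ j ((j x ⊗ₜ[ℂ] j y) * s) (a ⊗ₜ[ℂ] a') =
      pairing₂ Φ j s (Φ.L x a ⊗ₜ[ℂ] Φ.L y a') := by
  induction s using tensor_induction j with
  | zero => simp
  | add x y hx hy => simp only [map_add, mul_add, LinearMap.add_apply, hx, hy]
  | tmul b c =>
    rw [Algebra.TensorProduct.tmul_mul_tmul, hj, hj, pairing₂_tmul_tmul, pairing₂_tmul_tmul,
      fourier_conv, fourier_conv, fourier_L, fourier_L]

theorem pairing₂_tmulOne_right (hj : ∀ c d, j c * j d = j (Φ.conv c d)) (s : B ⊗[ℂ] B)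
    (x a a' : A) : pairing₂ Φ j ((tmulOne (j x)).right s) (a ⊗ₜ[ℂ] a') =
      pairing₂ Φ j s (Φ.R x a ⊗ₜ[ℂ] a') := by
  induction s using tensor_induction j with
  | zero => simp
  | add x y hx hy => simp only [map_add, LinearMap.add_apply, hx, hy]
  | tmul b c => rw [tmulOne_right, hj, pairing₂_tmul_tmul, pairing₂_tmul_tmul, fourier_conv]

theorem pairing₂_tmulOne_left (hj : ∀ c d, j c * j d = j (Φ.conv c d)) (s : B ⊗[ℂ] B)
    (x a a' : A) : pairing₂ Φ j ((tmulOne (j x)).left s) (a ⊗ₜ[ℂ] a') =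
      pairing₂ Φ j s (Φ.L x a ⊗ₜ[ℂ] a') := by
  induction s using tensor_induction j with
  | zero => simp
  | add x y hx hy => simp only [map_add, LinearMap.add_apply, hx, hy]
  | tmul b c =>
    rw [tmulOne_left, hj, pairing₂_tmul_tmul, pairing₂_tmul_tmul, fourier_conv, fourier_L]

theorem pairing₂_oneTmul_left (hj : ∀ c d, j c * j d = j (Φ.conv c d)) (s : B ⊗[ℂ] B)
    (x a a' : A) : pairing₂ Φ j ((oneTmul (j x)).left s) (a ⊗ₜ[ℂ] a') =
      pairing₂ Φ j s (a ⊗ₜ[ℂ] Φ.L x a') := by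
  induction s using tensor_induction j with
  | zero => simp
  | add x y hx hy => simp only [map_add, LinearMap.add_apply, hx, hy]
  | tmul b c =>
    rw [oneTmul_left, hj, pairing₂_tmul_tmul, pairing₂_tmul_tmul, fourier_conv, fourier_L]

theorem pairing₂_cancel (hj : ∀ c d, j c * j d = j (Φ.conv c d)) {s t : B ⊗[ℂ] B}
    (h : ∀ x y, s * (j x ⊗ₜ[ℂ] j y) = t * (j x ⊗ₜ[ℂ] j y)) : s = t := by
  have h1 : (TensorProduct.mk ℂ A A).compr₂ (pairing₂ Φ j s) =
      ((TensorProduct.mk ℂ A A).compr₂ (pairing₂ Φ j t)) :=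
    Φ.ext_R fun x a => Φ.ext_R fun y a' => by
      simpa [pairing₂_mul_tmul Φ j hj] using
        LinearMap.congr_fun (congrArg (pairing₂ Φ j) (h x y)) (a ⊗ₜ[ℂ] a')
  exact pairing₂_ext Φ j fun a a' => LinearMap.congr_fun₂ h1 a a'

/-- The right action is recovered from the left one through `x(my) = (xm)y` and cancellation, so
only left actions need comparing. -/
theorem multiplier_ext_of_pairing (hj : ∀ c d, j c * j d = j (Φ.conv c d))
    {m n : Multiplier (B ⊗[ℂ] B)} (h : ∀ x y, m.left (j x ⊗ₜ[ℂ] j y) = n.left (j x ⊗ₜ[ℂ] j y)) :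
    m = n := by
  have h1 : ∀ t, m.left t = n.left t := fun t => by
    induction t using tensor_induction j with
    | zero => simp
    | add x y hx hy => simp only [map_add, hx, hy]
    | tmul x y => exact h x y
  refine Multiplier.ext' h1 fun t => pairing₂_cancel Φ j hj fun x y => ?_
  rw [← Multiplier.mul_left_eq, ← Multiplier.mul_left_eq, h1]

end Convolution

/-! ### Construction of the dual -/

/-- A `*`-algebra `B` with a linear bijection `j : A → B` for which the product and involution of
`B` are those of the functionals `φ( · c)`, with the transposes of `V` and `Y`. -/
structure DualData {A : Type*} [NonUnitalRing A] [StarRing A] [Module ℂ A]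
    [IsScalarTower ℂ A A] [SMulCommClass ℂ A A] [StarModule ℂ A]
    {𝒜 : MultiplierHopfStarAlgebra A} (Φ : 𝒜.PositiveLeftIntegral)
    (B : Type*) [NonUnitalRing B] [StarRing B] [Module ℂ B]
    [IsScalarTower ℂ B B] [SMulCommClass ℂ B B] [StarModule ℂ B] where
  /-- The map `c ↦ φ( · c)`. -/
  j : A ≃ₗ[ℂ] B
  mul : ∀ c d, j c * j d = j (Φ.conv c d)
  star : ∀ c, star (j c) = j (Φ.sharp c)
  /-- The transpose of `V`. -/
  T₁ : (B ⊗[ℂ] B) ≃ₗ[ℂ] (B ⊗[ℂ] B)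
  pairing_T₁ : ∀ s t, pairing₂ Φ j (T₁ s) t = pairing₂ Φ j s (𝒜.V t)
  /-- The transpose of `a ⊗ a' ↦ (1 ⊗ a')Δ(a)`. -/
  T₂ : (B ⊗[ℂ] B) ≃ₗ[ℂ] (B ⊗[ℂ] B)
  pairing_T₂ : ∀ s a a', pairing₂ Φ j (T₂ s) (a ⊗ₜ a') = pairing₂ Φ j s (𝒜.Y (a' ⊗ₜ a))
  counit_T₂ : ∀ c d, rslice (𝒜.counit ∘ₗ j.symm.toLinearMap) (T₂ (j c ⊗ₜ[ℂ] j d)) =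
    𝒜.counit d • j c

namespace DualData

variable {A : Type*} [NonUnitalRing A] [StarRing A] [Module ℂ A]
    [IsScalarTower ℂ A A] [SMulCommClass ℂ A A] [StarModule ℂ A]
    {𝒜 : MultiplierHopfStarAlgebra A} {Φ : 𝒜.PositiveLeftIntegral}
  {B : Type*} [NonUnitalRing B] [StarRing B] [Module ℂ B] [IsScalarTower ℂ B B]
    [SMulCommClass ℂ B B] [StarModule ℂ B] (D : DualData Φ B)

/-- Left multiplication by `Δ(b)`. -/
def ΔLeft (b : B) : B ⊗[ℂ] B →ₗ[ℂ] B ⊗[ℂ] B :=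
  TensorProduct.lift (LinearMap.mk₂ ℂ (fun x y => (tmulOne x).right (D.T₁ (b ⊗ₜ[ℂ] y)))
    (fun x y z => by
      generalize D.T₁ (b ⊗ₜ[ℂ] z) = t
      induction t using TensorProduct.induction_on with
      | zero => simp
      | add u v hu hv => simp only [map_add, hu, hv]; abel
      | tmul u v => simp [mul_add, TensorProduct.add_tmul])
    (fun c x z => by
      generalize D.T₁ (b ⊗ₜ[ℂ] z) = t
      induction t using TensorProduct.induction_on with
      | zero => simp
      | add u v hu hv => simp only [map_add, hu, hv, smul_add]
      | tmul u v => simp [mul_smul_comm, TensorProduct.smul_tmul'])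
    (fun x y z => by simp [TensorProduct.tmul_add])
    (fun c x y => by simp))

/-- Right multiplication by `Δ(b)`. -/
def ΔRight (b : B) : B ⊗[ℂ] B →ₗ[ℂ] B ⊗[ℂ] B :=
  TensorProduct.lift (LinearMap.mk₂ ℂ (fun x y => (oneTmul y).left (D.T₂ (x ⊗ₜ[ℂ] b)))
    (fun x y z => by simp [TensorProduct.add_tmul])
    (fun c x y => by simp [← TensorProduct.smul_tmul'])
    (fun x y z => by
      generalize D.T₂ (x ⊗ₜ[ℂ] b) = t
      induction t using TensorProduct.induction_on with
      | zero => simp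
      | add u v hu hv => simp only [map_add, hu, hv]; abel
      | tmul u v => simp [add_mul, TensorProduct.tmul_add])
    (fun c z x => by
      generalize D.T₂ (z ⊗ₜ[ℂ] b) = t
      induction t using TensorProduct.induction_on with
      | zero => simp
      | add u v hu hv => simp only [map_add, hu, hv, smul_add]
      | tmul u v => simp [smul_mul_assoc]))

theorem ΔLeft_tmul (b x y : B) :
    D.ΔLeft b (x ⊗ₜ[ℂ] y) = (tmulOne x).right (D.T₁ (b ⊗ₜ[ℂ] y)) := by simp [ΔLeft]

theorem ΔRight_tmul (b x y : B) :
    D.ΔRight b (x ⊗ₜ[ℂ] y) = (oneTmul y).left (D.T₂ (x ⊗ₜ[ℂ] b)) := by simp [ΔRight]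

/-- The working form of the dual coproduct: the legs `a`, `a'` are multiplied in opposite order, and
the covers `x`, `y` act by `R`. Covers on the other side act by `L`. -/
theorem pairing_ΔLeft (b x y a a' : A) : pairing₂ Φ D.j (D.ΔLeft (D.j b) (D.j x ⊗ₜ[ℂ] D.j y))
    (a ⊗ₜ[ℂ] a') = Φ.fourier b (Φ.R y a' * Φ.R x a) := by
  rw [ΔLeft_tmul, pairing₂_tmulOne_right Φ D.j D.mul, D.pairing_T₁, pairing₂_V]

theorem pairing_ΔRight (b x y a a' : A) : pairing₂ Φ D.j (D.ΔRight (D.j b) (D.j x ⊗ₜ[ℂ] D.j y))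
    (a ⊗ₜ[ℂ] a') = Φ.fourier b (Φ.L y a' * Φ.L x a) := by
  rw [ΔRight_tmul, pairing₂_oneTmul_left Φ D.j D.mul, D.pairing_T₂, pairing₂_Y]

/-- The coproduct of the dual. -/
def Δ (b : B) : Multiplier (B ⊗[ℂ] B) :=
  ⟨(D.ΔLeft b, MulOpposite.op (D.ΔRight b)), by
    obtain ⟨b, rfl⟩ := D.j.surjective b
    refine ⟨fun s t => ?_, fun s t => ?_, fun s t => ?_⟩
    all_goals
      simp only [MulOpposite.unop_op]
      induction s using tensor_induction D.j with
      | zero => simp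
      | add x y hx hy => simp only [map_add, add_mul, hx, hy]
      | tmul x y =>
        induction t using tensor_induction D.j with
        | zero => simp
        | add x y hx hy => simp only [map_add, mul_add, hx, hy]
        | tmul z w =>
          refine pairing₂_ext Φ D.j fun a a' => ?_
          -- The multiplier identities reduce to `R` and `L` commuting and to their values on
          -- convolutions.
          simp only [pairing₂_mul_tmul Φ D.j D.mul, pairing₂_tmul_mul Φ D.j D.mul,
            pairing_ΔLeft, pairing_ΔRight, L_R_comm, Algebra.TensorProduct.tmul_mul_tmul, D.mul,
            R_conv, L_conv]⟩

theorem Δ_left (b : B) (t : B ⊗[ℂ] B) : (D.Δ b).left t = D.ΔLeft b t := rfl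

theorem Δ_right (b : B) (t : B ⊗[ℂ] B) : (D.Δ b).right t = D.ΔRight b t := rfl

theorem ext {m n : Multiplier (B ⊗[ℂ] B)} (h : ∀ x y a a',
    pairing₂ Φ D.j (m.left (D.j x ⊗ₜ[ℂ] D.j y)) (a ⊗ₜ[ℂ] a') =
      pairing₂ Φ D.j (n.left (D.j x ⊗ₜ[ℂ] D.j y)) (a ⊗ₜ[ℂ] a')) : m = n :=
  multiplier_ext_of_pairing Φ D.j D.mul fun x y => pairing₂_ext Φ D.j fun a a' => h x y a a'

theorem incl_T₁ (b c : B) : Multiplier.incl (D.T₁ (b ⊗ₜ[ℂ] c)) = D.Δ b * oneTmul c := by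
  obtain ⟨b, rfl⟩ := D.j.surjective b
  obtain ⟨c, rfl⟩ := D.j.surjective c
  refine D.ext fun x y a a' => ?_
  rw [Multiplier.incl_left, pairing₂_mul_tmul Φ D.j D.mul, D.pairing_T₁, pairing₂_V,
    Multiplier.mul_left, oneTmul_left, D.mul, Δ_left, pairing_ΔLeft, R_conv]

theorem incl_T₂ (b c : B) : Multiplier.incl (D.T₂ (c ⊗ₜ[ℂ] b)) = tmulOne c * D.Δ b := by
  obtain ⟨b, rfl⟩ := D.j.surjective b
  obtain ⟨c, rfl⟩ := D.j.surjective c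
  refine D.ext fun x y a a' => ?_
  rw [Multiplier.incl_left, pairing₂_mul_tmul Φ D.j D.mul, D.pairing_T₂, pairing₂_Y,
    Multiplier.mul_left, Δ_left, pairing₂_tmulOne_left Φ D.j D.mul, pairing_ΔLeft, L_R_comm]

theorem pairing_star (s : B ⊗[ℂ] B) (a a' : A) : pairing₂ Φ D.j (Star.star s) (a ⊗ₜ[ℂ] a') =
    (starRingEnd ℂ) (pairing₂ Φ D.j s
      (Star.star (𝒜.antipode a) ⊗ₜ[ℂ] Star.star (𝒜.antipode a'))) := by
  induction s using tensor_induction D.j with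
  | zero => simp
  | add x y hx hy => simp only [map_add, star_add, LinearMap.add_apply, hx, hy]
  | tmul x y =>
    rw [TensorProduct.star_tmul, D.star, D.star, pairing₂_tmul_tmul, pairing₂_tmul_tmul,
      fourier_sharp, fourier_sharp, map_mul]

theorem Δ_star (b : B) : D.Δ (Star.star b) = Star.star (D.Δ b) := by
  obtain ⟨b, rfl⟩ := D.j.surjective b
  refine D.ext fun x y a a' => ?_
  rw [Multiplier.star_left, pairing_star, D.star, Δ_left, pairing_ΔLeft, Δ_right,
    TensorProduct.star_tmul, D.star, D.star, pairing_ΔRight, L_sharp, L_sharp, fourier_sharp,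
    antipode_mul, star_mul]

/-- This is multiplicativity of the dual coproduct before pairing with a second functional.
Expanding the right side with `R_mul` leaves the tensor identity `h1`, to which `d ⊗ e ↦ (R d a')e`
is applied. -/
theorem sum_R_mul_R {n : ℕ} (z w : Fin n → A) (c x y a a' : A)
    (h : D.ΔLeft (D.j c) (D.j x ⊗ₜ[ℂ] D.j y) = ∑ i, D.j (z i) ⊗ₜ[ℂ] D.j (w i)) :
    ∑ i, Φ.R (w i) a' * Φ.R (z i) a = Φ.R c (Φ.R y a' * Φ.R x a) := by
  obtain ⟨m, r, s, hrs⟩ := exists_sum_tmul (𝒜.T₁ (Φ.R x a ⊗ₜ[ℂ] c))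
  rw [Φ.R_mul r s c _ _ hrs]
  have h1 : ∑ i, w i ⊗ₜ[ℂ] Φ.R (z i) a = ∑ k, Φ.conv (s k) y ⊗ₜ[ℂ] r k := by
    refine tensor_ext_of_separating (f := Φ.fourier.flip) (g := Φ.fourier)
      (fun u hu => ?_) (fun u hu => Φ.eq_zero_of_forall_fourier hu) fun b f => ?_
    · exact Φ.eq_zero_of_apply_mul_eq_zero hu
    -- Inserting `L f a` makes `L f (R x a) * c` appear, which is the slice of `T₁(R x a ⊗ c)` by
    -- `φ( · f)`.
    · have h2 := LinearMap.congr_fun (congrArg (pairing₂ Φ D.j) h) (Φ.L f a ⊗ₜ[ℂ] b)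
      have h3 := congrArg (fun t => Φ.φ (Φ.R y b * lslice (Φ.fourier f) t)) hrs
      rw [pairing_ΔLeft, ← L_R_comm, Φ.fourier_apply, mul_assoc] at h2
      simp only [lslice_fourier_T₁] at h3
      rw [h3] at h2
      simp only [map_sum, LinearMap.sum_apply, pairing₂_tmul_tmul, lslice_tmul, Finset.mul_sum,
        mul_smul_comm, map_smul, smul_eq_mul, fourier_L] at h2
      simp only [map_sum, rslice_tmul, map_smul, LinearMap.flip_apply, smul_eq_mul, fourier_conv]
      exact h2.symm
  let G : A ⊗[ℂ] A →ₗ[ℂ] A := TensorProduct.lift (LinearMap.mk₂ ℂ (fun d e => Φ.R d a' * e)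
    (fun x y z => by simp [Φ.R_apply, TensorProduct.tmul_add, add_mul])
    (fun c x y => by simp [Φ.R_apply, smul_mul_assoc])
    (fun x y z => by simp [mul_add]) (fun c x y => by simp [mul_smul_comm]))
  have hG : ∀ d e, G (d ⊗ₜ[ℂ] e) = Φ.R d a' * e := fun _ _ => rfl
  simpa only [map_sum, hG, R_conv] using congrArg G h1

theorem Δ_mul (b c : B) : D.Δ (b * c) = D.Δ b * D.Δ c := by
  obtain ⟨b, rfl⟩ := D.j.surjective b
  obtain ⟨c, rfl⟩ := D.j.surjective c
  refine D.ext fun x y a a' => ?_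
  obtain ⟨n, z, w, h⟩ := exists_sum_tmul (D.ΔLeft (D.j c) (D.j x ⊗ₜ[ℂ] D.j y))
  have h' : D.ΔLeft (D.j c) (D.j x ⊗ₜ[ℂ] D.j y) =
      ∑ i, D.j (D.j.symm (z i)) ⊗ₜ[ℂ] D.j (D.j.symm (w i)) := by simpa using h
  rw [D.mul, Δ_left, pairing_ΔLeft, Multiplier.mul_left, Δ_left, Δ_left, h', map_sum, map_sum,
    LinearMap.sum_apply]
  simp only [pairing_ΔLeft]
  rw [← map_sum, D.sum_R_mul_R _ _ c x y a a' h', fourier_conv]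

theorem Δ_add (b c : B) : D.Δ (b + c) = D.Δ b + D.Δ c :=
  D.ext fun x y a a' => by
    rw [Multiplier.add_left, Δ_left, Δ_left, Δ_left, ΔLeft_tmul, ΔLeft_tmul, ΔLeft_tmul,
      TensorProduct.add_tmul, map_add, map_add]

theorem Δ_smul (c : ℂ) (b : B) : D.Δ (c • b) = c • D.Δ b :=
  D.ext fun x y a a' => by
    rw [Multiplier.smul_left, Δ_left, Δ_left, ΔLeft_tmul, ΔLeft_tmul,
      ← TensorProduct.smul_tmul', map_smul, map_smul]

/-- The coproduct of the dual as a `*`-homomorphism. -/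
def ΔHom : B →⋆ₙₐ[ℂ] Multiplier (B ⊗[ℂ] B) where
  toFun := D.Δ
  map_smul' := D.Δ_smul
  map_zero' := by simpa using D.Δ_smul 0 0
  map_add' := D.Δ_add
  map_mul' := D.Δ_mul
  map_star' := D.Δ_star

theorem eq_zero_of_mul_right (D : DualData Φ B) (b : B) (h : ∀ c, b * c = 0) : b = 0 := by
  obtain ⟨b, rfl⟩ := D.j.surjective b
  have : Φ.fourier b = 0 := Φ.ext_R fun d a => by
    have h1 := h (D.j d)
    rw [D.mul, D.j.map_eq_zero_iff] at h1
    rw [← fourier_conv, h1, map_zero]; rfl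
  rw [Φ.fourier_injective (this.trans (map_zero Φ.fourier).symm), map_zero]

theorem eq_zero_of_mul_left (D : DualData Φ B) (b : B) (h : ∀ c, c * b = 0) : b = 0 := by
  obtain ⟨b, rfl⟩ := D.j.surjective b
  have : Φ.fourier b = 0 := Φ.ext_L fun d a => by
    have h1 := h (D.j d)
    rw [D.mul, D.j.map_eq_zero_iff] at h1
    rw [fourier_L, ← fourier_conv, h1, map_zero]; rfl
  rw [Φ.fourier_injective (this.trans (map_zero Φ.fourier).symm), map_zero]

/-- `T₁` is onto, so the span contains every `ex ⊗ d`, and products `ex` span the dual because `W`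
is onto. -/
theorem Δ_nondegenerate :
    Submodule.span ℂ {z : B ⊗[ℂ] B | ∃ a w, z = (D.ΔHom a).left w} = ⊤ := by
  set M := Submodule.span ℂ {z : B ⊗[ℂ] B | ∃ a w, z = (D.ΔHom a).left w} with hM
  have h1 : ∀ (x : B) (t : B ⊗[ℂ] B), (tmulOne x).right (D.T₁ t) ∈ M := fun x t => by
    induction t using TensorProduct.induction_on with
    | zero => simp
    | add u v hu hv => simpa only [map_add] using M.add_mem hu hv
    | tmul b y => exact Submodule.subset_span ⟨b, x ⊗ₜ y, (D.ΔLeft_tmul b x y).symm⟩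
  have h2 : ∀ d, M.mkQ ∘ₗ (TensorProduct.mk ℂ B B).flip d ∘ₗ D.j.toLinearMap = 0 := fun d =>
    Φ.ext_conv fun e x => by
      have := h1 (D.j x) (D.T₁.symm (D.j e ⊗ₜ d))
      rw [LinearEquiv.apply_symm_apply, tmulOne_right, D.mul] at this
      simpa using this
  rw [eq_top_iff, ← TensorProduct.span_tmul_eq_top, Submodule.span_le]
  rintro _ ⟨c, d, rfl⟩
  obtain ⟨c, rfl⟩ := D.j.surjective c
  simpa using LinearMap.congr_fun (h2 d) c

theorem pairing₂_slice (s : B ⊗[ℂ] B) (a a' : A) : pairing₂ Φ D.j s (a ⊗ₜ[ℂ] a') =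
    pairing Φ D.j (lslice ((pairing Φ D.j).flip a) s) a' := by
  rw [pairing₂_apply_tmul, ← apply_lslice, LinearMap.flip_apply]

/-- The action `ψ ↦ ψ( · w)` of `A` on functionals. -/
def act (w : A) : B →ₗ[ℂ] B :=
  D.j.toLinearMap ∘ₗ LinearMap.mulLeft ℂ w ∘ₗ D.j.symm.toLinearMap

theorem act_j (w c : A) : D.act w (D.j c) = D.j (w * c) := by simp [act]

/-- Evaluating the first leg of `T₂` at a point of `A` leaves the action of an element of `A` on
`b`. -/
theorem lslice_T₂ (x u : A) (b : B) : lslice ((pairing Φ D.j).flip x) (D.T₂ (D.j u ⊗ₜ[ℂ] b)) =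
    D.act (Φ.L u x) b := by
  obtain ⟨b, rfl⟩ := D.j.surjective b
  refine sub_eq_zero.mp (pairing_separating Φ D.j _ fun a => ?_)
  rw [LinearMap.flip_apply, map_sub, LinearMap.sub_apply, ← pairing₂_slice, D.pairing_T₂,
    pairing₂_Y, act_j, pairing_apply, Φ.fourier_apply, Φ.fourier_apply, mul_assoc, sub_self]

theorem T₁_act (w : A) (b c : B) : D.T₁ (D.act w b ⊗ₜ[ℂ] c) =
    TensorProduct.map (D.act w) LinearMap.id (D.T₁ (b ⊗ₜ[ℂ] c)) := by
  obtain ⟨b, rfl⟩ := D.j.surjective b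
  obtain ⟨c, rfl⟩ := D.j.surjective c
  refine pairing₂_ext Φ D.j fun a a' => ?_
  have h : ∀ t, pairing₂ Φ D.j (TensorProduct.map (D.act w) LinearMap.id t) (a ⊗ₜ[ℂ] a') =
      pairing₂ Φ D.j t ((a * w) ⊗ₜ[ℂ] a') := fun t => by
    induction t using tensor_induction D.j with
    | zero => simp
    | add x y hx hy => simp only [map_add, LinearMap.add_apply, hx, hy]
    | tmul x y =>
      rw [TensorProduct.map_tmul, act_j, LinearMap.id_apply, pairing₂_tmul_tmul,
        pairing₂_tmul_tmul, Φ.fourier_apply (w * x), Φ.fourier_apply x, mul_assoc]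
  rw [h, D.pairing_T₁, D.pairing_T₁, act_j, pairing₂_V, pairing₂_V, Φ.fourier_apply, Φ.fourier_apply]
  simp only [mul_assoc]

/-- After evaluation of the first leg at `x`, coassociativity says that `T₁` commutes with the
action of `L a x` on its first leg. That is `T₁_act`, which comes from associativity of `A`. -/
theorem coassoc (a b c : B) :
    TensorProduct.assoc ℂ B B B (TensorProduct.map D.T₂.toLinearMap LinearMap.id
      ((TensorProduct.assoc ℂ B B B).symm (a ⊗ₜ[ℂ] D.T₁ (b ⊗ₜ[ℂ] c)))) =
    TensorProduct.map LinearMap.id D.T₁.toLinearMap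
      (TensorProduct.assoc ℂ B B B (D.T₂ (a ⊗ₜ[ℂ] b) ⊗ₜ[ℂ] c)) := by
  obtain ⟨a, rfl⟩ := D.j.surjective a
  refine tensor_ext_of_separating (f := (pairing Φ D.j).flip) (g := fun g : Module.Dual ℂ _ => g)
    (pairing_separating Φ D.j) (fun t ht => (Module.forall_dual_apply_eq_zero_iff ℂ t).mp ht)
    fun x g => ?_
  rw [← apply_lslice, ← apply_lslice]
  congr 1
  have h1 : ∀ t, lslice ((pairing Φ D.j).flip x) (TensorProduct.assoc ℂ B B B
      (TensorProduct.map D.T₂.toLinearMap LinearMap.id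
        ((TensorProduct.assoc ℂ B B B).symm (D.j a ⊗ₜ[ℂ] t)))) =
      TensorProduct.map (D.act (Φ.L a x)) LinearMap.id t := fun t => by
    induction t using TensorProduct.induction_on with
    | zero => simp
    | add x y hx hy => simp only [map_add, TensorProduct.tmul_add, hx, hy]
    | tmul p q =>
      have h2 : ∀ s : B ⊗[ℂ] B, lslice ((pairing Φ D.j).flip x)
          (TensorProduct.assoc ℂ B B B (s ⊗ₜ[ℂ] q)) =
          lslice ((pairing Φ D.j).flip x) s ⊗ₜ[ℂ] q := fun s => by
        induction s using TensorProduct.induction_on with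
        | zero => simp
        | add x y hx hy => simp only [map_add, TensorProduct.add_tmul, hx, hy]
        | tmul p q => simp [TensorProduct.smul_tmul']
      simp [h2, lslice_T₂]
  have h3 : ∀ s : B ⊗[ℂ] B, lslice ((pairing Φ D.j).flip x)
      (TensorProduct.map LinearMap.id D.T₁.toLinearMap
        (TensorProduct.assoc ℂ B B B (s ⊗ₜ[ℂ] c))) =
      D.T₁ (lslice ((pairing Φ D.j).flip x) s ⊗ₜ[ℂ] c) := fun s => by
    induction s using TensorProduct.induction_on with
    | zero => simp
    | add x y hx hy => simp only [map_add, TensorProduct.add_tmul, hx, hy]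
    | tmul p q => simp [← TensorProduct.smul_tmul']
  rw [h1, h3, lslice_T₂, T₁_act]

/-- The dual as a multiplier Hopf `*`-algebra. -/
def dual : MultiplierHopfStarAlgebra B where
  eq_zero_of_mul_right := D.eq_zero_of_mul_right
  eq_zero_of_mul_left := D.eq_zero_of_mul_left
  Δ := D.ΔHom
  Δ_nondegenerate := D.Δ_nondegenerate
  T₁ := D.T₁
  T₁_spec := D.incl_T₁
  T₂ := D.T₂
  T₂_spec := fun c b => D.incl_T₂ b c
  coassoc := D.coassoc

theorem counit_star_mul (c : A) : (𝒜.counit ∘ₗ D.j.symm.toLinearMap) (Star.star (D.j c) * D.j c) =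
    Φ.φ (Star.star c * c) := by
  rw [D.star, D.mul, LinearMap.comp_apply, LinearEquiv.coe_coe, LinearEquiv.symm_apply_apply,
    counit_conv, fourier_sharp_apply]

/-- The left integral `φ( · c) ↦ ε(c)` of the dual. -/
def dualIntegral : D.dual.PositiveLeftIntegral where
  φ := 𝒜.counit ∘ₗ D.j.symm.toLinearMap
  ne_zero := fun h => by
    have : Nontrivial A := by
      by_contra hA
      rw [not_nontrivial_iff_subsingleton] at hA
      exact Φ.ne_zero (LinearMap.ext fun a => by rw [Subsingleton.elim a 0, map_zero, map_zero])
    obtain ⟨e, he⟩ := 𝒜.counit_ne_zero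
    have := LinearMap.congr_fun h (D.j e)
    simp [he] at this
  left_invariant := fun a a' => by
    obtain ⟨a, rfl⟩ := D.j.surjective a
    obtain ⟨a', rfl⟩ := D.j.surjective a'
    -- Left invariance is the counit clause of the transpose of `Y`.
    refine (D.counit_T₂ a' a).trans ?_
    simp
  nonneg_re := fun a => by
    obtain ⟨a, rfl⟩ := D.j.surjective a
    rw [counit_star_mul]; exact Φ.nonneg_re a
  im_eq_zero := fun a => by
    obtain ⟨a, rfl⟩ := D.j.surjective a
    rw [counit_star_mul]; exact Φ.im_eq_zero a

theorem isOpDual : IsOpDual Φ D.dualIntegral (pairing Φ D.j) where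
  injective := Φ.fourier_injective.comp D.j.symm.injective
  range_eq := by rw [pairing, LinearMap.range_comp, LinearEquiv.range, LinearMap.range_eq_map]
  mul := fun b b' c d a hb hb' => by
    obtain ⟨b, rfl⟩ := D.j.surjective b
    obtain ⟨b', rfl⟩ := D.j.surjective b'
    rw [pairing_apply] at hb hb'
    rw [Φ.fourier_injective hb, Φ.fourier_injective hb', D.mul, pairing_apply, fourier_conv,
      dualDistrib_eq, ← T₁_tmulOne_right, rslice_tmulOne_right, Φ.fourier_apply, Φ.R_apply]
  star := fun b a => by
    obtain ⟨b, rfl⟩ := D.j.surjective b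
    rw [D.star, pairing_apply, pairing_apply, fourier_sharp]
  comul := fun b b' a a' => by
    simpa [pairing₂] using! D.pairing_T₁ (b ⊗ₜ b') (a ⊗ₜ a')
  integral := fun b a hb => by
    obtain ⟨b, rfl⟩ := D.j.surjective b
    rw [pairing_apply] at hb
    rw [Φ.fourier_injective hb]
    simp [dualIntegral]

end DualData

/-! ### The convolution `*`-algebra of the functionals `φ( · c)` -/

section DualAlgebra

variable {A : Type*} [NonUnitalRing A] [StarRing A] [Module ℂ A]
    [IsScalarTower ℂ A A] [SMulCommClass ℂ A A] [StarModule ℂ A]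
    {𝒜 : MultiplierHopfStarAlgebra A} (Φ : 𝒜.PositiveLeftIntegral)

/-- The space of functionals `φ( · c)`, parametrized by `c`. -/
def DualAlgebra (_ : 𝒜.PositiveLeftIntegral) : Type _ := A

namespace DualAlgebra

instance : AddCommGroup (DualAlgebra Φ) := inferInstanceAs (AddCommGroup A)

instance : Module ℂ (DualAlgebra Φ) := inferInstanceAs (Module ℂ A)

/-- The element representing `φ( · c)`. -/
def of : A ≃ₗ[ℂ] DualAlgebra Φ := LinearEquiv.refl ℂ A

/-- The functional represented by an element. -/
def functional : DualAlgebra Φ →ₗ[ℂ] Module.Dual ℂ A := Φ.fourier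

variable {Φ} in
theorem ext {x y : DualAlgebra Φ} (h : ∀ a, functional Φ x a = functional Φ y a) : x = y :=
  Φ.fourier_injective (LinearMap.ext h)

instance : Mul (DualAlgebra Φ) := ⟨fun x y => of Φ (Φ.conv ((of Φ).symm x) ((of Φ).symm y))⟩

instance : Star (DualAlgebra Φ) := ⟨fun x => of Φ (Φ.sharp ((of Φ).symm x))⟩

theorem functional_mul (x y : DualAlgebra Φ) (a : A) :
    functional Φ (x * y) a = functional Φ x (Φ.R ((of Φ).symm y) a) := Φ.fourier_conv _ _ _

theorem functional_mul' (x y : DualAlgebra Φ) (a : A) :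
    functional Φ (x * y) a = functional Φ y (Φ.L ((of Φ).symm x) a) :=
  (Φ.fourier_conv _ _ _).trans (Φ.fourier_L _ _ _).symm

theorem functional_star (x : DualAlgebra Φ) (a : A) : functional Φ (star x) a =
    (starRingEnd ℂ) (functional Φ x (star (𝒜.antipode a))) := Φ.fourier_sharp _ _

instance : NonUnitalRing (DualAlgebra Φ) where
  left_distrib x y z := ext fun a => by
    simp only [functional_mul', map_add, LinearMap.add_apply]
  right_distrib x y z := ext fun a => by
    simp only [functional_mul, map_add, LinearMap.add_apply]
  zero_mul x := ext fun a => by simp only [functional_mul, map_zero, LinearMap.zero_apply]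
  mul_zero x := ext fun a => by simp only [functional_mul', map_zero, LinearMap.zero_apply]
  mul_assoc x y z := ext fun a => by
    simp only [functional_mul]
    exact congrArg _ (Φ.R_conv _ _ _).symm

instance : IsScalarTower ℂ (DualAlgebra Φ) (DualAlgebra Φ) :=
  ⟨fun c x y => ext fun a => by
    simp only [smul_eq_mul, functional_mul, map_smul, LinearMap.smul_apply]⟩

instance : SMulCommClass ℂ (DualAlgebra Φ) (DualAlgebra Φ) :=
  ⟨fun c x y => ext fun a => by
    simp only [smul_eq_mul, functional_mul', map_smul, LinearMap.smul_apply]⟩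

instance : StarRing (DualAlgebra Φ) where
  star_involutive x := ext fun a => by
    simp only [functional_star, star_antipode_star_antipode, Complex.conj_conj]
  star_mul x y := ext fun a => by
    rw [functional_star, functional_mul, functional_mul', functional_star]
    -- Anti-multiplicativity is `L_sharp` at `S(a)^*`, since `a ↦ S(a)^*` is an involution.
    have h := Φ.L_sharp ((of Φ).symm y) (star (𝒜.antipode a))
    rw [star_antipode_star_antipode] at h
    change _ = (starRingEnd ℂ) (functional Φ x
      (star (𝒜.antipode (Φ.L (Φ.sharp ((of Φ).symm y)) a))))
    rw [h, star_antipode_star_antipode]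
  star_add x y := ext fun a => by
    simp only [functional_star, map_add, LinearMap.add_apply]

instance : StarModule ℂ (DualAlgebra Φ) :=
  ⟨fun c x => ext fun a => by
    simp only [functional_star, map_smul, LinearMap.smul_apply, smul_eq_mul, map_mul]
    rfl⟩

/-- The convolution algebra `{φ( · c)}` with the transposes of `V` and of `a ⊗ a' ↦ Δ(a)(1 ⊗ a')`. -/
def data : DualData Φ (DualAlgebra Φ) where
  j := of Φ
  mul _ _ := rfl
  star _ := rfl
  T₁ := Φ.exists_transpose_V.choose
  pairing_T₁ := Φ.exists_transpose_V.choose_spec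
  T₂ := Φ.exists_transpose_Y.choose
  pairing_T₂ s a a' := Φ.exists_transpose_Y.choose_spec.2 s (a ⊗ₜ a')
  counit_T₂ := Φ.exists_transpose_Y.choose_spec.1

end DualAlgebra

end DualAlgebra

/-! ### The Fourier transform onto an arbitrary realization of the dual -/

namespace IsOpDual

section Pairing

variable {A : Type*} [NonUnitalRing A] [StarRing A] [Module ℂ A]
    [IsScalarTower ℂ A A] [SMulCommClass ℂ A A] [StarModule ℂ A]
    {𝒜 : MultiplierHopfStarAlgebra A} {Φ : 𝒜.PositiveLeftIntegral}
  {B : Type*} [NonUnitalRing B] [Module ℂ B] {p : B →ₗ[ℂ] Module.Dual ℂ A} {j : A ≃ₗ[ℂ] B}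

theorem pairing_eq (hj : ∀ c, p (j c) = Φ.fourier c) : pairing Φ j = p := by
  ext b a
  obtain ⟨b, rfl⟩ := j.surjective b
  rw [pairing_apply, hj]

/-- Evaluating `S⁻¹(x₍₁₎)c ⊗ x₍₂₎` at `a` gives `φ(aS⁻¹(x₍₁₎)c)x₍₂₎`. The left cover `S(c)` in
`W_tmul` and the right cover `S(a)` are exchanged by `T₂_tmulOne_right`. -/
theorem isTwist (hj : ∀ c, p (j c) = Φ.fourier c) (c x : A) : IsTwist 𝒜 p (j c) x
    (TensorProduct.map j.toLinearMap LinearMap.id (𝒜.W (c ⊗ₜ[ℂ] x))) := fun a => by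
  have h1 : ∀ t : A ⊗[ℂ] A, TensorProduct.lid ℂ A (TensorProduct.map (p.flip a) LinearMap.id
      (TensorProduct.map j.toLinearMap LinearMap.id
        (TensorProduct.map 𝒜.antipode.symm.toLinearMap LinearMap.id t))) =
      lslice (Φ.φ ∘ₗ 𝒜.antipode.symm.toLinearMap) ((tmulOne (𝒜.antipode a)).right t) := fun t => by
    induction t using TensorProduct.induction_on with
    | zero => simp
    | add x y hx hy => simp only [map_add, hx, hy]
    | tmul u v => simp [hj, Φ.fourier_apply, antipode_symm_mul]
  have h2 : ∀ t : A ⊗[ℂ] A,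
      lslice (Φ.φ ∘ₗ 𝒜.antipode.symm.toLinearMap) ((tmulOne (𝒜.antipode c)).left t) =
      TensorProduct.lid ℂ A (TensorProduct.map (p (j c) ∘ₗ 𝒜.antipode.symm.toLinearMap)
        LinearMap.id t) := fun t => by
    induction t using TensorProduct.induction_on with
    | zero => simp
    | add x y hx hy => simp only [map_add, hx, hy]
    | tmul u v => simp [hj, Φ.fourier_apply, antipode_symm_mul]
  rw [W_tmul, h1, T₂_tmulOne_right, h2]

end Pairing

variable {A : Type*} [NonUnitalRing A] [StarRing A] [Module ℂ A]
    [IsScalarTower ℂ A A] [SMulCommClass ℂ A A] [StarModule ℂ A]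
    {𝒜 : MultiplierHopfStarAlgebra A}
  {B : Type*} [NonUnitalRing B] [StarRing B] [Module ℂ B]
    [IsScalarTower ℂ B B] [SMulCommClass ℂ B B] [StarModule ℂ B]
    {ℬ : MultiplierHopfStarAlgebra B}
  {Φ : 𝒜.PositiveLeftIntegral} {Ψ : ℬ.PositiveLeftIntegral} {p : B →ₗ[ℂ] Module.Dual ℂ A}

theorem exists_equiv (h : IsOpDual Φ Ψ p) : ∃ j : A ≃ₗ[ℂ] B, ∀ c, p (j c) = Φ.fourier c :=
  exists_equiv_of_range_eq h.injective Φ.fourier_injective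
    (fun y => (h.range_eq ▸ LinearMap.mem_range_self Φ.fourier y : Φ.fourier y ∈ LinearMap.range p))
    (fun x => ((h.range_eq ▸ LinearMap.mem_range_self p x :
      p x ∈ LinearMap.range Φ.fourier)).imp fun _ h => h.symm)

variable {j : A ≃ₗ[ℂ] B}

theorem map_conv (h : IsOpDual Φ Ψ p) (hj : ∀ c, p (j c) = Φ.fourier c) (c d : A) :
    j c * j d = j (Φ.conv c d) :=
  h.injective <| LinearMap.ext fun a => by
    rw [h.mul _ _ c d a (hj c) (hj d), hj, fourier_conv, dualDistrib_eq, ← T₁_tmulOne_right,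
      rslice_tmulOne_right, Φ.fourier_apply, Φ.R_apply]

theorem map_sharp (h : IsOpDual Φ Ψ p) (hj : ∀ c, p (j c) = Φ.fourier c) (c : A) :
    Star.star (j c) = j (Φ.sharp c) :=
  h.injective <| LinearMap.ext fun a => by rw [h.star, hj, hj, fourier_sharp]

/-- The left side is `ε(c^♯ ⋆ d)`, so `counit_conv` applies. This makes the Fourier transform
isometric. -/
theorem plancherel (h : IsOpDual Φ Ψ p) (hj : ∀ c, p (j c) = Φ.fourier c) (c d : A) :
    Ψ.φ (Star.star (j c) * j d) = Φ.φ (Star.star c * d) := by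
  rw [h.map_sharp hj, h.map_conv hj, h.integral _ _ (hj _), counit_conv, fourier_sharp_apply]

theorem pairing₂_T₁ (h : IsOpDual Φ Ψ p) (hj : ∀ c, p (j c) = Φ.fourier c) (b c a a' : A) :
    pairing₂ Φ j (ℬ.T₁ (j b ⊗ₜ[ℂ] j c)) (a ⊗ₜ[ℂ] a') = Φ.fourier b (Φ.R c a' * a) := by
  rw [← pairing₂_V Φ j, pairing₂, pairing_eq hj]
  exact h.comul _ _ _ _

theorem pairing₂_dual_V (h : IsOpDual Φ Ψ p) (hj : ∀ c, p (j c) = Φ.fourier c) (c c' a a' : A) :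
    pairing₂ Φ j (ℬ.V (j c ⊗ₜ[ℂ] j c')) (a ⊗ₜ[ℂ] a') = Φ.fourier c' (a' * Φ.R c a) := by
  have key : (TensorProduct.mk ℂ A A).compr₂ (pairing₂ Φ j (ℬ.V (j c ⊗ₜ[ℂ] j c'))) =
      ((LinearMap.mul ℂ A).flip.compr₂ (Φ.fourier c')) ∘ₗ Φ.R c :=
    Φ.ext_R fun e a => Φ.ext_R fun b a' => by
      refine LinearMap.congr_fun (f := (TensorProduct.mk ℂ A A).compr₂
        (pairing₂ Φ j (ℬ.V (j c ⊗ₜ[ℂ] j c'))) (Φ.R e a) ∘ₗ Φ.R b)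
        (g := (((LinearMap.mul ℂ A).flip.compr₂ (Φ.fourier c')) ∘ₗ Φ.R c) (Φ.R e a) ∘ₗ Φ.R b)
        (Φ.ext_R fun d a' => ?_) a'
      -- Only `T₁` of the dual is prescribed. Multiplying `V` by `e ⊗ bd` leads to it, as `Δ(c')(ce
      -- ⊗ bd) = T₁(c' ⊗ b)(ce ⊗ d)`; the covers are then absorbed because the elements `R d a` span
      -- `A`.
      have h1 := pairing₂_mul_tmul Φ j (h.map_conv hj) (ℬ.V (j c ⊗ₜ[ℂ] j c')) e (Φ.conv b d) a a'
      rw [← h.map_conv hj b d, V_mul, ← T₁_mul, h.map_conv hj,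
        pairing₂_mul_tmul Φ j (h.map_conv hj), h.pairing₂_T₁ hj, R_conv, R_conv] at h1
      exact h1.symm
  exact LinearMap.congr_fun (LinearMap.congr_fun key a) a'

/-- Paired with `a ⊗ a'`, both sides are `φ(a'(R c a)c')`: on the right, `rslice_W_tmul` evaluates
the leg of `W(c' ⊗ c)` that meets `a`. This is the algebraic form of the duality between the two
regular representations. -/
theorem V_tmul (h : IsOpDual Φ Ψ p) (hj : ∀ c, p (j c) = Φ.fourier c) (c c' : A) :
    ℬ.V (j c ⊗ₜ[ℂ] j c') = TensorProduct.comm ℂ B B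
      (TensorProduct.map j.toLinearMap j.toLinearMap (𝒜.W (c' ⊗ₜ[ℂ] c))) := by
  refine pairing₂_ext Φ j fun a a' => ?_
  have h1 : ∀ t, pairing₂ Φ j (TensorProduct.comm ℂ B B
      (TensorProduct.map j.toLinearMap j.toLinearMap t)) (a ⊗ₜ[ℂ] a') =
      Φ.φ (a' * rslice Φ.φ ((oneTmul a).left t)) := fun t => by
    induction t using TensorProduct.induction_on with
    | zero => simp
    | add x y hx hy => simp only [map_add, LinearMap.add_apply, mul_add, hx, hy]
    | tmul u v => simp [pairing₂_tmul_tmul, Φ.fourier_apply, mul_smul_comm]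
  rw [h.pairing₂_dual_V hj, h1, rslice_W_tmul, Φ.fourier_apply, mul_assoc, Φ.R_apply]

theorem V_map_comm (h : IsOpDual Φ Ψ p) (hj : ∀ c, p (j c) = Φ.fourier c) (t : A ⊗[ℂ] A) :
    ℬ.V (TensorProduct.comm ℂ B B (TensorProduct.map j.toLinearMap j.toLinearMap t)) =
      TensorProduct.comm ℂ B B (TensorProduct.map j.toLinearMap j.toLinearMap (𝒜.W t)) := by
  induction t using TensorProduct.induction_on with
  | zero => simp
  | add x y hx hy => simp only [map_add, hx, hy]
  | tmul u v => exact h.V_tmul hj v u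

theorem norm_η (h : IsOpDual Φ Ψ p) (hj : ∀ c, p (j c) = Φ.fourier c) (c : A) :
    ‖Ψ.η (j c)‖ = ‖Φ.η c‖ := by
  rw [@norm_eq_sqrt_re_inner ℂ, @norm_eq_sqrt_re_inner ℂ, inner_η, inner_η, h.plancherel hj]

/-- The Fourier transform as a unitary between the GNS spaces. -/
def fourierUnitary (h : IsOpDual Φ Ψ p) (hj : ∀ c, p (j c) = Φ.fourier c) : Φ.GNS ≃ₗᵢ[ℂ] Ψ.GNS :=
  j.extendOfIsometry Φ.η Ψ.η (denseRange_η Φ) (denseRange_η Ψ) (h.norm_η hj)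

theorem fourierUnitary_η (h : IsOpDual Φ Ψ p) (hj : ∀ c, p (j c) = Φ.fourier c) (c : A) :
    h.fourierUnitary hj (Φ.η c) = Ψ.η (j c) :=
  LinearEquiv.extendOfIsometry_eq _ _ _ _ _ _ c

theorem exists_unitaries (h : IsOpDual Φ Ψ p) : ∃ (F : Φ.GNS ≃ₗᵢ[ℂ] Ψ.GNS)
    (U : HilbertTensor Ψ.GNS Φ.GNS ≃ₗᵢ[ℂ] HilbertTensor Ψ.GNS Φ.GNS)
    (W' : HilbertTensor Ψ.GNS Ψ.GNS ≃ₗᵢ[ℂ] HilbertTensor Ψ.GNS Ψ.GNS),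
    (∀ (a : A) (b : B), p b = Φ.fourier a → F (Φ.η a) = Ψ.η b) ∧
    (∀ ξ, U (HilbertTensor.congr F (LinearIsometryEquiv.refl ℂ Φ.GNS) ξ) =
      HilbertTensor.congr F (LinearIsometryEquiv.refl ℂ Φ.GNS) (regularRep Φ ξ)) ∧
    (∀ (y : B) (x : A), ∃ z : B ⊗[ℂ] A,
      IsTwist 𝒜 p y x z ∧ U (tensorη Ψ Φ (y ⊗ₜ[ℂ] x)) = tensorη Ψ Φ z) ∧
    ExtendsW Ψ W' ∧
    ∀ ξ, HilbertTensor.congr F F (regularRep Φ ((HilbertTensor.congr F F).symm ξ)) =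
      HilbertTensor.flip Ψ.GNS Ψ.GNS (ContinuousLinearMap.adjoint
        (W' : HilbertTensor Ψ.GNS Ψ.GNS →L[ℂ] HilbertTensor Ψ.GNS Ψ.GNS)
        (HilbertTensor.flip Ψ.GNS Ψ.GNS ξ)) := by
  obtain ⟨j, hj⟩ := h.exists_equiv
  set F := h.fourierUnitary hj
  have hF : ∀ a, F (Φ.η a) = Ψ.η (j.toLinearMap a) := h.fourierUnitary_η hj
  set C := HilbertTensor.congr F (LinearIsometryEquiv.refl ℂ Φ.GNS)
  have hC : ∀ t, C (tensorη Φ Φ t) = tensorη Ψ Φ (TensorProduct.map j.toLinearMap LinearMap.id t) :=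
    congr_tensorη Φ Φ Ψ Φ hF fun _ => rfl
  have hU : ∀ ξ, (C.symm.trans ((regularRep Φ).trans C)) (C ξ) = C (regularRep Φ ξ) := fun ξ => by
    simp
  refine ⟨F, C.symm.trans ((regularRep Φ).trans C), regularRep Ψ, fun a b hb => ?_, hU,
    fun y x => ?_, extendsW_regularRep Ψ, fun ξ => ?_⟩
  · rw [hF, LinearEquiv.coe_coe, h.injective (hb.trans (hj a).symm)]
  · obtain ⟨c, rfl⟩ := j.surjective y
    refine ⟨_, isTwist hj c x, ?_⟩
    have h1 := hC (c ⊗ₜ x)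
    rw [TensorProduct.map_tmul, LinearMap.id_apply, LinearEquiv.coe_coe] at h1
    rw [← h1, hU, extendsW_regularRep, hC]
  · obtain ⟨ξ, rfl⟩ := (HilbertTensor.congr F F).surjective ξ
    -- The adjoint is the inverse, which extends `V` of the dual, so by density the claim reduces to
    -- `V_map_comm`.
    rw [LinearIsometryEquiv.symm_apply_apply, adjoint_regularRep]
    refine eq_of_tensorη Φ Φ (f := fun ξ => HilbertTensor.congr F F (regularRep Φ ξ))
      (g := fun ξ => HilbertTensor.flip Ψ.GNS Ψ.GNS ((regularRep Ψ).symm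
        (HilbertTensor.flip Ψ.GNS Ψ.GNS (HilbertTensor.congr F F ξ))))
      (by fun_prop) (by fun_prop) (fun t => ?_) ξ
    rw [extendsW_regularRep, congr_tensorη Φ Φ Ψ Ψ hF hF, congr_tensorη Φ Φ Ψ Ψ hF hF,
      flip_tensorη, regularRep_symm_tensorη, h.V_map_comm hj, flip_tensorη]
    congr 1
    exact ((TensorProduct.comm ℂ B B).symm_apply_apply _).symm

end IsOpDual

end AlgQG

end

theorem proposition4p4 {A : Type u} [NonUnitalRing A] [StarRing A] [Module ℂ A]
    [IsScalarTower ℂ A A] [SMulCommClass ℂ A A] [StarModule ℂ A]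
    (𝒜 : MultiplierHopfStarAlgebra A) (Φ : 𝒜.PositiveLeftIntegral) :
    ∃ W : HilbertTensor Φ.GNS Φ.GNS ≃ₗᵢ[ℂ] HilbertTensor Φ.GNS Φ.GNS,
      -- `W` extends the algebraic map, and it is the only bounded operator that does
      ExtendsW Φ W ∧
      (∀ T : HilbertTensor Φ.GNS Φ.GNS →L[ℂ] HilbertTensor Φ.GNS Φ.GNS,
        (∀ t : A ⊗[ℂ] A, T (tensorη Φ Φ t) = tensorη Φ Φ (𝒜.W t)) → ∀ ξ, T ξ = W ξ) ∧
      -- `W(η(x) ⊗ η(x')) = η(S⁻¹(x'₍₁₎)x) ⊗ η(x'₍₂₎)`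
      (∀ x x' : A, W (tensorη Φ Φ (x ⊗ₜ[ℂ] x')) =
        tensorη Φ Φ (TensorProduct.map 𝒜.antipode.symm.toLinearMap LinearMap.id
          (𝒜.T₂ (𝒜.antipode x ⊗ₜ[ℂ] x')))) ∧
      -- `W^*(η(x) ⊗ η(x')) = η(x'₍₁₎x) ⊗ η(x'₍₂₎)`
      (∀ x x' : A, ContinuousLinearMap.adjoint
          (W : HilbertTensor Φ.GNS Φ.GNS →L[ℂ] HilbertTensor Φ.GNS Φ.GNS)
          (tensorη Φ Φ (x ⊗ₜ[ℂ] x')) = tensorη Φ Φ (𝒜.V (x ⊗ₜ[ℂ] x'))) ∧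
      -- the dual exists
      (∃ (B : Type u) (_ : NonUnitalRing B) (_ : StarRing B) (_ : Module ℂ B)
        (_ : IsScalarTower ℂ B B) (_ : SMulCommClass ℂ B B) (_ : StarModule ℂ B)
        (ℬ : MultiplierHopfStarAlgebra B) (Ψ : ℬ.PositiveLeftIntegral)
        (p : B →ₗ[ℂ] Module.Dual ℂ A), IsOpDual Φ Ψ p) ∧
      -- and for every realization of the dual
      ∀ (B : Type v) [NonUnitalRing B] [StarRing B] [Module ℂ B]
        [IsScalarTower ℂ B B] [SMulCommClass ℂ B B] [StarModule ℂ B]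
        (ℬ : MultiplierHopfStarAlgebra B) (Ψ : ℬ.PositiveLeftIntegral)
        (p : B →ₗ[ℂ] Module.Dual ℂ A), IsOpDual Φ Ψ p →
        ∃ (F : Φ.GNS ≃ₗᵢ[ℂ] Ψ.GNS)
          (U : HilbertTensor Ψ.GNS Φ.GNS ≃ₗᵢ[ℂ] HilbertTensor Ψ.GNS Φ.GNS)
          (W' : HilbertTensor Ψ.GNS Ψ.GNS ≃ₗᵢ[ℂ] HilbertTensor Ψ.GNS Ψ.GNS),
          -- `F` is the Fourier transform `a ↦ φ( · a)`
          (∀ (a : A) (b : B), p b = Φ.fourier a → F (Φ.η a) = Ψ.η b) ∧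
          -- `U = (F ⊗ 1)W(F ⊗ 1)^*`
          (∀ ξ, U (HilbertTensor.congr F (LinearIsometryEquiv.refl ℂ Φ.GNS) ξ) =
            HilbertTensor.congr F (LinearIsometryEquiv.refl ℂ Φ.GNS) (W ξ)) ∧
          -- `U(η(y) ⊗ η(x)) = ⟨S⁻¹(x₍₁₎), y₍₁₎⟩ η(y₍₂₎) ⊗ η(x₍₂₎)`
          (∀ (y : B) (x : A), ∃ z : B ⊗[ℂ] A,
            IsTwist 𝒜 p y x z ∧ U (tensorη Ψ Φ (y ⊗ₜ[ℂ] x)) = tensorη Ψ Φ z) ∧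
          -- `W'` is the left regular representation of `B`
          ExtendsW Ψ W' ∧
          -- `(F ⊗ F)W(F ⊗ F)^* = Σ W'^* Σ`
          ∀ ξ, HilbertTensor.congr F F (W ((HilbertTensor.congr F F).symm ξ)) =
            HilbertTensor.flip Ψ.GNS Ψ.GNS (ContinuousLinearMap.adjoint
              (W' : HilbertTensor Ψ.GNS Ψ.GNS →L[ℂ] HilbertTensor Ψ.GNS Ψ.GNS)
              (HilbertTensor.flip Ψ.GNS Ψ.GNS ξ)) := by
  refine ⟨regularRep Φ, extendsW_regularRep Φ, fun T hT => ?_, fun x x' => ?_, fun x x' => ?_,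
    ⟨DualAlgebra Φ, inferInstance, inferInstance, inferInstance, inferInstance, inferInstance,
      inferInstance, (DualAlgebra.data Φ).dual, (DualAlgebra.data Φ).dualIntegral, _,
      (DualAlgebra.data Φ).isOpDual⟩, fun B _ _ _ _ _ _ ℬ Ψ p h => h.exists_unitaries⟩
  · exact eq_of_tensorη Φ Φ T.continuous (regularRep Φ).continuous fun t =>
      (hT t).trans (extendsW_regularRep Φ t).symm
  · rw [extendsW_regularRep, W_tmul]
  · rw [adjoint_regularRep, regularRep_symm_tensorη]
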